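/- **Words and necklaces.** Let $q\ge 0$, $d\ge 0$ and let $n=(n_1,\dots,n_d)$ be integers with $1\le n_1\le n_2\le\dots\le n_d$; put $N=\prod_{i=1}^d n_i$ (so $N=1$ if $d=0$). A $d$-dimensional word of size $n$ over the ordered alphabet $\{1<2<\dots<q\}$ is an array $w=(w_p)$ indexed by $p\in Z_n=\mathbb Z_{n_1}\times\dots\times\mathbb Z_{n_d}$. The translation of $w$ by $g\in Z_n$ is the word $\langle w\rangle_g$ with $(\langle w\rangle_g)_p=w_{p+g}$. A necklace is an equivalence class of words of size $n$ under translation, and $\mathcal N_q^{n}$ is the set of these necklaces. The index of $g\in Z_n$ (with $0\le g_i<n_i$) is $\sum_{i=1}^d g_i\prod_{j<i}n_j$; translations are ordered by their index. **Order.** The words of size $n$ are ordered by recursion on $d$. A word of dimension $0$ is a single letter, and these are ordered as the alphabet. If $d\ge 1$, the $k$-th slice $w_k$ of $w$ is the $(d-1)$-dimensional word of size $(n_1,\dots,n_{d-1})$ obtained by fixing the last coordinate to $k$. For words $u\ne v$ of size $n$ let $k$ be the smallest index with $u_k\ne v_k$; let $a$ and $b$ be the smallest words of the translation classes of $u_k$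 and $v_k$, and let $G(u_k,a)$, $G(v_k,b)$ be the smallest indices of translations that take $u_k$ to $a$ and $v_k$ to $b$. Then $u<v$ if and only if $a<b$, or $a=b$ and $G(u_k,a)<G(v_k,b)$. The canonical representation of a necklace is its smallest word; necklaces are compared through their canonical representations. The rank of a necklace in $\mathcal N_q^{n}$ is the number of necklaces in $\mathcal N_q^{n}$ that are smaller. **Machine.** A random access machine has registers and a memory, each indexed by $\mathbb N$ and holding natural numbers. A program is a finite list of instructions: set a register to a constant; addition, truncated subtraction, multiplication, and division with rounding down (with $x/0=0$), of registers; load from, or store to, the memory cell whose address is in a register; unconditional jump; jump if a register is zero; halt. Every instruction takes one step. The input is $d$ in register $0$, $q$ in register $1$, the sizes $n_1,\dots,n_d$ in the memory cells $0,\dots,d-1$, and the $N$ letters of a word $w$ in the memory cells $d,\dots,d+N-1$, ordered by the index of their positions; all other cells and registers are $0$. The output is the content of register $0$ at the end. **Theorem.** The rank of a $d$-dimensional necklace in $\mathcal N_q^{n}$ can be computed in $O(N^5)$ time. Precisely: there are one program and one constant $C$ such that for all $d$, $q$, $n$ as above and every word $w$ of size $n$ over $\{1,\dots,q\}$, the program,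 started on the input $w$, halts after at most $C\,N^5$ steps with the rank of the necklace of $w$ in $\mathcal N_q^{n}$ as its output, and all numbers that occur in registers and memory during the computation are at most $(d+q+N)^{C N}$ (that is, each arithmetic operation is on numbers of $O(N\log(d+q+N))$ bits). -/

import Mathlib

namespace MultiNecklace

/-! ### Multidimensional words, translations, necklaces -/

/-- Positions of an array of size `n = (n₁, …, n_d)`, counted from `0`. As an additive group
(coordinatewise addition modulo `nᵢ`) this is also the group `Z_n` of translations. -/
abbrev Pos {d : ℕ} (n : Fin d → ℕ) : Type := (i : Fin d) → Fin (n i)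

/-- The `d`-dimensional words of size `n` over an alphabet of `q` letters. The element `a` of
`Fin q` stands for the letter `a + 1` of the ordered alphabet `{1, …, q}`. -/
abbrev Word (q : ℕ) {d : ℕ} (n : Fin d → ℕ) : Type := Pos n → Fin q

/-- The translation of `w` by `g`: its letter at `p` is the letter of `w` at `p + g`. -/
def translate {q d : ℕ} {n : Fin d → ℕ} (g : Pos n) (w : Word q n) : Word q n :=
  fun p => w (fun i => p i + g i)

/-- The index `∑ᵢ gᵢ ∏_{j < i} nⱼ` of a translation (or of a position). -/
def index {d : ℕ} {n : Fin d → ℕ} (g : Pos n) : ℕ :=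
  ∑ i, (g i : ℕ) * ∏ j ∈ Finset.Iio i, n j

/-- Two words are equivalent if one is a translation of the other. -/
def TransEquiv {q d : ℕ} {n : Fin d → ℕ} (u v : Word q n) : Prop :=
  ∃ g : Pos n, translate g u = v

/-- The `k`-th slice of a `(d+1)`-dimensional word: the last coordinate is fixed to `k`. -/
def slice {q d : ℕ} {n : Fin (d + 1) → ℕ} (w : Word q n) (k : Fin (n (Fin.last d))) :
    Word q (fun i : Fin d => n i.castSucc) :=
  fun p => w (Fin.snoc (α := fun i => Fin (n i)) p k)

/-- `c` is the smallest element, for the relation `lt`, of the translation class of `u`. -/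
def IsCanonicalFor {q d : ℕ} {n : Fin d → ℕ} (lt : Word q n → Word q n → Prop)
    (u c : Word q n) : Prop :=
  TransEquiv u c ∧ ∀ v, TransEquiv u v → v ≠ c → lt c v

/-- The index of the smallest translation `g` that takes `u` to `s`
(used only for equivalent `u` and `s`). -/
noncomputable def minIndex {q d : ℕ} {n : Fin d → ℕ} (u s : Word q n) : ℕ :=
  sInf {m | ∃ g : Pos n, translate g u = s ∧ index g = m}

/-- The recursive ordering of words. In dimension `0` a word is a single letter. In dimension
`d + 1`, two words are compared at the first slice in which they differ: first by the canonical
representations of the two slices, then, if these agree, by the index of the smallest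
translation that takes the slice to its canonical representation. -/
def wordLT {q : ℕ} : {d : ℕ} → (n : Fin d → ℕ) → Word q n → Word q n → Prop
  | 0, _, u, v => u (fun i => i.elim0) < v (fun i => i.elim0)
  | d + 1, n, u, v =>
      ∃ k : Fin (n (Fin.last d)), (∀ j < k, slice u j = slice v j) ∧ slice u k ≠ slice v k ∧
        ∃ a b : Word q (fun i : Fin d => n i.castSucc),
          IsCanonicalFor (wordLT (fun i : Fin d => n i.castSucc)) (slice u k) a ∧
          IsCanonicalFor (wordLT (fun i : Fin d => n i.castSucc)) (slice v k) b ∧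
          (wordLT (fun i : Fin d => n i.castSucc) a b ∨
            (a = b ∧ minIndex (slice u k) a < minIndex (slice v k) b))

/-- `c` is the canonical representation of the necklace that contains `u`. -/
def IsCanonical {q d : ℕ} {n : Fin d → ℕ} (u c : Word q n) : Prop :=
  IsCanonicalFor (wordLT n) u c

theorem transEquiv_equivalence (q : ℕ) {d : ℕ} (n : Fin d → ℕ) [∀ i, NeZero (n i)] :
    Equivalence (TransEquiv (q := q) (n := n)) where
  refl u := ⟨0, by funext p; simp [translate]⟩
  symm := by
    rintro u v ⟨g, rfl⟩
    refine ⟨-g, ?_⟩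
    funext p
    simp [translate, add_assoc]
  trans := by
    rintro u v w ⟨g, rfl⟩ ⟨h, rfl⟩
    refine ⟨h + g, ?_⟩
    funext p
    simp [translate, add_assoc]

/-- Translation equivalence on the words of size `n`. -/
instance transSetoid (q : ℕ) {d : ℕ} (n : Fin d → ℕ) [∀ i, NeZero (n i)] :
    Setoid (Word q n) where
  r := TransEquiv
  iseqv := transEquiv_equivalence q n

/-- The set `N_q^n` of necklaces of size `n` over an alphabet of `q` letters. -/
def Necklace (q : ℕ) {d : ℕ} (n : Fin d → ℕ) [∀ i, NeZero (n i)] : Type :=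
  Quotient (transSetoid q n)

/-- The necklace of a word. -/
def Necklace.mk {q d : ℕ} {n : Fin d → ℕ} [∀ i, NeZero (n i)] (w : Word q n) : Necklace q n :=
  Quotient.mk (transSetoid q n) w

/-- Necklaces are compared through their canonical representations. -/
def Necklace.LT {q d : ℕ} {n : Fin d → ℕ} [∀ i, NeZero (n i)] (x y : Necklace q n) : Prop :=
  ∃ a b : Word q n, Necklace.mk a = x ∧ Necklace.mk b = y ∧
    IsCanonical a a ∧ IsCanonical b b ∧ wordLT n a b

/-- The rank of a necklace: the number of smaller necklaces of the same size. -/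
noncomputable def Necklace.rank {q d : ℕ} {n : Fin d → ℕ} [∀ i, NeZero (n i)]
    (x : Necklace q n) : ℕ :=
  Set.ncard {y : Necklace q n | Necklace.LT y x}

/-! ### The random access machine

A machine has registers and a memory, both indexed by `ℕ` and holding natural numbers. A program
is a finite list of instructions, hence names only finitely many registers; the memory is
reached through addresses held in registers. Every instruction takes one step. -/

/-- The instructions. -/
inductive Instr : Type
  /-- `reg i := c` -/
  | const (i c : ℕ)
  /-- `reg i := reg j + reg k` -/
  | add (i j k : ℕ)
  /-- `reg i := reg j - reg k`, truncated at `0` -/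
  | sub (i j k : ℕ)
  /-- `reg i := reg j * reg k` -/
  | mul (i j k : ℕ)
  /-- `reg i := ⌊reg j / reg k⌋`, with value `0` if `reg k = 0` -/
  | div (i j k : ℕ)
  /-- `reg i := mem (reg j)` -/
  | load (i j : ℕ)
  /-- `mem (reg i) := reg j` -/
  | store (i j : ℕ)
  /-- go to instruction `l` -/
  | jump (l : ℕ)
  /-- go to instruction `l` if `reg i = 0` -/
  | jumpZero (i l : ℕ)
  /-- stop -/
  | halt

/-- A program is a finite list of instructions, numbered from `0`. -/
abbrev Program : Type := List Instr

/-- A configuration of the machine. -/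
structure Config : Type where
  /-- the number of the next instruction -/
  pc : ℕ
  /-- the registers -/
  reg : ℕ → ℕ
  /-- the memory -/
  mem : ℕ → ℕ

/-- The effect of one instruction. -/
def Instr.exec (c : Config) : Instr → Config
  | .const i a => ⟨c.pc + 1, Function.update c.reg i a, c.mem⟩
  | .add i j k => ⟨c.pc + 1, Function.update c.reg i (c.reg j + c.reg k), c.mem⟩
  | .sub i j k => ⟨c.pc + 1, Function.update c.reg i (c.reg j - c.reg k), c.mem⟩
  | .mul i j k => ⟨c.pc + 1, Function.update c.reg i (c.reg j * c.reg k), c.mem⟩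
  | .div i j k => ⟨c.pc + 1, Function.update c.reg i (c.reg j / c.reg k), c.mem⟩
  | .load i j => ⟨c.pc + 1, Function.update c.reg i (c.mem (c.reg j)), c.mem⟩
  | .store i j => ⟨c.pc + 1, c.reg, Function.update c.mem (c.reg i) (c.reg j)⟩
  | .jump l => ⟨l, c.reg, c.mem⟩
  | .jumpZero i l => ⟨if c.reg i = 0 then l else c.pc + 1, c.reg, c.mem⟩
  | .halt => c

/-- The machine has stopped: it is at a `halt`, or past the end of the program. -/
def Program.Halted (P : Program) (c : Config) : Prop :=
  P[c.pc]? = none ∨ P[c.pc]? = some Instr.halt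

/-- One step of the machine; a machine that has stopped does not move any more. -/
def Program.step (P : Program) (c : Config) : Config :=
  match P[c.pc]? with
  | none => c
  | some a => a.exec c

/-- All the numbers in a configuration are at most `B`. -/
def Config.Bounded (B : ℕ) (c : Config) : Prop :=
  (∀ i, c.reg i ≤ B) ∧ ∀ a, c.mem a ≤ B

/-- Started in `c`, the program stops after at most `T` steps with the number `r` in register
`0`, and no number larger than `B` ever occurs on the way. -/
def Program.Computes (P : Program) (c : Config) (r T B : ℕ) : Prop :=
  ∃ t ≤ T, P.Halted (P.step^[t] c) ∧ (P.step^[t] c).reg 0 = r ∧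
    ∀ s ≤ t, (P.step^[s] c).Bounded B

/-- The initial configuration for the input `w`. Register `0` holds `d`, register `1` holds `q`;
the memory holds `n₁, …, n_d` at the addresses `0, …, d - 1` and then, from the address `d` on, the
`∏ nᵢ` letters (numbers in `{1, …, q}`) of `w` in the order of the index of their positions.
Everything else is `0`. -/
def input {q d : ℕ} {n : Fin d → ℕ} (w : Word q n) : Config where
  pc := 0
  reg i := if i = 0 then d else if i = 1 then q else 0
  mem a :=
    if h : a < d then n ⟨a, h⟩
    else if h : a - d < ∏ i, n i then (w (finPiFinEquiv.symm ⟨a - d, h⟩) : ℕ) + 1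
    else 0

/-- `finPiFinEquiv` numbers the positions by their index. -/
theorem index_eq_finPiFinEquiv {d : ℕ} {n : Fin d → ℕ} (p : Pos n) :
    index p = (finPiFinEquiv p : ℕ) := by
  rw [index, finPiFinEquiv_apply]
  refine Finset.sum_congr rfl fun i _ => ?_
  congr 1
  refine (Finset.prod_bij (fun (j : Fin i) _ => Fin.castLE i.is_lt.le j) ?_ ?_ ?_ ?_).symm
  · intro j _
    exact Finset.mem_Iio.mpr (Fin.lt_def.mpr j.is_lt)
  · intro j _ k _ h
    simpa using h
  · intro j hj
    exact ⟨⟨j, Fin.lt_def.mp (Finset.mem_Iio.mp hj)⟩, Finset.mem_univ _, by ext; rfl⟩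
  · intro j _
    rfl

/-- The letter of `w` at the position `p` is stored at the address `d + index p`. -/
theorem input_mem_index {q d : ℕ} {n : Fin d → ℕ} (w : Word q n) (p : Pos n) :
    (input w).mem (d + index p) = (w p : ℕ) + 1 := by
  have h : index p < ∏ i, n i := by
    rw [index_eq_finPiFinEquiv]
    exact (finPiFinEquiv p).is_lt
  have e : (⟨index p, h⟩ : Fin (∏ i, n i)) = finPiFinEquiv p :=
    Fin.ext (index_eq_finPiFinEquiv p)
  simp [input, h, e]

end MultiNecklace

/-! Counting. Write `c` for the smallest translate of `w`. The necklaces are the smaller ones, that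
of `w`, and the larger ones, so the rank is the number of all orbits minus the number of larger
orbits minus one. By the orbit-counting argument of Burnside (`sum_fixed_eq`), `N` times each of
these numbers is a sum over the translations `g`: of the words fixed by `g` (`fixCount`), or of the
words fixed by `g` whose orbit is larger than that of `w` (`bigCount`). This gives `rank_eq`.

Order. `code` turns the recursive order into the order of natural numbers: a word is the sequence of
its slices, compared lexicographically, where a slice is weighed by `kap`, the code of its orbit
followed by its smallest shift (`code_spec`).

Fixed words. Let `g` have last coordinate `j` of order `r` modulo the last size, let `m` be that
size divided by `r`, and let `a * j` be congruent to `m`. Write `g'` for the other coordinates of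
`g`. A word is fixed by `g` exactly if its slices are fixed by `r • g'` and are moved by `-(a • g')`
when the index grows by `m` (`fixed_iff`). So `m` slices are free, and `fixCount` is an `m`-th power
of a count one dimension lower.

Larger orbits. An orbit is larger than that of `w` exactly if all its members exceed `c`. Read a
word slice by slice with an automaton of Knuth-Morris-Pratt type, whose states are the translates of
the proper prefixes of `c`, and forbid a letter that completes a translate of `c` or creates
something smaller. Translation commutes with the automaton, so the wanted words correspond to walks
of length `m` from a state `x` to `x` translated by `-(a • g')`; the start is determined by the
word, because the state depends only on the recent letters (`sum_goodAll`, `bigCount_succ`). The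
alphabet of slices is enormous, but `trans_eq` makes the transitions computable: where the prefix
would continue with the slice `s` of `c`, slices of smaller orbit are forbidden, slices in the orbit
of `s` are tried one by one, and those of larger orbit all lead to the empty state. The number of
the latter is `bigCount` of `s`, one dimension lower.

Time. The tables are therefore built dimension by dimension, for all blocks of consecutive letters
at once. If the sizes so far have product `M`, there are `N / M` blocks, `M` translations for each,
and at most `M ^ 4` operations up to a constant for each pair, because there are at most `M` states:
in total `N * M ^ 4`. Each size that is treated is at least `2`, so the sum over the dimensions is
geometric and is `O(N ^ 5)`. The dimension `d` may be much larger than `N`, but the sizes are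
sorted, so sizes equal to `1` come first; a scan from the last size stops at the first `1` that it
meets, and all leading dimensions are skipped together.

Machine. The algorithm is written in a small language with loops and arrays. Its compiler is proved
correct together with a time bound (`cost`) and a size bound: if stored values are at most `V`, then
all numbers are at most a fixed power of `V` (`deg`). Here `V = (d + q + N) ^ (2 * N)` suffices. -/

namespace MultiNecklace

/-! ### Runs of the machine -/

/-- The machine gets from `c` to `c'` within `T` steps, all numbers on the way being at most `B`. -/
def Program.Reach (P : Program) (B T : ℕ) (c c' : Config) : Prop :=
  ∃ t ≤ T, P.step^[t] c = c' ∧ ∀ s ≤ t, (P.step^[s] c).Bounded B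

namespace Program.Reach

variable {P : Program} {B T T₁ T₂ : ℕ} {c c₁ c₂ : Config}

theorem refl (h : c.Bounded B) : P.Reach B 0 c c :=
  ⟨0, le_rfl, rfl, fun s hs => by obtain rfl : s = 0 := by omega
                                  exact h⟩

theorem mono (h : P.Reach B T₁ c c₁) (hT : T₁ ≤ T₂) : P.Reach B T₂ c c₁ := by
  obtain ⟨t, ht, h⟩ := h
  exact ⟨t, ht.trans hT, h⟩

theorem bounded (h : P.Reach B T c c₁) : c₁.Bounded B := by
  obtain ⟨t, -, rfl, h⟩ := h
  exact h t le_rfl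

theorem trans (h₁ : P.Reach B T₁ c c₁) (h₂ : P.Reach B T₂ c₁ c₂) : P.Reach B (T₁ + T₂) c c₂ := by
  obtain ⟨t₁, ht₁, rfl, h₁⟩ := h₁
  obtain ⟨t₂, ht₂, rfl, h₂⟩ := h₂
  refine ⟨t₂ + t₁, by omega, Function.iterate_add_apply _ _ _ _, fun s hs => ?_⟩
  rcases le_or_gt s t₁ with h | h
  · exact h₁ s h
  · obtain ⟨s', rfl⟩ : ∃ s', s = s' + t₁ := ⟨s - t₁, by omega⟩
    rw [Function.iterate_add_apply]
    exact h₂ s' (by omega)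

theorem single {i : Instr} (hc : c.Bounded B) (hi : P[c.pc]? = some i)
    (h : (i.exec c).Bounded B) : P.Reach B 1 c (i.exec c) := by
  have e : P.step c = i.exec c := by simp [Program.step, hi]
  refine ⟨1, le_rfl, by simpa using e, fun s hs => ?_⟩
  interval_cases s
  · exact hc
  · simpa [e] using h

theorem snoc {i : Instr} (h₁ : P.Reach B T c c₁) (hi : P[c₁.pc]? = some i)
    (h : (i.exec c₁).Bounded B) : P.Reach B (T + 1) c (i.exec c₁) :=
  h₁.trans (single h₁.bounded hi h)

end Program.Reach

theorem Config.Bounded.update {B : ℕ} {c : Config} (h : c.Bounded B) (p i v : ℕ) (hv : v ≤ B) :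
    Config.Bounded B ⟨p, Function.update c.reg i v, c.mem⟩ := by
  refine ⟨fun j => ?_, h.2⟩
  by_cases hj : j = i
  · subst hj; simpa using hv
  · simpa [hj] using h.1 j

theorem Config.Bounded.updateMem {B : ℕ} {c : Config} (h : c.Bounded B) (p i v : ℕ) (hv : v ≤ B) :
    Config.Bounded B ⟨p, c.reg, Function.update c.mem i v⟩ := by
  refine ⟨h.1, fun j => ?_⟩
  by_cases hj : j = i
  · subst hj; simpa using hv
  · simpa [hj] using h.2 j

/-- The instructions of `P` from number `p` on are those of `code`. -/
def CodeAt (P : Program) (p : ℕ) : List Instr → Prop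
  | [] => True
  | i :: l => P[p]? = some i ∧ CodeAt P (p + 1) l

theorem codeAt_append {P : Program} {p : ℕ} {l₁ l₂ : List Instr} :
    CodeAt P p (l₁ ++ l₂) ↔ CodeAt P p l₁ ∧ CodeAt P (p + l₁.length) l₂ := by
  induction l₁ generalizing p with
  | nil => simp [CodeAt]
  | cons i l ih =>
    simp only [List.cons_append, CodeAt, ih, List.length_cons, and_assoc]
    rw [show p + 1 + l.length = p + (l.length + 1) by omega]

theorem codeAt_self (l₁ l₂ : List Instr) : CodeAt (l₁ ++ l₂) l₁.length l₂ := by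
  induction l₂ generalizing l₁ with
  | nil => trivial
  | cons i l ih =>
    refine ⟨by simp, ?_⟩
    have := ih (l₁ ++ [i])
    simpa using this

/-! ### A small programming language with arrays -/

/-- Expressions. `get a i j` is the entry `(i, j)` of the array `a`, `raw e` is a cell of the
input, and `sum x v e` is the sum of `e` over all values of `x` below the value of the
variable `v`. -/
inductive Expr : Type
  | const (c : ℕ)
  | var (x : ℕ)
  | add (e f : Expr)
  | sub (e f : Expr)
  | mul (e f : Expr)
  | div (e f : Expr)
  | get (a : ℕ) (e f : Expr)
  | raw (e : Expr)
  | sum (x v : ℕ) (e : Expr)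

/-- Statements. `loop x v s` runs `s` for all values of `x` below the value of `v`, and then
restores `x`. -/
inductive Stmt : Type
  | assign (x : ℕ) (e : Expr)
  | store (a : ℕ) (i j e : Expr)
  | seq (s t : Stmt)
  | loop (x v : ℕ) (s : Stmt)

/-- A state: variables, two-dimensional arrays, and the input, which occupies the cells up to
`base`. -/
@[ext] structure Store : Type where
  r : ℕ → ℕ
  A : ℕ → ℕ → ℕ → ℕ
  base : ℕ
  raw : ℕ → ℕ

namespace Store

def setR (σ : Store) (x v : ℕ) : Store := { σ with r := Function.update σ.r x v }

def setA (σ : Store) (a : ℕ) (f : ℕ → ℕ → ℕ) : Store := { σ with A := Function.update σ.A a f }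

@[simp] theorem setR_A (σ : Store) (x v : ℕ) : (σ.setR x v).A = σ.A := rfl
@[simp] theorem setR_base (σ : Store) (x v : ℕ) : (σ.setR x v).base = σ.base := rfl
@[simp] theorem setR_raw (σ : Store) (x v : ℕ) : (σ.setR x v).raw = σ.raw := rfl
theorem setR_r (σ : Store) (x v : ℕ) : (σ.setR x v).r = Function.update σ.r x v := rfl
@[simp] theorem setA_r (σ : Store) (a : ℕ) (f : ℕ → ℕ → ℕ) : (σ.setA a f).r = σ.r := rfl
@[simp] theorem setA_base (σ : Store) (a : ℕ) (f : ℕ → ℕ → ℕ) : (σ.setA a f).base = σ.base := rfl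
@[simp] theorem setA_raw (σ : Store) (a : ℕ) (f : ℕ → ℕ → ℕ) : (σ.setA a f).raw = σ.raw := rfl
theorem setA_A (σ : Store) (a : ℕ) (f : ℕ → ℕ → ℕ) : (σ.setA a f).A = Function.update σ.A a f := rfl

@[simp] theorem setR_r_same (σ : Store) (x v : ℕ) : (σ.setR x v).r x = v := by simp [setR_r]
theorem setR_r_ne (σ : Store) {x y : ℕ} (v : ℕ) (h : y ≠ x) : (σ.setR x v).r y = σ.r y := by
  simp [setR_r, h]
@[simp] theorem setA_A_same (σ : Store) (a : ℕ) (f : ℕ → ℕ → ℕ) : (σ.setA a f).A a = f := by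
  simp [setA_A]
theorem setA_A_ne (σ : Store) {a b : ℕ} (f : ℕ → ℕ → ℕ) (h : b ≠ a) :
    (σ.setA a f).A b = σ.A b := by simp [setA_A, h]

/-- All numbers in a state are at most `V`. -/
structure Le (σ : Store) (V : ℕ) : Prop where
  r : ∀ x, σ.r x ≤ V
  A : ∀ a i j, σ.A a i j ≤ V
  base : σ.base ≤ V
  raw : ∀ i, σ.raw i ≤ V

theorem Le.setR {σ : Store} {V : ℕ} (h : σ.Le V) {x v : ℕ} (hv : v ≤ V) : (σ.setR x v).Le V := by
  refine ⟨fun y => ?_, h.A, h.base, h.raw⟩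
  by_cases e : y = x
  · subst e; simpa using hv
  · rw [setR_r_ne _ _ e]; exact h.r y

theorem Le.setA {σ : Store} {V : ℕ} (h : σ.Le V) {a : ℕ} {f : ℕ → ℕ → ℕ}
    (hf : ∀ i j, f i j ≤ V) : (σ.setA a f).Le V := by
  refine ⟨h.r, fun b => ?_, h.base, h.raw⟩
  by_cases e : b = a
  · subst e; simpa using hf
  · rw [setA_A_ne _ _ e]; exact h.A b

end Store

/-- A function of two arguments changed at one place. -/
def upd (f : ℕ → ℕ → ℕ) (i j v : ℕ) : ℕ → ℕ → ℕ := fun x y => if x = i ∧ y = j then v else f x y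

/-- The value of an expression. -/
def Expr.eval : Expr → Store → ℕ
  | .const c, _ => c
  | .var x, σ => σ.r x
  | .add e f, σ => e.eval σ + f.eval σ
  | .sub e f, σ => e.eval σ - f.eval σ
  | .mul e f, σ => e.eval σ * f.eval σ
  | .div e f, σ => e.eval σ / f.eval σ
  | .get a e f, σ => σ.A a (e.eval σ) (f.eval σ)
  | .raw e, σ => σ.raw (min (e.eval σ) σ.base)
  | .sum x v e, σ => ∑ i ∈ Finset.range (σ.r v), e.eval (σ.setR x i)

/-- A bound for the time needed to evaluate an expression. -/
def Expr.cost : Expr → Store → ℕ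
  | .const _, _ => 1
  | .var _, _ => 2
  | .add e f, σ => e.cost σ + f.cost σ + 1
  | .sub e f, σ => e.cost σ + f.cost σ + 1
  | .mul e f, σ => e.cost σ + f.cost σ + 1
  | .div e f, σ => e.cost σ + f.cost σ + 1
  | .get _ e f, σ => e.cost σ + f.cost σ + 9
  | .raw e, σ => e.cost σ + 3
  | .sum x v e, σ => ∑ i ∈ Finset.range (σ.r v), (e.cost (σ.setR x i) + 8) + 8

/-- If all numbers in the state are at most `V`, then those that occur in the evaluation of an
expression are at most `V ^ deg`. -/
def Expr.deg : Expr → ℕ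
  | .const c => c + 1
  | .var _ => 1
  | .add e f => e.deg + f.deg + 1
  | .sub e f => e.deg + f.deg
  | .mul e f => e.deg + f.deg
  | .div e f => e.deg + f.deg
  | .get a e f => 4 * (e.deg + f.deg + 1) + 2 * a + 10
  | .raw e => e.deg + 1
  | .sum _ _ e => e.deg + 1

/-- The state after running the body `f` of a loop for `x = 0, …, i - 1`. -/
def iter (f : Store → Store) (x : ℕ) (σ : Store) : ℕ → Store
  | 0 => σ
  | i + 1 => f ((iter f x σ i).setR x i)

/-- The effect of a statement. -/
def Stmt.exec : Stmt → Store → Store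
  | .assign x e, σ => σ.setR x (e.eval σ)
  | .store a i j e, σ => σ.setA a (upd (σ.A a) (i.eval σ) (j.eval σ) (e.eval σ))
  | .seq s t, σ => t.exec (s.exec σ)
  | .loop x v s, σ => (iter s.exec x σ (σ.r v)).setR x (σ.r x)

/-- A bound for the running time of a statement. -/
def Stmt.cost : Stmt → Store → ℕ
  | .assign _ e, σ => e.cost σ + 2
  | .store _ i j e, σ => i.cost σ + j.cost σ + e.cost σ + 9
  | .seq s t, σ => s.cost σ + t.cost (s.exec σ)
  | .loop x v s, σ => ∑ i ∈ Finset.range (σ.r v), (s.cost ((iter s.exec x σ i).setR x i) + 7) + 8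

/-- All numbers stored by a statement are at most `V`. -/
def Stmt.Safe (V : ℕ) : Stmt → Store → Prop
  | .assign _ e, σ => e.eval σ ≤ V
  | .store _ _ _ e, σ => e.eval σ ≤ V
  | .seq s t, σ => s.Safe V σ ∧ t.Safe V (s.exec σ)
  | .loop x v s, σ => ∀ i < σ.r v, s.Safe V ((iter s.exec x σ i).setR x i)

/-- The analogue of `Expr.deg` for statements. -/
def Stmt.deg : Stmt → ℕ
  | .assign _ e => e.deg
  | .store a i j e => 4 * (i.deg + j.deg + 1) + 2 * a + 10 + e.deg
  | .seq s t => s.deg + t.deg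
  | .loop _ _ s => s.deg + 1

theorem Stmt.Safe.exec_le {V : ℕ} {s : Stmt} {σ : Store} (h : s.Safe V σ) (hσ : σ.Le V) :
    (s.exec σ).Le V := by
  induction s generalizing σ with
  | assign x e => exact hσ.setR h
  | store a i j e =>
    refine hσ.setA fun x y => ?_
    unfold upd
    split_ifs
    exacts [h, hσ.A _ _ _]
  | seq s t hs ht => exact ht h.2 (hs h.1 hσ)
  | loop x v s ih =>
    refine Store.Le.setR ?_ (hσ.r x)
    have : ∀ i ≤ σ.r v, (iter s.exec x σ i).Le V := by
      intro i hi
      induction i with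
      | zero => exact hσ
      | succ i hi' =>
        refine ih (h i (by omega)) ((hi' (by omega)).setR ?_)
        have := hσ.r v
        omega
    exact this _ le_rfl

/-! ### Addresses -/

/-- An injective pairing. -/
def pair (x y : ℕ) : ℕ := (x + y) * (x + y) + x

/-- With `s = x + y`, the value lies between `s ^ 2` and `(s + 1) ^ 2` (exclusive), because `x ≤ s`;
so it determines `s`, and then `x`. -/
theorem pair_inj {x y x' y' : ℕ} (h : pair x y = pair x' y') : x = x' ∧ y = y' := by
  unfold pair at h
  have h1 : x + y = x' + y' := by
    rcases lt_trichotomy (x + y) (x' + y') with h' | h' | h'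
    · nlinarith
    · exact h'
    · nlinarith
  rw [h1] at h
  omega

/-- The address of the entry `(i, j)` of the array `a`. -/
def addr (β a i j : ℕ) : ℕ := pair (a + 1) (pair i j) + β

theorem addr_inj {β a i j a' i' j' : ℕ} (h : addr β a i j = addr β a' i' j') :
    a = a' ∧ i = i' ∧ j = j' := by
  unfold addr at h
  have h1 := pair_inj (Nat.add_right_cancel h)
  have h2 := pair_inj h1.2
  omega

/-- The input occupies addresses up to `β`. Pairing with `a + 1` rather than `a` gives a positive
number, so no store into an array touches the input. -/
theorem lt_addr (β a i j : ℕ) : β < addr β a i j := by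
  unfold addr pair
  omega

/-! ### Compilation -/

/-- The register of the `k`-th temporary value; the variable `x` is held in register `2 * x`. -/
def tmp (k : ℕ) : ℕ := 2 * k + 3

/-- Replace the temporary values `k`, `k + 1` by the address of the entry of `a` they index. -/
def addrCode (a k : ℕ) : List Instr :=
  [.add (tmp (k + 2)) (tmp k) (tmp (k + 1)), .mul (tmp (k + 2)) (tmp (k + 2)) (tmp (k + 2)),
   .add (tmp (k + 2)) (tmp (k + 2)) (tmp k), .const (tmp (k + 1)) (a + 1),
   .add (tmp k) (tmp (k + 1)) (tmp (k + 2)), .mul (tmp k) (tmp k) (tmp k),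
   .add (tmp k) (tmp k) (tmp (k + 1)), .add (tmp k) (tmp k) 1]

/-- The code before the body of a loop. The temporary values `k + 1`, `k + 2`, `k + 3` hold the old
value of `x`, the number of rounds, and the number of rounds done. -/
def loopHead (x v k p len : ℕ) : List Instr :=
  [.const (tmp k) 0, .add (tmp (k + 1)) (tmp k) (2 * x), .add (tmp (k + 2)) (tmp k) (2 * v),
   .const (tmp (k + 3)) 0, .sub (tmp (k + 4)) (tmp (k + 2)) (tmp (k + 3)),
   .jumpZero (tmp (k + 4)) (p + 8 + len + 3), .const (2 * x) 0, .add (2 * x) (2 * x) (tmp (k + 3))]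

/-- The code after the body of a loop. -/
def loopTail (x k p : ℕ) : List Instr :=
  [.const (tmp (k + 4)) 1, .add (tmp (k + 3)) (tmp (k + 3)) (tmp (k + 4)), .jump (p + 4),
   .const (2 * x) 0, .add (2 * x) (2 * x) (tmp (k + 1))]

/-- The code of an expression, to be placed at `p`; the value goes to the temporary value `k`. -/
def Expr.code : Expr → ℕ → ℕ → List Instr
  | .const c, k, _ => [.const (tmp k) c]
  | .var x, k, _ => [.const (tmp k) 0, .add (tmp k) (tmp k) (2 * x)]
  | .add e f, k, p => e.code k p ++ (f.code (k + 1) (p + (e.code k p).length) ++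
      [.add (tmp k) (tmp k) (tmp (k + 1))])
  | .sub e f, k, p => e.code k p ++ (f.code (k + 1) (p + (e.code k p).length) ++
      [.sub (tmp k) (tmp k) (tmp (k + 1))])
  | .mul e f, k, p => e.code k p ++ (f.code (k + 1) (p + (e.code k p).length) ++
      [.mul (tmp k) (tmp k) (tmp (k + 1))])
  | .div e f, k, p => e.code k p ++ (f.code (k + 1) (p + (e.code k p).length) ++
      [.div (tmp k) (tmp k) (tmp (k + 1))])
  | .get a e f, k, p => e.code k p ++ (f.code (k + 1) (p + (e.code k p).length) ++
      (addrCode a k ++ [.load (tmp k) (tmp k)]))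
  | .raw e, k, p => e.code k p ++ [.sub (tmp k) 1 (tmp k), .sub (tmp k) 1 (tmp k),
      .load (tmp k) (tmp k)]
  | .sum x v e, k, p => loopHead x v k p ((e.code (k + 4) (p + 8)).length + 1) ++
      ((e.code (k + 4) (p + 8) ++ [.add (tmp k) (tmp k) (tmp (k + 4))]) ++ loopTail x k p)

/-- The code of a statement, to be placed at `p`; only temporary values from `k` on are used. -/
def Stmt.code : Stmt → ℕ → ℕ → List Instr
  | .assign x e, k, p => e.code k p ++ [.const (2 * x) 0, .add (2 * x) (2 * x) (tmp k)]
  | .store a i j e, k, p => i.code k p ++ (j.code (k + 1) (p + (i.code k p).length) ++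
      (addrCode a k ++
        (e.code (k + 1) (p + (i.code k p).length +
          (j.code (k + 1) (p + (i.code k p).length)).length + 8) ++
        [.store (tmp k) (tmp (k + 1))])))
  | .seq s t, k, p => s.code k p ++ t.code k (p + (s.code k p).length)
  | .loop x v s, k, p => loopHead x v k p (s.code (k + 4) (p + 8)).length ++
      (s.code (k + 4) (p + 8) ++ loopTail x k p)

/-- The configuration `c` represents the state `σ`, except possibly for the variables in `X`. -/
structure RelOff (X : Set ℕ) (σ : Store) (c : Config) : Prop where
  r : ∀ x, x ∉ X → c.reg (2 * x) = σ.r x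
  base : c.reg 1 = σ.base
  raw : ∀ i ≤ σ.base, c.mem i = σ.raw i
  A : ∀ a i j, c.mem (addr σ.base a i j) = σ.A a i j

/-- The configuration `c` represents the state `σ`. -/
abbrev Rel (σ : Store) (c : Config) : Prop := RelOff ∅ σ c

/-- `c'` differs from `c` only in temporary values from `k` on and in the variables in `X`. -/
structure Keep (X : Set ℕ) (k : ℕ) (c c' : Config) : Prop where
  mem : c'.mem = c.mem
  r : ∀ x, x ∉ X → c'.reg (2 * x) = c.reg (2 * x)
  base : c'.reg 1 = c.reg 1
  tmp : ∀ j < k, c'.reg (tmp j) = c.reg (tmp j)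

theorem Keep.trans {X : Set ℕ} {k : ℕ} {c c₁ c₂ : Config} (h₁ : Keep X k c c₁)
    (h₂ : Keep X k c₁ c₂) : Keep X k c c₂ :=
  ⟨h₂.mem.trans h₁.mem, fun x hx => (h₂.r x hx).trans (h₁.r x hx), h₂.base.trans h₁.base,
    fun j hj => (h₂.tmp j hj).trans (h₁.tmp j hj)⟩

theorem Keep.mono {X Y : Set ℕ} {k l : ℕ} {c c' : Config} (h : Keep X k c c') (hX : X ⊆ Y)
    (hl : l ≤ k) : Keep Y l c c' :=
  ⟨h.mem, fun x hx => h.r x fun h' => hx (hX h'), h.base, fun j hj => h.tmp j (by omega)⟩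

theorem Keep.rel {X : Set ℕ} {k : ℕ} {σ : Store} {c c' : Config} (h : Keep X k c c')
    (hc : RelOff X σ c) : RelOff X σ c' :=
  ⟨fun x hx => (h.r x hx).trans (hc.r x hx), h.base.trans hc.base,
    fun i hi => by rw [h.mem]; exact hc.raw i hi, fun a i j => by rw [h.mem]; exact hc.A a i j⟩

theorem keep_tmp (X : Set ℕ) {k l : ℕ} (h : k ≤ l) (c : Config) (p v : ℕ) :
    Keep X k c ⟨p, Function.update c.reg (tmp l) v, c.mem⟩ := by
  refine ⟨rfl, fun x _ => ?_, ?_, fun j hj => ?_⟩ <;> simp only <;>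
    rw [Function.update_of_ne] <;> unfold tmp <;> omega

theorem keep_var {X : Set ℕ} {x : ℕ} (hx : x ∈ X) (k : ℕ) (c : Config) (p v : ℕ) :
    Keep X k c ⟨p, Function.update c.reg (2 * x) v, c.mem⟩ := by
  refine ⟨rfl, fun y hy => ?_, ?_, fun j hj => ?_⟩ <;> simp only <;> rw [Function.update_of_ne]
  · rintro h
    obtain rfl : y = x := by omega
    exact hy hx
  · omega
  · unfold tmp; omega

/-! ### Correctness of the compiler -/

@[simp] theorem tmp_inj {k l : ℕ} : tmp k = tmp l ↔ k = l := by unfold tmp; omega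
@[simp] theorem one_ne_tmp (k : ℕ) : 1 ≠ tmp k := by unfold tmp; omega
@[simp] theorem tmp_ne_var (k x : ℕ) : tmp k ≠ 2 * x := by unfold tmp; omega
@[simp] theorem var_ne_tmp (k x : ℕ) : 2 * x ≠ tmp k := by unfold tmp; omega
@[simp] theorem one_ne_var (x : ℕ) : 1 ≠ 2 * x := by omega

section

variable {P : Program} {B : ℕ}

theorem run_set {I : Instr} {c : Config} {d v : ℕ} (hb : c.Bounded B) (hi : P[c.pc]? = some I)
    (he : I.exec c = ⟨c.pc + 1, Function.update c.reg d v, c.mem⟩) (hv : v ≤ B) :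
    ∃ c', P.Reach B 1 c c' ∧ c'.pc = c.pc + 1 ∧ c'.mem = c.mem ∧
      c'.reg = Function.update c.reg d v := by
  refine ⟨I.exec c, Program.Reach.single hb hi ?_, ?_⟩
  · rw [he]; exact hb.update _ _ _ hv
  · rw [he]; exact ⟨rfl, rfl, rfl⟩

theorem addrCode_run {a k i j p : ℕ} {c : Config} (hb : c.Bounded B)
    (hc : CodeAt P p (addrCode a k)) (hp : c.pc = p) (hi : c.reg (tmp k) = i)
    (hj : c.reg (tmp (k + 1)) = j) (hB : addr (c.reg 1) a i j ≤ B) :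
    ∃ c', P.Reach B 8 c c' ∧ c'.pc = p + 8 ∧ Keep ∅ k c c' ∧
      c'.reg (tmp k) = addr (c.reg 1) a i j := by
  subst hp
  obtain ⟨h0, h1, h2, h3, h4, h5, h6, h7, -⟩ := hc
  have hA : addr (c.reg 1) a i j = (a + 1 + ((i + j) * (i + j) + i)) *
    (a + 1 + ((i + j) * (i + j) + i)) + (a + 1) + c.reg 1 := rfl
  -- Squares dominate their bases, so the bound on the final address covers every intermediate
  -- value.
  have g1 : i + j ≤ (i + j) * (i + j) := Nat.le_mul_self _
  have g2 := Nat.le_mul_self (a + 1 + ((i + j) * (i + j) + i))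
  rw [hA] at hB ⊢
  obtain ⟨c1, q1, p1, m1, r1⟩ := run_set (d := tmp (k + 2)) (v := i + j) hb h0 (by simp [Instr.exec, hi, hj]) (by omega)
  obtain ⟨c2, q2, p2, m2, r2⟩ := run_set (d := tmp (k + 2)) (v := (i + j) * (i + j)) q1.bounded (by rw [p1]; exact h1)
    (by simp [Instr.exec, r1]) (by omega)
  obtain ⟨c3, q3, p3, m3, r3⟩ := run_set (d := tmp (k + 2)) (v := (i + j) * (i + j) + i) q2.bounded
    (by rw [p2, p1]; exact h2) (by simp [Instr.exec, r1, r2, hi]) (by omega)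
  obtain ⟨c4, q4, p4, m4, r4⟩ := run_set (d := tmp (k + 1)) (v := a + 1) q3.bounded
    (by rw [p3, p2, p1]; exact h3) (by simp only [Instr.exec]) (by omega)
  obtain ⟨c5, q5, p5, m5, r5⟩ := run_set (d := tmp k) (v := a + 1 + ((i + j) * (i + j) + i)) q4.bounded
    (by rw [p4, p3, p2, p1]; exact h4) (by simp [Instr.exec, r4, r3]) (by omega)
  obtain ⟨c6, q6, p6, m6, r6⟩ := run_set (d := tmp k) (v := (a + 1 + ((i + j) * (i + j) + i)) *
    (a + 1 + ((i + j) * (i + j) + i))) q5.bounded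
    (by rw [p5, p4, p3, p2, p1]; exact h5) (by simp [Instr.exec, r5]) (by omega)
  obtain ⟨c7, q7, p7, m7, r7⟩ := run_set (d := tmp k) (v := (a + 1 + ((i + j) * (i + j) + i)) *
    (a + 1 + ((i + j) * (i + j) + i)) + (a + 1)) q6.bounded
    (by rw [p6, p5, p4, p3, p2, p1]; exact h6) (by simp [Instr.exec, r6, r5, r4]) (by omega)
  obtain ⟨c8, q8, p8, m8, r8⟩ := run_set (d := tmp k) (v := (a + 1 + ((i + j) * (i + j) + i)) *
    (a + 1 + ((i + j) * (i + j) + i)) + (a + 1) + c.reg 1) q7.bounded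
    (by rw [p7, p6, p5, p4, p3, p2, p1]; exact h7)
    (by simp [Instr.exec, r7, r6, r5, r4, r3, r2, r1]) (by omega)
  refine ⟨c8, ((((((q1.trans q2).trans q3).trans q4).trans q5).trans q6).trans q7).trans q8,
    by omega, ⟨by rw [m8, m7, m6, m5, m4, m3, m2, m1], fun x _ => ?_, ?_, fun l hl => ?_⟩, ?_⟩
  · simp [r8, r7, r6, r5, r4, r3, r2, r1]
  · simp [r8, r7, r6, r5, r4, r3, r2, r1]
  · have e0 : l ≠ k := by omega
    have e1 : l ≠ k + 1 := by omega
    have e2 : l ≠ k + 2 := by omega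
    simp [r8, r7, r6, r5, r4, r3, r2, r1, e0, e1, e2]
  · simp [r8]

/-- The general loop: `J i` holds before the `i`-th round of the body. -/
theorem loop_run {x v k p len : ℕ} {body : List Instr} {c : Config} {n : ℕ} (J : ℕ → Config → Prop)
    (T : ℕ → ℕ) (hB : 1 ≤ B) (hb : c.Bounded B)
    (hc : CodeAt P p (loopHead x v k p len ++ (body ++ loopTail x k p))) (hl : body.length = len)
    (hp : c.pc = p) (hn : c.reg (2 * v) = n)
    (h0 : ∀ c', Keep {x} k c c' → c'.reg (tmp k) = 0 → J 0 c')
    (hJ : ∀ i c₁ c₂, J i c₁ → Keep {x} (k + 1) c₁ c₂ → J i c₂)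
    (hbody : ∀ i < n, ∀ c', J i c' → c'.Bounded B → c'.pc = p + 8 → c'.reg (2 * x) = i →
      ∃ c'', P.Reach B (T i) c' c'' ∧ c''.pc = p + 8 + len ∧ J (i + 1) c'' ∧
        ∀ j, k < j → j < k + 4 → c''.reg (tmp j) = c'.reg (tmp j)) :
    ∃ c', P.Reach B (∑ i ∈ Finset.range n, (T i + 7) + 8) c c' ∧ c'.pc = p + 8 + len + 5 ∧ J n c' ∧
      c'.reg (2 * x) = c.reg (2 * x) := by
  subst hp
  rw [codeAt_append, codeAt_append, hl] at hc
  obtain ⟨⟨i0, i1, i2, i3, i4, i5, i6, i7, -⟩, -, ⟨j0, j1, j2, j3, j4, -⟩⟩ := hc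
  simp only [loopHead, List.length_cons, List.length_nil, zero_add, Nat.reduceAdd] at j0 j1 j2 j3 j4
  have hcx := hb.1 (2 * x)
  have hcv := hb.1 (2 * v)
  have hnB : n ≤ B := hn ▸ hcv
  obtain ⟨c1, q1, p1, m1, r1⟩ := run_set (d := tmp k) (v := 0) hb i0 rfl (by omega)
  obtain ⟨c2, q2, p2, m2, r2⟩ := run_set (d := tmp (k + 1)) (v := c.reg (2 * x)) q1.bounded (by rw [p1]; exact i1)
    (by simp [Instr.exec, r1]) hcx
  obtain ⟨c3, q3, p3, m3, r3⟩ := run_set (d := tmp (k + 2)) (v := n) q2.bounded (by rw [p2, p1]; exact i2)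
    (by simp [Instr.exec, r1, r2, hn]) hnB
  obtain ⟨c4, q4, p4, m4, r4⟩ := run_set (d := tmp (k + 3)) (v := 0) q3.bounded (by rw [p3, p2, p1]; exact i3)
    rfl (by omega)
  have k4 : Keep {x} k c c4 := by
    refine ⟨by rw [m4, m3, m2, m1], fun x _ => ?_, ?_, fun l hl => ?_⟩
    · simp [r4, r3, r2, r1]
    · simp [r4, r3, r2, r1]
    · have e0 : l ≠ k := by omega
      have e1 : l ≠ k + 1 := by omega
      have e2 : l ≠ k + 2 := by omega
      have e3 : l ≠ k + 3 := by omega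
      simp [r4, r3, r2, r1, e0, e1, e2, e3]
  -- The invariant holds at the test, four instructions after the start. Besides the body, a round
  -- takes 7 steps: two for the test, two to set `x`, three for the tail. The remaining 8 are the
  -- four initial instructions, the last test, and the restoration of `x`.
  have main : ∀ i ≤ n, ∃ c', P.Reach B (4 + ∑ i ∈ Finset.range i, (T i + 7)) c c' ∧
      c'.pc = c.pc + 4 ∧ J i c' ∧ c'.reg (tmp (k + 1)) = c.reg (2 * x) ∧
      c'.reg (tmp (k + 2)) = n ∧ c'.reg (tmp (k + 3)) = i := by
    intro i hi
    induction i with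
    | zero =>
      refine ⟨c4, by simpa using ((q1.trans q2).trans q3).trans q4, by omega,
        h0 _ k4 (by simp [r4, r3, r2, r1]), ?_, ?_, ?_⟩ <;>
        simp [r4, r3, r2, r1]
    | succ i ih =>
      obtain ⟨d, qd, pd, Jd, d1, d2, d3⟩ := ih (by omega)
      obtain ⟨e1, s1, t1, u1, w1⟩ := run_set (d := tmp (k + 4)) (v := n - i) qd.bounded (by rw [pd]; exact i4)
        (by simp [Instr.exec, d2, d3]) (by omega)
      have x2 : (Instr.jumpZero (tmp (k + 4)) (c.pc + 8 + len + 3)).exec e1 =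
          ⟨e1.pc + 1, e1.reg, e1.mem⟩ := by
        have : n - i ≠ 0 := by omega
        simp [Instr.exec, w1, this]
      have s2 := s1.snoc (by rw [t1, pd]; exact i5) (by rw [x2]; exact s1.bounded)
      rw [x2] at s2
      obtain ⟨e3, s3, t3, u3, w3⟩ := run_set (d := 2 * x) (v := 0) s2.bounded
        (by simp only [t1, pd]; exact i6) rfl (by omega)
      obtain ⟨e4, s4, t4, u4, w4⟩ := run_set (d := 2 * x) (v := i) s3.bounded
        (by rw [t3]; simp only [t1, pd]; exact i7) (by simp [Instr.exec, w3, w1, d3]) (by omega)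
      have ke : Keep {x} (k + 1) d e4 := by
        refine ⟨by rw [u4, u3, u1], fun y hy => ?_, ?_, fun l hl => ?_⟩
        · have : 2 * y ≠ 2 * x := fun h => hy (by simp; omega)
          simp [w4, w3, w1]
          rw [Function.update_of_ne this]
          simp
        · simp [w4, w3, w1]
        · have e0 : l ≠ k + 4 := by omega
          simp [w4, w3, w1, e0]
      obtain ⟨f, qf, pf, Jf, kf⟩ := hbody i (by omega) e4 (hJ _ _ _ Jd ke) s4.bounded
        (by rw [t4, t3]; simp only [t1, pd]) (by simp [w4])
      obtain ⟨f1, a1, b1, v1, y1⟩ := run_set (d := tmp (k + 4)) (v := 1) qf.bounded (by rw [pf]; exact j0) rfl hB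
      have f3 : f.reg (tmp (k + 3)) = i := by
        rw [kf _ (by omega) (by omega)]; simp [w4, w3, w1, d3]
      obtain ⟨f2, a2, b2, v2, y2⟩ := run_set (d := tmp (k + 3)) (v := i + 1) a1.bounded (by rw [b1, pf]; exact j1)
        (by simp [Instr.exec, y1, f3]) (by omega)
      have a3 := a2.snoc (i := .jump (c.pc + 4)) (by rw [b2, b1, pf]; exact j2) a2.bounded
      refine ⟨_, (((qd.trans ((s2.trans s3).trans s4)).trans qf).trans (a1.trans a3)).mono ?_,
        rfl, ?_, ?_, ?_, ?_⟩
      · rw [Finset.sum_range_succ]; omega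
      · refine hJ _ _ _ Jf ⟨by simp [Instr.exec, v2, v1], fun y hy => ?_, ?_, fun l hl => ?_⟩
        · simp [Instr.exec, y2, y1]
        · simp [Instr.exec, y2, y1]
        · have e3 : l ≠ k + 3 := by omega
          have e4 : l ≠ k + 4 := by omega
          simp [Instr.exec, y2, y1, e3, e4]
      · simp only [Instr.exec, y2, y1]
        simp [kf (k + 1) (by omega) (by omega), w4, w3, w1, d1]
      · simp only [Instr.exec, y2, y1]
        simp [kf (k + 2) (by omega) (by omega), w4, w3, w1, d2]
      · simp [Instr.exec, y2]
  -- After `n` rounds the difference that is tested is `0`, and the jump goes to the two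
  -- instructions that restore `x`.
  obtain ⟨d, qd, pd, Jd, d1, d2, d3⟩ := main n le_rfl
  obtain ⟨e1, s1, t1, u1, w1⟩ := run_set (d := tmp (k + 4)) (v := 0) qd.bounded (by rw [pd]; exact i4)
    (by simp [Instr.exec, d2, d3]) (by omega)
  have x2 : (Instr.jumpZero (tmp (k + 4)) (c.pc + 8 + len + 3)).exec e1 =
      ⟨c.pc + 8 + len + 3, e1.reg, e1.mem⟩ := by
    simp [Instr.exec, w1]
  have s2 := s1.snoc (by rw [t1, pd]; exact i5) (by rw [x2]; exact s1.bounded)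
  rw [x2] at s2
  obtain ⟨e3, s3, t3, u3, w3⟩ := run_set (d := 2 * x) (v := 0) s2.bounded j3 rfl (by omega)
  obtain ⟨e4, s4, t4, u4, w4⟩ := run_set (d := 2 * x) (v := c.reg (2 * x)) s3.bounded
    (by rw [t3]; exact j4) (by simp [Instr.exec, w3, w1, d1]) hcx
  refine ⟨e4, (qd.trans ((s2.trans s3).trans s4)).mono (by omega), by rw [t4, t3], ?_, by simp [w4]⟩
  refine hJ _ _ _ Jd ⟨by rw [u4, u3, u1], fun y hy => ?_, ?_, fun l hl => ?_⟩
  · have : 2 * y ≠ 2 * x := fun h => hy (by simp; omega)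
    simp [w4, w3, w1]
    rw [Function.update_of_ne this]
    simp
  · simp [w4, w3, w1]
  · have e0 : l ≠ k + 4 := by omega
    simp [w4, w3, w1, e0]

end

theorem Expr.eval_le {V : ℕ} (hV : 2 ≤ V) (e : Expr) {σ : Store} (hσ : σ.Le V) :
    e.eval σ ≤ V ^ e.deg := by
  have mono : ∀ {a b : ℕ}, a ≤ b → V ^ a ≤ V ^ b := fun h => Nat.pow_le_pow_right (by omega) h
  have one : ∀ a : ℕ, 1 ≤ V ^ a := fun a => Nat.one_le_pow _ _ (by omega)
  induction e generalizing σ with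
  | const c =>
    have : c < V ^ c := Nat.lt_pow_self (by omega)
    exact this.le.trans (mono (by simp [Expr.deg]))
  | var x => simpa [Expr.eval, Expr.deg] using hσ.r x
  | add e f he hf =>
    have h1 := he hσ
    have h2 := hf hσ
    -- Both powers are at least `1`, so their sum is at most twice their product; one more factor `V
    -- ≥ 2` pays for the `2`.
    have h3 : V ^ e.deg + V ^ f.deg ≤ V ^ (e.deg + f.deg) * 2 := by
      rw [pow_add]; nlinarith [one e.deg, one f.deg]
    calc e.eval σ + f.eval σ ≤ V ^ (e.deg + f.deg) * 2 := by omega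
      _ ≤ V ^ (e.deg + f.deg) * V := Nat.mul_le_mul_left _ hV
      _ = V ^ (e.deg + f.deg + 1) := (pow_succ _ _).symm
  | sub e f he hf =>
    exact (Nat.sub_le _ _).trans ((he hσ).trans (mono (by simp [Expr.deg])))
  | mul e f he hf =>
    simp only [Expr.eval, Expr.deg, pow_add]
    exact Nat.mul_le_mul (he hσ) (hf hσ)
  | div e f he hf =>
    exact (Nat.div_le_self _ _).trans ((he hσ).trans (mono (by simp [Expr.deg])))
  | get a e f he hf =>
    exact (hσ.A _ _ _).trans (by simpa using mono (show 1 ≤ _ by simp only [Expr.deg]; omega))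
  | raw e he =>
    exact (hσ.raw _).trans (by simpa using mono (show 1 ≤ _ by simp only [Expr.deg]; omega))
  | sum x v e he =>
    simp only [Expr.eval, Expr.deg]
    calc ∑ i ∈ Finset.range (σ.r v), e.eval (σ.setR x i)
        ≤ ∑ i ∈ Finset.range (σ.r v), V ^ e.deg := Finset.sum_le_sum fun i hi =>
          he (hσ.setR ((Finset.mem_range.mp hi).le.trans (hσ.r v)))
      _ = σ.r v * V ^ e.deg := by simp
      _ ≤ V * V ^ e.deg := Nat.mul_le_mul_right _ (hσ.r v)
      _ = V ^ (e.deg + 1) := by ring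

/-- Each pairing of numbers up to `V ^ s` stays below `8 * V ^ (2 * s) ≤ V ^ (2 * s + 3)`. This is
applied twice, with `a < V ^ a` for the number of the array; adding `β` at most doubles the bound.
-/
theorem addr_le {V : ℕ} (hV : 2 ≤ V) {β a i j m n : ℕ} (hβ : β ≤ V) (hi : i ≤ V ^ m)
    (hj : j ≤ V ^ n) : addr β a i j ≤ V ^ (4 * (m + n + 1) + 2 * a + 10) := by
  have mono : ∀ {a b : ℕ}, a ≤ b → V ^ a ≤ V ^ b := fun h => Nat.pow_le_pow_right (by omega) h
  have one : ∀ a : ℕ, 1 ≤ V ^ a := fun a => Nat.one_le_pow _ _ (by omega)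
  have dbl : ∀ a : ℕ, 2 * V ^ a ≤ V ^ (a + 1) := fun a => by
    rw [pow_succ, mul_comm]; exact Nat.mul_le_mul_left _ hV
  have hp : ∀ {x y s : ℕ}, x ≤ V ^ s → y ≤ V ^ s → pair x y ≤ V ^ (2 * s + 3) := by
    intro x y s hx hy
    have h1 : (x + y) * (x + y) + x ≤ 2 * (2 * (2 * (V ^ s * V ^ s))) := by
      nlinarith [one s, Nat.mul_le_mul hx hx, Nat.mul_le_mul hy hy, Nat.mul_le_mul hx hy]
    calc pair x y ≤ 2 * (2 * (2 * (V ^ s * V ^ s))) := h1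
      _ = 2 * (2 * (2 * V ^ (2 * s))) := by rw [two_mul s, pow_add]
      _ ≤ V ^ (2 * s + 3) := by
        have := dbl (2 * s)
        have := dbl (2 * s + 1)
        have := dbl (2 * s + 2)
        simp only [add_assoc] at *
        norm_num at *
        omega
  have h1 : pair i j ≤ V ^ (2 * (m + n) + 3) :=
    hp (hi.trans (mono (by omega))) (hj.trans (mono (by omega)))
  have h2 : a + 1 ≤ V ^ (2 * (m + n) + 3 + a) := by
    have : a < V ^ a := Nat.lt_pow_self (by omega)
    exact this.trans_le (mono (by omega))
  have h3 : pair (a + 1) (pair i j) ≤ V ^ (2 * (2 * (m + n) + 3 + a) + 3) :=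
    hp h2 (h1.trans (mono (by omega)))
  have h4 : β ≤ V ^ (2 * (2 * (m + n) + 3 + a) + 3) :=
    hβ.trans (by simpa using mono (show 1 ≤ 2 * (2 * (m + n) + 3 + a) + 3 by omega))
  calc addr β a i j ≤ 2 * V ^ (2 * (2 * (m + n) + 3 + a) + 3) := by unfold addr; omega
    _ ≤ V ^ (2 * (2 * (m + n) + 3 + a) + 4) := dbl _
    _ ≤ _ := mono (by omega)

section

variable {P : Program} {V D B : ℕ}

theorem RelOff.setR {x v : ℕ} {σ : Store} {c : Config} (h : RelOff {x} σ c)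
    (hx : c.reg (2 * x) = v) : Rel (σ.setR x v) c := by
  refine ⟨fun y _ => ?_, h.base, h.raw, h.A⟩
  by_cases e : y = x
  · subst e; simpa using hx
  · rw [Store.setR_r_ne _ _ e]; exact h.r y e

theorem RelOff.mono {X Y : Set ℕ} {σ : Store} {c : Config} (h : RelOff X σ c) (hX : X ⊆ Y) :
    RelOff Y σ c := ⟨fun x hx => h.r x fun h' => hx (hX h'), h.base, h.raw, h.A⟩

/-- The statement that the code of `e` computes `e`. -/
def Expr.Correct (P : Program) (V D B : ℕ) (e : Expr) : Prop :=
  e.deg ≤ D → ∀ (k p : ℕ) (c : Config) (σ : Store), CodeAt P p (e.code k p) → c.pc = p → Rel σ c →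
    c.Bounded B → σ.Le V → ∃ c', P.Reach B (e.cost σ) c c' ∧ c'.pc = p + (e.code k p).length ∧
      Keep ∅ k c c' ∧ c'.reg (tmp k) = e.eval σ

/-- One argument for the four arithmetic operations: the second operand is evaluated with
temporaries from `k + 1` on, so the first one survives in `k`. -/
theorem Expr.Correct.op {e f g : Expr} {I : ℕ → ℕ → ℕ → Instr} {o : ℕ → ℕ → ℕ}
    (he : e.Correct P V D B) (hf : f.Correct P V D B)
    (hI : ∀ c i j k, (I i j k).exec c =
      ⟨c.pc + 1, Function.update c.reg i (o (c.reg j) (c.reg k)), c.mem⟩)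
    (hcode : ∀ k p, g.code k p = e.code k p ++ (f.code (k + 1) (p + (e.code k p).length) ++
      [I (tmp k) (tmp k) (tmp (k + 1))]))
    (heval : ∀ σ, g.eval σ = o (e.eval σ) (f.eval σ))
    (hcost : ∀ σ, g.cost σ = e.cost σ + f.cost σ + 1)
    (hdeg : e.deg ≤ g.deg ∧ f.deg ≤ g.deg) (hB : ∀ σ : Store, g.deg ≤ D → σ.Le V → g.eval σ ≤ B) :
    g.Correct P V D B := by
  intro hD k p c σ hc hp hr hb hσ
  rw [hcode, codeAt_append, codeAt_append] at hc
  obtain ⟨hc1, hc2, hc3, -⟩ := hc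
  obtain ⟨c1, q1, p1, k1, v1⟩ := he (hdeg.1.trans hD) k p c σ hc1 hp hr hb hσ
  obtain ⟨c2, q2, p2, k2, v2⟩ := hf (hdeg.2.trans hD) (k + 1) _ c1 σ hc2 p1 (k1.rel hr) q1.bounded hσ
  obtain ⟨c3, q3, p3, m3, r3⟩ := run_set (d := tmp k) (v := g.eval σ) q2.bounded
    (by rw [p2]; exact hc3) (by rw [hI, v2, k2.tmp k (by omega), v1, heval]) (hB σ hD hσ)
  refine ⟨c3, ((q1.trans q2).trans q3).mono (by rw [hcost]), ?_, ?_, by simp [r3]⟩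
  · rw [p3, p2, hcode]; simp; omega
  · refine (k1.trans (k2.mono le_rfl (by omega))).trans ?_
    have := keep_tmp ∅ (le_refl k) c2 c3.pc (g.eval σ)
    rw [← r3, ← m3] at this
    exact this

theorem Expr.correct (hV : 2 ≤ V) (hB : V ^ D ≤ B) (e : Expr) : e.Correct P V D B := by
  have mono : ∀ {a b : ℕ}, a ≤ b → V ^ a ≤ V ^ b := fun h => Nat.pow_le_pow_right (by omega) h
  have ev : ∀ (e : Expr) (σ : Store), e.deg ≤ D → σ.Le V → e.eval σ ≤ B := fun e σ hd hσ =>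
    ((e.eval_le hV hσ).trans (mono hd)).trans hB
  have hB1 : 1 ≤ B := (Nat.one_le_pow _ _ (by omega)).trans hB
  induction e with
  | const a =>
    intro hD k p c σ hc hp hr hb hσ
    subst hp
    obtain ⟨hc, -⟩ := hc
    obtain ⟨c1, q1, p1, m1, r1⟩ := run_set (d := tmp k) (v := a) hb hc rfl
      (ev (.const a) σ hD hσ)
    refine ⟨c1, q1, by rw [p1]; rfl, ?_, by simp [r1, Expr.eval]⟩
    have := keep_tmp ∅ (le_refl k) c c1.pc a
    rwa [← r1, ← m1] at this
  | var x =>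
    intro hD k p c σ hc hp hr hb hσ
    subst hp
    obtain ⟨hc, hc', -⟩ := hc
    obtain ⟨c1, q1, p1, m1, r1⟩ := run_set (d := tmp k) (v := 0) hb hc rfl (by omega)
    obtain ⟨c2, q2, p2, m2, r2⟩ := run_set (d := tmp k) (v := σ.r x) q1.bounded
      (by rw [p1]; exact hc') (by simp [Instr.exec, r1, hr.r x]) (ev (.var x) σ hD hσ)
    refine ⟨c2, q1.trans q2, by rw [p2, p1]; rfl, ?_, by simp [r2, Expr.eval]⟩
    have h1 := keep_tmp ∅ (le_refl k) c c1.pc 0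
    rw [← r1, ← m1] at h1
    have h2 := keep_tmp ∅ (le_refl k) c1 c2.pc (σ.r x)
    rw [← r2, ← m2] at h2
    exact h1.trans h2
  | add e f he hf =>
    exact he.op hf (I := .add) (o := (· + ·)) (fun _ _ _ _ => rfl) (fun _ _ => rfl) (fun _ => rfl)
      (fun _ => rfl) (by simp only [Expr.deg]; omega) (fun σ => ev _ σ)
  | sub e f he hf =>
    exact he.op hf (I := .sub) (o := (· - ·)) (fun _ _ _ _ => rfl) (fun _ _ => rfl) (fun _ => rfl)
      (fun _ => rfl) (by simp only [Expr.deg]; omega) (fun σ => ev _ σ)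
  | mul e f he hf =>
    exact he.op hf (I := .mul) (o := (· * ·)) (fun _ _ _ _ => rfl) (fun _ _ => rfl) (fun _ => rfl)
      (fun _ => rfl) (by simp only [Expr.deg]; omega) (fun σ => ev _ σ)
  | div e f he hf =>
    exact he.op hf (I := .div) (o := (· / ·)) (fun _ _ _ _ => rfl) (fun _ _ => rfl) (fun _ => rfl)
      (fun _ => rfl) (by simp only [Expr.deg]; omega) (fun σ => ev _ σ)
  | get a e f he hf =>
    intro hD k p c σ hc hp hr hb hσ
    simp only [Expr.deg] at hD
    simp only [Expr.code] at hc
    rw [codeAt_append, codeAt_append, codeAt_append] at hc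
    obtain ⟨hc1, hc2, hc3, hc4, -⟩ := hc
    obtain ⟨c1, q1, p1, k1, v1⟩ := he (by omega) k p c σ hc1 hp hr hb hσ
    obtain ⟨c2, q2, p2, k2, v2⟩ := hf (by omega) (k + 1) _ c1 σ hc2 p1 (k1.rel hr) q1.bounded hσ
    have hr2 := k2.rel (k1.rel hr)
    have hA : addr (c2.reg 1) a (e.eval σ) (f.eval σ) ≤ B := by
      rw [hr2.base]
      exact (addr_le hV hσ.base (e.eval_le hV hσ) (f.eval_le hV hσ)).trans ((mono hD).trans hB)
    obtain ⟨c3, q3, p3, k3, v3⟩ := addrCode_run q2.bounded hc3 p2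
      (by rw [k2.tmp k (by omega), v1]) v2 hA
    have hr3 := k3.rel hr2
    obtain ⟨c4, q4, p4, m4, r4⟩ := run_set (d := tmp k) (v := σ.A a (e.eval σ) (f.eval σ)) q3.bounded
      (by rw [p3]; exact hc4)
      (by simp only [Instr.exec]; rw [v3, hr2.base, hr3.A])
      ((hσ.A _ _ _).trans ((by simpa using mono (show 1 ≤ D by omega) : V ≤ V ^ D).trans hB))
    refine ⟨c4, (((q1.trans q2).trans q3).trans q4).mono (by simp only [Expr.cost]; omega), ?_, ?_,
      by simp [r4, Expr.eval]⟩
    · rw [p4, p3]; simp [Expr.code, addrCode]; omega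
    · refine ((k1.trans (k2.mono le_rfl (by omega))).trans k3).trans ?_
      have := keep_tmp ∅ (le_refl k) c3 c4.pc (σ.A a (e.eval σ) (f.eval σ))
      rw [← r4, ← m4] at this
      exact this
  | raw e he =>
    intro hD k p c σ hc hp hr hb hσ
    simp only [Expr.deg] at hD
    simp only [Expr.code] at hc
    rw [codeAt_append] at hc
    obtain ⟨hc1, hc2, hc3, hc4, -⟩ := hc
    have hVB : V ≤ B := (by simpa using mono (show 1 ≤ D by omega) : V ≤ V ^ D).trans hB
    have hbB := hσ.base.trans hVB
    obtain ⟨c1, q1, p1, k1, v1⟩ := he (by omega) k p c σ hc1 hp hr hb hσ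
    have hr1 := k1.rel hr
    obtain ⟨c2, q2, p2, m2, r2⟩ := run_set (d := tmp k) (v := σ.base - e.eval σ) q1.bounded
      (by rw [p1]; exact hc2) (by simp only [Instr.exec]; rw [v1, hr1.base]) (by omega)
    -- With truncated subtraction, `β - (β - e)` is `min e β`. This keeps the read inside the cells
    -- that `raw` describes.
    obtain ⟨c3, q3, p3, m3, r3⟩ := run_set (d := tmp k) (v := min (e.eval σ) σ.base) q2.bounded
      (by rw [p2, p1]; exact hc3)
      (by simp only [Instr.exec, r2]
          rw [Function.update_of_ne (one_ne_tmp k), hr1.base, Function.update_self,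
            show σ.base - (σ.base - e.eval σ) = min (e.eval σ) σ.base by omega])
      (by omega)
    obtain ⟨c4, q4, p4, m4, r4⟩ := run_set (d := tmp k) (v := σ.raw (min (e.eval σ) σ.base))
      q3.bounded (by rw [p3, p2, p1]; exact hc4)
      (by simp only [Instr.exec, r3]
          rw [Function.update_self, m3, m2, hr1.raw _ (by omega)])
      ((hσ.raw _).trans hVB)
    refine ⟨c4, (((q1.trans q2).trans q3).trans q4).mono (by simp only [Expr.cost]; omega), ?_, ?_,
      by simp [r4, Expr.eval]⟩
    · rw [p4, p3, p2, p1]; simp [Expr.code]; omega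
    · refine k1.trans ⟨by rw [m4, m3, m2], fun x _ => ?_, ?_, fun j hj => ?_⟩
      · simp [r4, r3, r2]
      · simp [r4, r3, r2]
      · have : j ≠ k := by omega
        simp [r4, r3, r2, this]
  | sum x v e he =>
    intro hD k p c σ hc hp hr hb hσ
    have hev := ev _ σ hD hσ
    simp only [Expr.deg] at hD
    -- The temporary `k` holds the partial sum. The loop variable `x` is exempt until the end, where
    -- the loop restores it.
    let J : ℕ → Config → Prop := fun i c' => c'.mem = c.mem ∧
      (∀ y, y ≠ x → c'.reg (2 * y) = c.reg (2 * y)) ∧ c'.reg 1 = c.reg 1 ∧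
      (∀ j < k, c'.reg (tmp j) = c.reg (tmp j)) ∧
      c'.reg (tmp k) = ∑ j ∈ Finset.range i, e.eval (σ.setR x j)
    have hJr : ∀ i c', J i c' → RelOff {x} σ c' := by
      rintro i c' ⟨j1, j2, j3, -⟩
      exact ⟨fun y hy => (j2 y hy).trans (hr.r y (by simp)), j3.trans hr.base,
        fun i hi => by rw [j1]; exact hr.raw i hi, fun a i j => by rw [j1]; exact hr.A a i j⟩
    refine Exists.elim (loop_run (v := v) (n := σ.r v) J
      (fun i => e.cost (σ.setR x i) + 1) hB1 hb hc (by simp) hp (hr.r v (by simp)) ?_ ?_ ?_) ?_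
    · rintro c' hk h0
      exact ⟨hk.mem, fun y hy => hk.r y hy, hk.base, hk.tmp, by simpa using h0⟩
    · rintro i c₁ c₂ ⟨j1, j2, j3, j4, j5⟩ hk
      exact ⟨hk.mem.trans j1, fun y hy => (hk.r y hy).trans (j2 y hy), hk.base.trans j3,
        fun j hj => (hk.tmp j (by omega)).trans (j4 j hj), (hk.tmp k (by omega)).trans j5⟩
    · intro i hi c₁ hJ hb1 hp1 hx1
      have hr1 := (hJr i c₁ hJ).setR hx1
      obtain ⟨j1, j2, j3, j4, j5⟩ := hJ
      simp only [Expr.code] at hc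
      rw [codeAt_append, codeAt_append, codeAt_append] at hc
      obtain ⟨-, ⟨hc1, hc2, -⟩, -⟩ := hc
      obtain ⟨c2, q2, p2, k2, v2⟩ := he (by omega) (k + 4) (p + 8) c₁ (σ.setR x i) hc1 hp1 hr1 hb1
        (hσ.setR (hi.le.trans (hσ.r v)))
      obtain ⟨c3, q3, p3, m3, r3⟩ := run_set (d := tmp k)
        (v := ∑ j ∈ Finset.range (i + 1), e.eval (σ.setR x j)) q2.bounded
        (by rw [p2]; exact hc2)
        (by simp only [Instr.exec]; rw [v2, k2.tmp k (by omega), j5, Finset.sum_range_succ])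
        (le_trans (Finset.sum_le_sum_of_subset (Finset.range_mono hi)) hev)
      refine ⟨c3, q2.trans q3, by rw [p3, p2]; omega, ⟨by rw [m3, k2.mem, j1], fun y hy => ?_, ?_,
        fun j hj => ?_, ?_⟩, fun j h1 h2 => ?_⟩
      · simp [r3, k2.r y, j2 y hy]
      · simp [r3, k2.base, j3]
      · have : j ≠ k := by omega
        simp [r3, this, k2.tmp j (by omega), j4 j hj]
      · simp [r3]
      · have : j ≠ k := by omega
        simp [r3, this, k2.tmp j h2]
    · rintro c' ⟨q, p', ⟨j1, j2, j3, j4, j5⟩, hx⟩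
      refine ⟨c', q.mono (by simp [Expr.cost]), ?_, ⟨j1, fun y _ => ?_, j3, j4⟩, j5⟩
      · rw [p']; simp [Expr.code, loopHead, loopTail]; omega
      · by_cases h : y = x
        · rw [h, hx]
        · exact j2 y h

end

section

variable {P : Program} {V D B : ℕ}

/-- Temporaries below `k` belong to the enclosing loops, which keep their counters there, and must
survive. Stored values stay at most `V` by `Safe`, while intermediate results may reach `V ^ D`. -/
theorem Stmt.correct (hV : 2 ≤ V) (hB : V ^ D ≤ B) (s : Stmt) : s.deg ≤ D →
    ∀ (k p : ℕ) (c : Config) (σ : Store), CodeAt P p (s.code k p) → c.pc = p → Rel σ c →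
      c.Bounded B → σ.Le V → s.Safe V σ → ∃ c', P.Reach B (s.cost σ) c c' ∧
        c'.pc = p + (s.code k p).length ∧ Rel (s.exec σ) c' ∧
        ∀ j < k, c'.reg (tmp j) = c.reg (tmp j) := by
  have mono : ∀ {a b : ℕ}, a ≤ b → V ^ a ≤ V ^ b := fun h => Nat.pow_le_pow_right (by omega) h
  have hB1 : 1 ≤ B := (Nat.one_le_pow _ _ (by omega)).trans hB
  have hVB : 1 ≤ D → V ≤ B := fun h => (by simpa using mono h : V ≤ V ^ D).trans hB
  induction s with
  | assign x e =>
    intro hD k p c σ hc hp hr hb hσ hs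
    simp only [Stmt.deg] at hD
    simp only [Stmt.code, codeAt_append] at hc
    obtain ⟨hc1, hc2, hc3, -⟩ := hc
    obtain ⟨c1, q1, p1, k1, v1⟩ := e.correct hV hB hD k p c σ hc1 hp hr hb hσ
    have he : e.eval σ ≤ B := (e.eval_le hV hσ).trans ((mono hD).trans hB)
    obtain ⟨c2, q2, p2, m2, r2⟩ := run_set (d := 2 * x) (v := 0) q1.bounded
      (by rw [p1]; exact hc2) rfl (by omega)
    obtain ⟨c3, q3, p3, m3, r3⟩ := run_set (d := 2 * x) (v := e.eval σ) q2.bounded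
      (by rw [p2, p1]; exact hc3) (by simp [Instr.exec, r2, v1]) he
    have h2 := keep_var (X := {x}) rfl k c1 c2.pc 0
    rw [← r2, ← m2] at h2
    have h3 := keep_var (X := {x}) rfl k c2 c3.pc (e.eval σ)
    rw [← r3, ← m3] at h3
    have hk : Keep {x} k c c3 := ((k1.mono (by simp) le_rfl).trans h2).trans h3
    refine ⟨c3, (q1.trans q2).trans q3, ?_, (hk.rel (hr.mono (by simp))).setR (by simp [r3]),
      hk.tmp⟩
    rw [p3, p2, p1]; simp [Stmt.code]; omega
  | store a i j e =>
    intro hD k p c σ hc hp hr hb hσ hs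
    simp only [Stmt.deg] at hD
    simp only [Stmt.code] at hc
    rw [codeAt_append, codeAt_append, codeAt_append, codeAt_append] at hc
    obtain ⟨hc1, hc2, hc3, hc4, hc5, -⟩ := hc
    obtain ⟨c1, q1, p1, k1, v1⟩ := i.correct hV hB (by omega) k p c σ hc1 hp hr hb hσ
    obtain ⟨c2, q2, p2, k2, v2⟩ := j.correct hV hB (by omega) (k + 1) _ c1 σ hc2 p1 (k1.rel hr)
      q1.bounded hσ
    have hr2 := k2.rel (k1.rel hr)
    obtain ⟨c3, q3, p3, k3, v3⟩ := addrCode_run q2.bounded hc3 p2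
      (by rw [k2.tmp k (by omega), v1]) v2 (by
        rw [hr2.base]
        exact (addr_le hV hσ.base (i.eval_le hV hσ) (j.eval_le hV hσ)).trans
          ((mono (by omega)).trans hB))
    have hr3 := k3.rel hr2
    obtain ⟨c4, q4, p4, k4, v4⟩ := e.correct hV hB (by omega) (k + 1) _ c3 σ hc4
      (by rw [p3]; rfl) hr3 q3.bounded hσ
    have hr4 := k4.rel hr3
    have he : e.eval σ ≤ B := (e.eval_le hV hσ).trans ((mono (by omega)).trans hB)
    have hadr : c4.reg (tmp k) = addr σ.base a (i.eval σ) (j.eval σ) := by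
      rw [k4.tmp k (by omega), v3, hr2.base]
    have hex : (Instr.store (tmp k) (tmp (k + 1))).exec c4 = ⟨c4.pc + 1, c4.reg,
        Function.update c4.mem (addr σ.base a (i.eval σ) (j.eval σ)) (e.eval σ)⟩ := by
      simp only [Instr.exec, hadr, v4]
    have q5 := q4.snoc (i := .store (tmp k) (tmp (k + 1))) (by rw [p4]; exact hc5)
      (by rw [hex]; exact q4.bounded.updateMem _ _ _ he)
    rw [hex] at q5
    refine ⟨_, (((q1.trans q2).trans q3).trans q5).mono (by simp only [Stmt.cost]; omega), ?_,
      ⟨hr4.r, hr4.base, fun l hl => ?_, fun b x y => ?_⟩, fun l hl => ?_⟩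
    · simp only [p4, Stmt.code]; simp [addrCode]; omega
    · simp only [Stmt.exec, Store.setA_raw]
      rw [Function.update_of_ne, hr4.raw l hl]
      have := lt_addr σ.base a (i.eval σ) (j.eval σ)
      simp only [Stmt.exec, Store.setA_base] at hl
      omega
    · simp only [Stmt.exec, Store.setA_base, Store.setA_A]
      by_cases h : addr σ.base b x y = addr σ.base a (i.eval σ) (j.eval σ)
      · obtain ⟨rfl, rfl, rfl⟩ := addr_inj h
        simp [upd]
      · rw [Function.update_of_ne h, hr4.A]
        by_cases hab : b = a
        · subst hab
          have : ¬ (x = i.eval σ ∧ y = j.eval σ) := by rintro ⟨rfl, rfl⟩; exact h rfl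
          simp [upd, this]
        · rw [Function.update_of_ne hab]
    · simp only
      rw [k4.tmp l (by omega), k3.tmp l hl, k2.tmp l (by omega), k1.tmp l hl]
  | seq s t hs ht =>
    intro hD k p c σ hc hp hr hb hσ hsafe
    simp only [Stmt.deg] at hD
    simp only [Stmt.code] at hc
    rw [codeAt_append] at hc
    obtain ⟨c1, q1, p1, r1, t1⟩ := hs (by omega) k p c σ hc.1 hp hr hb hσ hsafe.1
    obtain ⟨c2, q2, p2, r2, t2⟩ := ht (by omega) k _ c1 _ hc.2 p1 r1 q1.bounded
      (hsafe.1.exec_le hσ) hsafe.2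
    exact ⟨c2, q1.trans q2, by rw [p2]; simp [Stmt.code]; omega, r2,
      fun j hj => (t2 j hj).trans (t1 j hj)⟩
  | loop x v s ih =>
    intro hD k p c σ hc hp hr hb hσ hsafe
    simp only [Stmt.deg] at hD
    let J : ℕ → Config → Prop := fun i c' => RelOff {x} (iter s.exec x σ i) c' ∧
      ∀ j < k, c'.reg (tmp j) = c.reg (tmp j)
    have hle : ∀ i ≤ σ.r v, (iter s.exec x σ i).Le V := by
      intro i hi
      induction i with
      | zero => exact hσ
      | succ i ih' =>
        exact (hsafe i (by omega)).exec_le ((ih' (by omega)).setR (by have := hσ.r v; omega))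
    refine Exists.elim (loop_run (v := v) (n := σ.r v) J
      (fun i => s.cost ((iter s.exec x σ i).setR x i)) hB1 hb hc rfl hp (hr.r v (by simp)) ?_ ?_ ?_) ?_
    · rintro c' hk -
      exact ⟨hk.rel (hr.mono (by simp)), hk.tmp⟩
    · rintro i c₁ c₂ ⟨j1, j2⟩ hk
      exact ⟨hk.rel j1, fun j hj => (hk.tmp j (by omega)).trans (j2 j hj)⟩
    · rintro i hi c₁ ⟨j1, j2⟩ hb1 hp1 hx1
      simp only [Stmt.code] at hc
      rw [codeAt_append, codeAt_append] at hc
      obtain ⟨c2, q2, p2, r2, t2⟩ := ih (by omega) (k + 4) (p + 8) c₁ _ hc.2.1 hp1 (j1.setR hx1)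
        hb1 ((hle i hi.le).setR (hi.le.trans (hσ.r v))) (hsafe i hi)
      exact ⟨c2, q2, p2, ⟨r2.mono (by simp), fun j hj => (t2 j (by omega)).trans (j2 j hj)⟩,
        fun j _ h => t2 j h⟩
    · rintro c' ⟨q, p', ⟨j1, j2⟩, hx⟩
      refine ⟨c', q, by rw [p']; simp [Stmt.code, loopHead, loopTail]; omega, ?_, j2⟩
      exact j1.setR (by rw [hx, hr.r x (by simp)])

end

/-! ### The automaton of the translates of a word

A word over `X` of length `n` is given by its letters `c 0, …, c (n - 1)`; a group `H` acts on the
letters. The states of the automaton are the translates of the proper prefixes of the word. -/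

namespace Auto

section Defs

variable (H : Type*) {X : Type*} [AddCommGroup H] [AddAction H X] (κ : X → ℕ) (c : ℕ → X) (n : ℕ)

/-- The translate by `h` of the prefix of length `l`. -/
def wd {H : Type*} [AddCommGroup H] [AddAction H X] (l : ℕ) (h : H) : List X :=
  (List.range l).map fun i => h +ᵥ c i

/-- The states. -/
def InS (x : List X) : Prop := ∃ l < n, ∃ h : H, x = wd c l h

/-- After the letters `x`, the letter `v` creates no translate of the word, and nothing smaller. -/
def Good (x : List X) (v : X) : Prop :=
  ∀ l < n, ∀ h : H, wd c l h <:+ x → κ (c l) < κ (-h +ᵥ v) + if l + 1 < n then 1 else 0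

/-- The state after the letters `L`: the longest suffix of `L` that is a state. -/
def IsState (L x : List X) : Prop :=
  InS H c n x ∧ x <:+ L ∧ ∀ z, InS H c n z → z <:+ L → z.length ≤ x.length

/-- The transitions of the automaton. -/
def Step (x : List X) (v : X) (y : List X) : Prop := Good H κ c n x v ∧ IsState H c n (x ++ [v]) y

/-- After the letters `x`, the letters `L` create no translate of the word, and nothing smaller. -/
def GoodList (x : List X) (L : List X) : Prop := ∀ L₁ a, L₁ ++ [a] <+: L → Good H κ c n (x ++ L₁) a

end Defs

section

variable {H : Type*} {X : Type*} [AddCommGroup H] [AddAction H X] {κ : X → ℕ} {c : ℕ → X} {n : ℕ}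

@[simp] theorem neg_vadd_comp (g : H) :
    ((fun x : X => -g +ᵥ x) ∘ fun x => g +ᵥ x) = id := by ext x; simp

@[simp] theorem vadd_neg_comp (g : H) :
    ((fun x : X => g +ᵥ x) ∘ fun x => -g +ᵥ x) = id := by ext x; simp

@[simp] theorem length_wd (l : ℕ) (h : H) : (wd c l h).length = l := by simp [wd]

@[simp] theorem wd_zero (h : H) : wd c 0 h = [] := rfl

theorem wd_succ (l : ℕ) (h : H) : wd c (l + 1) h = wd c l h ++ [h +ᵥ c l] := by
  simp [wd, List.range_succ]

theorem map_wd (l : ℕ) (h g : H) : (wd c l h).map (g +ᵥ ·) = wd c l (g + h) := by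
  simp [wd, add_vadd]

theorem InS.length_lt {x : List X} (h : InS H c n x) : x.length < n := by
  obtain ⟨l, hl, h, rfl⟩ := h
  simpa using hl

theorem inS_nil (hn : 0 < n) : InS H c n [] := ⟨0, hn, 0, rfl⟩

theorem InS.map {x : List X} (hx : InS H c n x) (g : H) : InS H c n (x.map (g +ᵥ ·)) := by
  obtain ⟨l, hl, h, rfl⟩ := hx
  exact ⟨l, hl, g + h, map_wd l h g⟩

theorem suffix_snoc_iff {L : List X} {z : List X} {v a : X} :
    z ++ [a] <:+ L ++ [v] ↔ a = v ∧ z <:+ L := by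
  rw [List.suffix_concat_iff]
  constructor
  · rintro (h | ⟨t, h1, h2⟩)
    · simp at h
    · obtain ⟨rfl, h⟩ := List.append_inj' h1 rfl
      simp at h
      exact ⟨h, h2⟩
  · rintro ⟨rfl, h⟩
    exact Or.inr ⟨z, rfl, h⟩

theorem wd_suffix_snoc {l : ℕ} {h : H} {L : List X} {v : X} :
    wd c (l + 1) h <:+ L ++ [v] ↔ h +ᵥ c l = v ∧ wd c l h <:+ L := by
  rw [wd_succ, suffix_snoc_iff]

theorem IsState.unique {L x y : List X} (hx : IsState H c n L x) (hy : IsState H c n L y) :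
    x = y := by
  have h1 := hx.2.2 y hy.1 hy.2.1
  have h2 := hy.2.2 x hx.1 hx.2.1
  exact (List.suffix_of_suffix_length_le hx.2.1 hy.2.1 h2).eq_of_length (by omega)

theorem IsState.exists (hn : 0 < n) (L : List X) : ∃ x, IsState H c n L x := by
  classical
  have hP : ∃ m, ∃ x, InS H c n x ∧ x <:+ L ∧ x.length = m := ⟨0, [], inS_nil hn, by simp, rfl⟩
  obtain ⟨m, hm⟩ : ∃ m, m = Nat.findGreatest (fun m => ∃ x, InS H c n x ∧ x <:+ L ∧ x.length = m) n :=
    ⟨_, rfl⟩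
  have h0 := Nat.findGreatest_spec (P := fun m => ∃ x, InS H c n x ∧ x <:+ L ∧ x.length = m)
    (Nat.zero_le n) ⟨[], inS_nil hn, by simp, rfl⟩
  obtain ⟨x, hx1, hx2, hx3⟩ := h0
  refine ⟨x, hx1, hx2, fun z hz1 hz2 => ?_⟩
  rw [hx3]
  exact Nat.le_findGreatest hz1.length_lt.le ⟨z, hz1, hz2, rfl⟩

theorem isState_self {x : List X} (hx : InS H c n x) : IsState H c n x x :=
  ⟨hx, List.suffix_refl x, fun _ _ h => h.length_le⟩

/-- Of two suffixes of the same list the shorter is a suffix of the longer. So the longest state at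
the end of `L` knows all the others, and nothing else about `L` matters to the automaton. -/
theorem IsState.suffix_iff {L x z : List X} (hx : IsState H c n L x) (hz : InS H c n z) :
    z <:+ L ↔ z <:+ x :=
  ⟨fun h => List.suffix_of_suffix_length_le h hx.2.1 (hx.2.2 z hz h), fun h => h.trans hx.2.1⟩

theorem IsState.good_iff {L x : List X} (hx : IsState H c n L x) {v : X} :
    Good H κ c n L v ↔ Good H κ c n x v := by
  unfold Good
  refine forall_congr' fun l => forall_congr' fun hl => forall_congr' fun h => ?_
  rw [hx.suffix_iff ⟨l, hl, h, rfl⟩]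

/-- A nonempty translated prefix at the end of `L ++ [v]` is a shorter translated prefix at the end
of `L`, again a state, followed by `v`. Hence the next state depends only on the present one and on
`v`. -/
theorem IsState.snoc_suffix_iff {L x z : List X} {v : X} (hx : IsState H c n L x)
    (hz : InS H c n z) : z <:+ L ++ [v] ↔ z <:+ x ++ [v] := by
  obtain ⟨l, hl, h, rfl⟩ := hz
  cases l with
  | zero => simp
  | succ l => rw [wd_suffix_snoc, wd_suffix_snoc, hx.suffix_iff ⟨l, by omega, h, rfl⟩]

theorem IsState.snoc_iff {L x y : List X} {v : X} (hx : IsState H c n L x) :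
    IsState H c n (L ++ [v]) y ↔ IsState H c n (x ++ [v]) y := by
  unfold IsState
  constructor
  · rintro ⟨h1, h2, h3⟩
    exact ⟨h1, (hx.snoc_suffix_iff h1).mp h2, fun z hz h => h3 z hz ((hx.snoc_suffix_iff hz).mpr h)⟩
  · rintro ⟨h1, h2, h3⟩
    exact ⟨h1, (hx.snoc_suffix_iff h1).mpr h2, fun z hz h => h3 z hz ((hx.snoc_suffix_iff hz).mp h)⟩

theorem IsState.append_iff (hn : 0 < n) {L x : List X} (hx : IsState H c n L x) (L₁ : List X) :
    ∀ y, IsState H c n (L ++ L₁) y ↔ IsState H c n (x ++ L₁) y := by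
  induction L₁ using List.reverseRecOn with
  | nil =>
    intro y
    simp only [List.append_nil]
    constructor
    · intro h
      rw [← hx.unique h]
      exact isState_self hx.1
    · intro h
      rw [← (isState_self hx.1).unique h]
      exact hx
  | append_singleton L₁ a ih =>
    intro y
    obtain ⟨y', hy'⟩ := IsState.exists (H := H) (c := c) hn (L ++ L₁)
    rw [← List.append_assoc, ← List.append_assoc, hy'.snoc_iff, ((ih y').mp hy').snoc_iff]

theorem IsState.good_append_iff (hn : 0 < n) {L x : List X} (hx : IsState H c n L x)
    (L₁ : List X) (a : X) : Good H κ c n (L ++ L₁) a ↔ Good H κ c n (x ++ L₁) a := by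
  obtain ⟨y', hy'⟩ := IsState.exists (H := H) (c := c) hn (L ++ L₁)
  rw [hy'.good_iff, ((hx.append_iff hn L₁ y').mp hy').good_iff]

theorem suffix_map_iff (g : H) {z L : List X} :
    z.map (g +ᵥ ·) <:+ L.map (g +ᵥ ·) ↔ z <:+ L := by
  constructor
  · intro h
    have := h.map (-g +ᵥ ·)
    simpa using this
  · exact fun h => h.map _

/-- Translation by `g` permutes the translated prefixes. With `IsState.map` this makes the whole
automaton equivariant, which is what allows walks that close up only after a translation. -/
theorem good_map (g : H) {x : List X} {v : X} (h : Good H κ c n x v) :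
    Good H κ c n (x.map (g +ᵥ ·)) (g +ᵥ v) := by
  intro l hl h' hs
  have := h l hl (-g + h') (by
    rw [← suffix_map_iff g, map_wd]
    simpa using hs)
  have e : -(-g + h') +ᵥ v = -h' +ᵥ (g +ᵥ v) := by rw [← add_vadd]; congr 1; abel
  rwa [e] at this

theorem IsState.map (g : H) {L x : List X} (h : IsState H c n L x) :
    IsState H c n (L.map (g +ᵥ ·)) (x.map (g +ᵥ ·)) := by
  refine ⟨h.1.map g, (suffix_map_iff g).mpr h.2.1, fun z hz hs => ?_⟩
  have := h.2.2 (z.map (-g +ᵥ ·)) (hz.map _) (by rw [← suffix_map_iff g]; simpa using hs)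
  simpa using this

/-- Letters that lie too far back do not matter. -/
theorem isState_append_left {L₀ L y : List X} (hL : n ≤ L.length + 1) :
    IsState H c n (L₀ ++ L) y ↔ IsState H c n L y := by
  have key : ∀ z, InS H c n z → (z <:+ L₀ ++ L ↔ z <:+ L) := by
    intro z hz
    have := hz.length_lt
    exact ⟨fun h => List.suffix_of_suffix_length_le h (List.suffix_append _ _) (by omega),
      fun h => h.trans (List.suffix_append _ _)⟩
  constructor
  · rintro ⟨h1, h2, h3⟩
    exact ⟨h1, (key y h1).mp h2, fun z hz h => h3 z hz ((key z hz).mpr h)⟩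
  · rintro ⟨h1, h2, h3⟩
    exact ⟨h1, (key y h1).mpr h2, fun z hz h => h3 z hz ((key z hz).mp h)⟩

theorem goodList_nil (x : List X) : GoodList H κ c n x [] := by
  intro L₁ a h
  simp at h

theorem goodList_snoc {x L : List X} {v : X} :
    GoodList H κ c n x (L ++ [v]) ↔ GoodList H κ c n x L ∧ Good H κ c n (x ++ L) v := by
  constructor
  · intro h
    exact ⟨fun L₁ a hp => h L₁ a (hp.trans (List.prefix_append _ _)), h L v (List.prefix_refl _)⟩
  · rintro ⟨h1, h2⟩ L₁ a hp
    rw [List.prefix_concat_iff] at hp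
    rcases hp with hp | hp
    · obtain ⟨rfl, h⟩ := List.append_inj' hp rfl
      simp at h
      exact h ▸ h2
    · exact h1 L₁ a hp

theorem IsState.goodList_iff (hn : 0 < n) {L x : List X} (hx : IsState H c n L x) (L₁ : List X) :
    GoodList H κ c n L L₁ ↔ GoodList H κ c n x L₁ := by
  unfold GoodList
  refine forall_congr' fun L₂ => forall_congr' fun a => ?_
  rw [hx.good_append_iff hn]

theorem goodList_map (g : H) {x L : List X} (h : GoodList H κ c n x L) :
    GoodList H κ c n (x.map (g +ᵥ ·)) (L.map (g +ᵥ ·)) := by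
  intro L₁ a hp
  have h1 := h (L₁.map (-g +ᵥ ·)) (-g +ᵥ a) (by
    have := hp.map (-g +ᵥ ·)
    simpa using this)
  simpa using good_map g h1

theorem goodList_append {x L L' : List X} :
    GoodList H κ c n x (L ++ L') ↔ GoodList H κ c n x L ∧ GoodList H κ c n (x ++ L) L' := by
  induction L' using List.reverseRecOn with
  | nil => simp [goodList_nil]
  | append_singleton L' a ih =>
    rw [← List.append_assoc, goodList_snoc, ih, goodList_snoc]
    simp [and_assoc]

end

end Auto

/-! ### Walks of the automaton, and sequences all of whose translates exceed the word -/

namespace Auto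

section Defs

variable (H : Type*) {X : Type*} [AddCommGroup H] [AddAction H X] (κ : X → ℕ) (c : ℕ → X) (n : ℕ)

/-- In every translate, and from every position on, the sequence `s` is larger than the word. -/
def GoodAll (s : ℕ → X) : Prop :=
  ∀ (j : ℕ) (h : H), ∃ t < n, (∀ i < t, h +ᵥ s (j + i) = c i) ∧ κ (c t) < κ (h +ᵥ s (j + t))

/-- The first letters of a sequence. -/
def pre (s : ℕ → X) (i : ℕ) : List X := (List.range i).map s

/-- A sequence of letters in `Y` that leads from the state `x` to the state `y`. -/
def IsWalk (Y : Set X) {m : ℕ} (x y : List X) (v : Fin m → X) : Prop :=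
  (∀ i, v i ∈ Y) ∧ GoodList H κ c n x (List.ofFn v) ∧ IsState H c n (x ++ List.ofFn v) y

open Classical in
/-- The number of walks of length `m` from `x` to `y`. -/
noncomputable def walks [Fintype X] (Y : Set X) (m : ℕ) (x y : List X) : ℕ :=
  ∑ v : Fin m → X, if IsWalk H κ c n Y x y v then 1 else 0

open Classical in
/-- The number of letters in `Y` that lead from `x` to `y`. -/
noncomputable def trans [Fintype X] (Y : Set X) (x y : List X) : ℕ :=
  ∑ a : X, if a ∈ Y ∧ Step H κ c n x a y then 1 else 0

open Classical in
/-- The set of states. -/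
noncomputable def states [Fintype H] : Finset (List X) :=
  (Finset.range n ×ˢ (Finset.univ : Finset H)).image fun p => wd c p.1 p.2

end Defs

/-- The sequence with first letters `v` that is translated by `f` when it is shifted by `m`. -/
def twist {H X : Type*} [AddCommGroup H] [AddAction H X] (f : H) {m : ℕ} (hm : 0 < m)
    (v : Fin m → X) (i : ℕ) : X := (i / m) • f +ᵥ v ⟨i % m, Nat.mod_lt _ hm⟩

section

variable {H : Type*} {X : Type*} [AddCommGroup H] [AddAction H X] {κ : X → ℕ} {c : ℕ → X} {n : ℕ}

theorem mem_states [Fintype H] {x : List X} : x ∈ states H c n ↔ InS H c n x := by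
  simp only [states, Finset.mem_image, Finset.mem_product, Finset.mem_range, Finset.mem_univ,
    and_true, Prod.exists, InS]
  constructor
  · rintro ⟨l, h, hl, rfl⟩; exact ⟨l, hl, h, rfl⟩
  · rintro ⟨l, hl, h, rfl⟩; exact ⟨l, h, hl, rfl⟩

theorem pre_succ (s : ℕ → X) (i : ℕ) : pre s (i + 1) = pre s i ++ [s i] := by
  simp [pre, List.range_succ]

@[simp] theorem length_pre (s : ℕ → X) (i : ℕ) : (pre s i).length = i := by simp [pre]

theorem pre_add (s : ℕ → X) (i j : ℕ) : pre s (i + j) = pre s i ++ pre (fun t => s (i + t)) j := by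
  simp [pre, List.range_add]

theorem pre_map (s : ℕ → X) (g : H) (i : ℕ) :
    pre (fun t => g +ᵥ s t) i = (pre s i).map (g +ᵥ ·) := by
  simp [pre]

theorem goodList_pre {x : List X} {s : ℕ → X} {i : ℕ} :
    GoodList H κ c n x (pre s i) ↔ ∀ j < i, Good H κ c n (x ++ pre s j) (s j) := by
  induction i with
  | zero => simp [pre, goodList_nil]
  | succ i ih =>
    rw [pre_succ, goodList_snoc, ih]
    constructor
    · rintro ⟨h1, h2⟩ j hj
      rcases Nat.lt_succ_iff_lt_or_eq.mp hj with h | rfl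
      · exact h1 j h
      · exact h2
    · exact fun h => ⟨fun j hj => h j (by omega), h i (by omega)⟩

theorem wd_suffix_pre {s : ℕ → X} {j t : ℕ} {h : H}
    (hs : ∀ i < t, h +ᵥ s (j + i) = c i) : wd c t (-h) <:+ pre s (j + t) := by
  rw [pre_add]
  have : pre (fun i => s (j + i)) t = wd c t (-h) := by
    unfold pre wd
    refine List.map_congr_left fun i hi => ?_
    rw [← hs i (List.mem_range.mp hi)]
    simp
  rw [this]
  exact List.suffix_append _ _

theorem of_wd_suffix_pre {s : ℕ → X} {i l : ℕ} {h : H} (hs : wd c l h <:+ pre s i) :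
    l ≤ i ∧ ∀ t < l, -h +ᵥ s (i - l + t) = c t := by
  have hl : l ≤ i := by simpa using hs.length_le
  refine ⟨hl, fun t ht => ?_⟩
  obtain ⟨j, rfl⟩ : ∃ j, i = j + l := ⟨i - l, by omega⟩
  rw [pre_add] at hs
  have h1 := (List.suffix_of_suffix_length_le hs (List.suffix_append _ _)
    (by simp)).eq_of_length (by simp)
  have h2 := congrArg (fun L => L[t]?) h1
  simp [wd, pre, ht] at h2
  rw [Nat.add_sub_cancel, ← h2]
  simp

/-- If the sequence did not exceed the word from some position on, then `Good` together with the
injectivity of `κ` would force agreement letter after letter; the inequality for the last letter of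
the word is strict and excludes this. -/
theorem goodAll_of_good (hκ : Function.Injective κ) (hn : 0 < n) {x : List X} {s : ℕ → X}
    (h : ∀ i, Good H κ c n (x ++ pre s i) (s i)) : GoodAll H κ c n s := by
  intro j g
  by_contra! hc
  have h1 : ∀ t < n, (∀ i < t, g +ᵥ s (j + i) = c i) →
      κ (c t) < κ (g +ᵥ s (j + t)) + if t + 1 < n then 1 else 0 := by
    intro t ht hp
    have := h (j + t) t ht (-g) ((wd_suffix_pre hp).trans (List.suffix_append _ _))
    rwa [neg_neg] at this
  have h2 : ∀ t < n, ∀ i < t, g +ᵥ s (j + i) = c i := by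
    intro t
    induction t with
    | zero => simp
    | succ t ih =>
      intro ht i hi
      have ih := ih (by omega)
      rcases Nat.lt_succ_iff_lt_or_eq.mp hi with h' | rfl
      · exact ih i h'
      · have a1 := h1 i (by omega) ih
        have a2 := hc i (by omega) ih
        rw [if_pos (by omega)] at a1
        exact hκ (by omega)
  have a1 := h1 (n - 1) (by omega) (h2 _ (by omega))
  have a2 := hc (n - 1) (by omega) (h2 _ (by omega))
  rw [if_neg (by omega)] at a1
  omega

/-- A translated prefix of length `l` that ends before position `i` means agreement from `i - l` on
for `l` letters. So the letter at which the sequence exceeds the word is the next one or comes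
later; in the second case the next letter agrees and `l + 1 < n`. -/
theorem good_of_goodAll {s : ℕ → X} (h : GoodAll H κ c n s) (i : ℕ) :
    Good H κ c n (pre s i) (s i) := by
  intro l hl g hs
  obtain ⟨hli, hs⟩ := of_wd_suffix_pre hs
  obtain ⟨t, ht, h1, h2⟩ := h (i - l) (-g)
  have hlt : l ≤ t := by
    by_contra! hlt
    rw [hs t hlt] at h2
    exact lt_irrefl _ h2
  have e : i - l + l = i := by omega
  rcases hlt.eq_or_lt with rfl | hlt
  · rw [e] at h2
    omega
  · have := h1 l hlt
    rw [e] at this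
    rw [this, if_pos (by omega)]
    omega

section Twist

variable {f : H} {m : ℕ} (hm : 0 < m) (v : Fin m → X)

theorem twist_add (i k : ℕ) : twist f hm v (k * m + i) = k • f +ᵥ twist f hm v i := by
  unfold twist
  have h1 : (k * m + i) / m = k + i / m := by rw [mul_comm, Nat.mul_add_div hm]
  have h2 : (k * m + i) % m = i % m := by simp
  simp only [h1, h2]
  rw [add_nsmul, add_vadd]

theorem twist_lt {i : ℕ} (hi : i < m) : twist f hm v i = v ⟨i, hi⟩ := by
  unfold twist
  simp [Nat.div_eq_of_lt hi, Nat.mod_eq_of_lt hi]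

theorem ofFn_eq_pre : List.ofFn v = pre (twist f hm v) m := by
  refine List.ext_getElem (by simp) fun i h1 h2 => ?_
  simp at h1
  simp [pre, twist_lt hm v h1]

theorem pre_twist (k i : ℕ) : pre (twist f hm v) (k * m + i) =
    pre (twist f hm v) (k * m) ++ (pre (twist f hm v) i).map (k • f +ᵥ ·) := by
  rw [pre_add, ← pre_map]
  simp only [twist_add]

variable {v} {Y : Set X} {x : List X}

/-- Equivariance: the `k`-th period is the first one translated by `k • f`, and it starts in a state
translated by `k • f` as well. -/
theorem IsWalk.forever (hn : 0 < n) (hx : InS H c n x)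
    (hv : IsWalk H κ c n Y x (x.map (f +ᵥ ·)) v) (k : ℕ) :
    GoodList H κ c n x (pre (twist f hm v) (k * m)) ∧
      IsState H c n (x ++ pre (twist f hm v) (k * m)) (x.map (k • f +ᵥ ·)) := by
  obtain ⟨-, hv1, hv2⟩ := hv
  rw [ofFn_eq_pre (f := f) hm] at hv1 hv2
  induction k with
  | zero => simpa [pre, goodList_nil] using isState_self hx
  | succ k ih =>
    obtain ⟨i1, i2⟩ := ih
    rw [Nat.succ_mul, pre_twist, goodList_append, ← List.append_assoc, i2.goodList_iff hn,
      i2.append_iff hn, ← List.map_append]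
    refine ⟨⟨i1, goodList_map _ hv1⟩, ?_⟩
    have := hv2.map (k • f)
    rw [List.map_map] at this
    convert this using 2
    ext a
    simp [add_nsmul, add_vadd]

theorem IsWalk.goodAll (hκ : Function.Injective κ) (hn : 0 < n) (hx : InS H c n x)
    (hv : IsWalk H κ c n Y x (x.map (f +ᵥ ·)) v) : GoodAll H κ c n (twist f hm v) := by
  refine goodAll_of_good hκ hn (x := x) fun i => ?_
  refine goodList_pre.mp (hv.forever hm hn hx (i + 1)).1 i ?_
  nlinarith

/-- After `n` periods at least `n - 1` letters have been read, so the state no longer depends on the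
start. It is also the start translated by `n • f`, and that translation is injective. -/
theorem IsWalk.unique (hm : 0 < m) (hn : 0 < n) (hx : InS H c n x)
    (hv : IsWalk H κ c n Y x (x.map (f +ᵥ ·)) v) {y : List X} (hy : InS H c n y)
    (hv' : IsWalk H κ c n Y y (y.map (f +ᵥ ·)) v) : x = y := by
  have h1 := (hv.forever hm hn hx n).2
  have h2 := (hv'.forever hm hn hy n).2
  rw [isState_append_left (by simp; nlinarith)] at h1 h2
  exact List.map_injective_iff.mpr (AddAction.injective (n • f)) (h1.unique h2)

/-- The start is found by reading `n` periods from the empty state and translating the state reached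
by `-(n • f)`. -/
theorem IsWalk.exists (hn : 0 < n) (hY : ∀ i, v i ∈ Y) (hv : GoodAll H κ c n (twist f hm v)) :
    ∃ x, InS H c n x ∧ IsWalk H κ c n Y x (x.map (f +ᵥ ·)) v := by
  obtain ⟨z, hz⟩ := IsState.exists (H := H) (c := c) hn (pre (twist f hm v) (n * m))
  have back : (z.map (-(n • f) +ᵥ ·)).map (n • f +ᵥ ·) = z := by simp
  refine ⟨z.map (-(n • f) +ᵥ ·), hz.1.map _, hY, ?_, ?_⟩
  · have h1 : GoodList H κ c n (pre (twist f hm v) (n * m))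
        ((pre (twist f hm v) m).map (n • f +ᵥ ·)) := by
      have : GoodList H κ c n [] (pre (twist f hm v) (n * m + m)) :=
        goodList_pre.mpr fun j _ => good_of_goodAll hv j
      rw [pre_twist, goodList_append] at this
      exact this.2
    rw [hz.goodList_iff hn] at h1
    have h2 := goodList_map (-(n • f)) h1
    simpa [ofFn_eq_pre (f := f) hm] using h2
  · have h1 : IsState H c n (pre (twist f hm v) (n * m + m)) (z.map (f +ᵥ ·)) := by
      -- Seen as one period followed by `n` more: the first lies too far back to matter, and the
      -- others are the first `n` periods translated by `f`.
      have e : n * m + m = 1 * m + n * m := by ring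
      rw [e, pre_twist, isState_append_left (by simp; nlinarith)]
      simpa using hz.map f
    rw [pre_twist, hz.append_iff hn] at h1
    have h2 := h1.map (-(n • f))
    simp only [List.map_append, List.map_map, neg_vadd_comp, List.map_id] at h2
    rw [ofFn_eq_pre (f := f) hm, List.map_map]
    convert h2 using 2
    ext a
    simp only [Function.comp]
    rw [← add_vadd, ← add_vadd, add_comm]

open Classical in
-- Each admissible `v` belongs to exactly one state at which its walk starts, so summing the
-- closed-up walks over all states counts it once.
theorem sum_goodAll [Fintype H] [Fintype X] (hκ : Function.Injective κ) (hn : 0 < n) :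
    (∑ v : Fin m → X, if (∀ i, v i ∈ Y) ∧ GoodAll H κ c n (twist f hm v) then 1 else 0) =
      ∑ x ∈ states H c n, walks H κ c n Y m x (x.map (f +ᵥ ·)) := by
  unfold walks
  rw [Finset.sum_comm]
  refine Finset.sum_congr rfl fun v _ => ?_
  split_ifs with h
  · obtain ⟨x, hx, hw⟩ := IsWalk.exists hm hn h.1 h.2
    rw [Finset.sum_eq_single x]
    · rw [if_pos hw]
    · intro y hy hne
      rw [if_neg]
      exact fun hw' => hne (hw'.unique hm hn (mem_states.mp hy) hx hw)
    · exact fun h => absurd (mem_states.mpr hx) h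
  · symm
    refine Finset.sum_eq_zero fun x hx => if_neg fun hw => h ?_
    exact ⟨hw.1, hw.goodAll hm hκ hn (mem_states.mp hx)⟩

end Twist

open Classical in
theorem walks_zero [Fintype X] {Y : Set X} {x y : List X} (hx : InS H c n x) :
    walks H κ c n Y 0 x y = if x = y then 1 else 0 := by
  unfold walks
  rw [Fintype.sum_unique]
  have : IsWalk H κ c n Y x y (default : Fin 0 → X) ↔ x = y := by
    simp only [IsWalk, List.ofFn_zero, List.append_nil]
    constructor
    · rintro ⟨-, -, h⟩
      exact (isState_self hx).unique h
    · rintro rfl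
      exact ⟨fun i => i.elim0, goodList_nil x, isState_self hx⟩
  simp [this]

/-- The first letter leads to exactly one state, so for each sequence of letters only one summand
over `z` can be nonzero. -/
theorem walks_succ [Fintype H] [Fintype X] (hn : 0 < n) {Y : Set X} {m : ℕ} {x y : List X} :
    walks H κ c n Y (m + 1) x y =
      ∑ z ∈ states H c n, trans H κ c n Y x z * walks H κ c n Y m z y := by
  classical
  unfold walks trans
  simp_rw [Finset.sum_mul_sum]
  rw [Finset.sum_comm, ← Fintype.sum_equiv (Fin.consEquiv fun _ => X) _ _ (fun _ => rfl),
    Fintype.sum_prod_type]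
  refine Finset.sum_congr rfl fun a _ => ?_
  rw [Finset.sum_comm]
  refine Finset.sum_congr rfl fun v _ => ?_
  change (if IsWalk H κ c n Y x y (Fin.cons a v : Fin (m + 1) → X) then 1 else 0) = _
  obtain ⟨z, hz⟩ := IsState.exists (H := H) (c := c) hn (x ++ [a])
  have key : IsWalk H κ c n Y x y (Fin.cons a v : Fin (m + 1) → X) ↔
      (a ∈ Y ∧ Step H κ c n x a z) ∧ IsWalk H κ c n Y z y v := by
    have e : List.ofFn (Fin.cons a v : Fin (m + 1) → X) = [a] ++ List.ofFn v := by
      simp [List.ofFn_succ]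
    have e2 : GoodList H κ c n x [a] ↔ Good H κ c n x a := by
      have := goodList_snoc (H := H) (κ := κ) (c := c) (n := n) (x := x) (L := []) (v := a)
      simpa [goodList_nil] using this
    simp only [IsWalk, Step, e, Fin.forall_fin_succ, Fin.cons_zero, Fin.cons_succ]
    rw [goodList_append, ← List.append_assoc, hz.goodList_iff hn, hz.append_iff hn, e2]
    tauto
  rw [Finset.sum_eq_single z]
  · by_cases h1 : a ∈ Y ∧ Step H κ c n x a z <;> by_cases h2 : IsWalk H κ c n Y z y v <;>
      simp [key, h1, h2]
  · intro z' _ hne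
    rw [if_neg, zero_mul]
    rintro ⟨-, -, h⟩
    exact hne (h.unique hz)
  · exact fun h => absurd (mem_states.mpr hz.1) h

end

end Auto

open Classical in
/-- A sum over the values of a function, as a sum over the first arguments with these values. -/
theorem sum_first {Z : Type*} (f : ℕ → Z) (w : Z → ℕ) (M : ℕ) :
    ∑ p ∈ Finset.range M, (if ∀ p' < p, f p' ≠ f p then w (f p) else 0) =
      ∑ z ∈ (Finset.range M).image f, w z := by
  induction M with
  | zero => simp
  | succ M ih =>
    rw [Finset.sum_range_succ, ih, Finset.range_add_one, Finset.image_insert]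
    by_cases h : f M ∈ (Finset.range M).image f
    · rw [Finset.insert_eq_of_mem h, if_neg, add_zero]
      obtain ⟨p', hp', h⟩ := Finset.mem_image.mp h
      exact fun h' => h' p' (Finset.mem_range.mp hp') h
    · rw [Finset.sum_insert h, if_pos, add_comm]
      exact fun p' hp' h' => h (Finset.mem_image.mpr ⟨p', Finset.mem_range.mpr hp', h'⟩)

/-! ### Transitions, sorted by the orbits of the letters -/

namespace Auto

section

variable {H : Type*} {X : Type*} [AddCommGroup H] [AddAction H X] {κ : X → ℕ} {c : ℕ → X} {n : ℕ}

/-- The word is the smallest of its translates (in a form that compares suffixes with prefixes). -/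
def Minimal (H : Type*) {X : Type*} [AddCommGroup H] [AddAction H X] (κ : X → ℕ) (c : ℕ → X)
    (n : ℕ) : Prop :=
  ∀ l < n, ∀ l₂ ≤ l, ∀ h : H, (∀ i < l₂, h +ᵥ c (l - l₂ + i) = c i) → κ (c l₂) ≤ κ (h +ᵥ c l)

/-- The order of the letters compares orbits first. -/
structure OrbitOrder (H : Type*) {X : Type*} [AddCommGroup H] [AddAction H X] (κ cls : X → ℕ) :
    Prop where
  inj : Function.Injective κ
  vadd : ∀ (h : H) x, cls (h +ᵥ x) = cls x
  lt : ∀ {x y}, cls x < cls y → κ x < κ y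
  eq : ∀ {x y}, cls x = cls y → ∃ h : H, y = h +ᵥ x

theorem wd_suffix_wd {l l₂ : ℕ} {h h₂ : H} : wd c l₂ h₂ <:+ wd c l h ↔
    l₂ ≤ l ∧ ∀ i < l₂, h₂ +ᵥ c i = h +ᵥ c (l - l₂ + i) := by
  constructor
  · intro hs
    obtain ⟨h1, h2⟩ := of_wd_suffix_pre (s := fun i => h +ᵥ c i) hs
    refine ⟨h1, fun i hi => ?_⟩
    rw [← h2 i hi, vadd_neg_vadd]
  · rintro ⟨h1, h2⟩
    have := wd_suffix_pre (c := c) (s := fun i => h +ᵥ c i) (j := l - l₂) (t := l₂) (h := -h₂)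
      fun i hi => by rw [← h2 i hi, neg_vadd_vadd]
    rwa [neg_neg, Nat.sub_add_cancel h1] at this

open Classical in
-- A letter of smaller orbit than `c l` creates something smaller. By minimality of the word, every
-- shorter translated prefix that ends the state `wd c l h` continues with a letter whose class is
-- at most that of `c l`; hence a letter of larger orbit is always allowed and extends none of these
-- prefixes, and the state becomes empty. Only the orbit of `c l` itself has to be examined letter
-- by letter.
theorem trans_eq [Fintype X] {cls : X → ℕ} (ho : OrbitOrder H κ cls) (hm : Minimal H κ c n)
    (hn : 0 < n) {Y : Set X} {l : ℕ} (hl : l < n) (h : H) (y : List X) :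
    trans H κ c n Y (wd c l h) y =
      (if y = [] then ∑ a : X, (if a ∈ Y ∧ cls (c l) < cls a then 1 else 0) else 0) +
      ∑ a : X, if (∃ r : H, a = r +ᵥ c l) ∧ a ∈ Y ∧ Step H κ c n (wd c l h) a y then 1 else 0 := by
  have hcls : ∀ {x y}, κ x ≤ κ y → cls x ≤ cls y := fun hxy => by
    by_contra! h'
    exact absurd (ho.lt h') (by omega)
  have hbig : ∀ a, cls (c l) < cls a → (Step H κ c n (wd c l h) a y ↔ y = []) := by
    intro a ha
    have key : ∀ (l₂ : ℕ) (h₂ : H), wd c l₂ h₂ <:+ wd c l h → cls (c l₂) < cls a := by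
      intro l₂ h₂ hs
      rw [wd_suffix_wd] at hs
      have := hm l hl l₂ hs.1 (-h₂ + h) fun i hi => by
        rw [add_vadd, ← hs.2 i hi, neg_vadd_vadd]
      have := hcls this
      rw [ho.vadd] at this
      omega
    have hst : IsState H c n (wd c l h ++ [a]) [] := by
      refine ⟨inS_nil hn, by simp, ?_⟩
      rintro z ⟨l₂, hl₂, h₂, rfl⟩ hs
      cases l₂ with
      | zero => simp
      | succ l₂ =>
        rw [wd_suffix_snoc] at hs
        have := key l₂ h₂ hs.2
        rw [← hs.1, ho.vadd] at this
        omega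
    constructor
    · exact fun hs => hs.2.unique hst
    · rintro rfl
      refine ⟨fun l₂ _ h₂ hs => ?_, hst⟩
      have := key l₂ h₂ hs
      rw [← ho.vadd (-h₂) a] at this
      have := ho.lt this
      omega
  have hsmall : ∀ a, cls a < cls (c l) → ¬ Step H κ c n (wd c l h) a y := by
    intro a ha hs
    have h1 := hs.1 l hl h (List.suffix_refl _)
    have h2 : κ (-h +ᵥ a) < κ (c l) := ho.lt (by rwa [ho.vadd])
    split_ifs at h1 <;> omega
  have horb : ∀ a, (∃ r : H, a = r +ᵥ c l) ↔ cls (c l) = cls a := fun a =>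
    ⟨by rintro ⟨r, rfl⟩; rw [ho.vadd], fun h => ho.eq h⟩
  unfold trans
  have e : (if y = [] then ∑ a : X, (if a ∈ Y ∧ cls (c l) < cls a then 1 else 0) else 0) =
      ∑ a : X, if y = [] then (if a ∈ Y ∧ cls (c l) < cls a then 1 else 0) else 0 := by
    split_ifs <;> simp
  rw [e, ← Finset.sum_add_distrib]
  refine Finset.sum_congr rfl fun a _ => ?_
  simp only [horb]
  rcases lt_trichotomy (cls (c l)) (cls a) with h1 | h1 | h1
  · simp only [hbig a h1, h1, h1.ne]
    by_cases h2 : y = [] <;> by_cases h3 : a ∈ Y <;> simp [h2, h3]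
  · simp [h1]
  · simp only [hsmall a h1, h1.ne', h1.not_gt]
    simp

end

/-! ### Periodic sequences fixed by a shift combined with a translation -/

section Fixed

variable {H : Type*} {X : Type*} [AddCommGroup H] [AddAction H X]

/-- The periodic sequence that repeats a word. -/
def ext {X : Type*} {n : ℕ} (hn : 0 < n) (u : Fin n → X) (i : ℕ) : X := u ⟨i % n, Nat.mod_lt _ hn⟩

theorem ext_mod {n : ℕ} (hn : 0 < n) (u : Fin n → X) {i j : ℕ} (h : i % n = j % n) :
    ext hn u i = ext hn u j := by
  simp [ext, h]

open Classical in
/-- Words with a twisted period `m` correspond to their prefixes of length `m`. -/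
theorem sum_twisted [Fintype X] {n m r : ℕ} (hn : 0 < n) (hm : 0 < m) (hr : n = m * r) {g f : H}
    (hf : ∀ x : X, g +ᵥ x = x → r • f +ᵥ x = x) (Q : (ℕ → X) → Prop) :
    (∑ u : Fin n → X, if ((∀ i, g +ᵥ ext hn u i = ext hn u i) ∧
      ∀ i, ext hn u (i + m) = f +ᵥ ext hn u i) ∧ Q (ext hn u) then 1 else 0) =
    ∑ v : Fin m → X, if (∀ i, v i ∈ {x : X | g +ᵥ x = x}) ∧ Q (twist f hm v) then 1 else 0 := by
  rw [← Finset.card_filter, ← Finset.card_filter]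
  have hle : m ≤ n := by
    rw [hr]; exact Nat.le_mul_of_pos_right _ (Nat.pos_of_ne_zero fun h => by simp [h] at hr; omega)
  have h1 : ∀ u : Fin n → X, (∀ i, ext hn u (i + m) = f +ᵥ ext hn u i) →
      twist f hm (fun k : Fin m => u ⟨k, k.2.trans_le hle⟩) = ext hn u := by
    intro u hu
    have : ∀ k i, ext hn u (k * m + i) = k • f +ᵥ ext hn u i := by
      intro k i
      induction k with
      | zero => simp
      | succ k ih =>
        rw [show (k + 1) * m + i = k * m + i + m by ring, hu, ih, add_nsmul, one_nsmul,
          add_comm (k • f), add_vadd]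
    ext i
    have e := this (i / m) (i % m)
    rw [mul_comm, Nat.div_add_mod] at e
    rw [e]
    unfold twist ext
    simp only [Nat.mod_eq_of_lt ((Nat.mod_lt i hm).trans_le hle)]
  -- A sequence twisted by `f` every `m` letters is twisted by `r • f` after `n = m * r` letters. By
  -- `hf` this is trivial on letters fixed by `g`, so `n` is a true period.
  have h2 : ∀ v : Fin m → X, (∀ i, g +ᵥ v i = v i) →
      ext hn (fun k : Fin n => twist f hm v k) = twist f hm v := by
    intro v hv
    have hper : ∀ i, twist f hm v (i + n) = twist f hm v i := by
      intro i
      rw [add_comm, hr, mul_comm m r, twist_add]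
      apply hf
      unfold twist
      rw [vadd_comm, hv]
    ext i
    have hk : ∀ k, twist f hm v (i % n + k * n) = twist f hm v (i % n) := by
      intro k
      induction k with
      | zero => simp
      | succ k ih => rw [Nat.succ_mul, ← add_assoc, hper, ih]
    have := hk (i / n)
    rw [mul_comm, Nat.mod_add_div] at this
    rw [this]
    rfl
  refine Finset.card_nbij' (fun u k => u ⟨k, k.2.trans_le hle⟩) (fun v k => twist f hm v k)
    ?_ ?_ ?_ ?_
  · intro u hu
    simp only [Finset.coe_filter, Finset.mem_univ, true_and, Set.mem_ofPred_eq] at hu ⊢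
    refine ⟨fun i => ?_, by rw [h1 u hu.1.2]; exact hu.2⟩
    have := hu.1.1 i
    unfold ext at this
    simpa only [Nat.mod_eq_of_lt (i.2.trans_le hle)] using this
  · intro v hv
    simp only [Finset.coe_filter, Finset.mem_univ, true_and, Set.mem_ofPred_eq] at hv ⊢
    rw [h2 v hv.1]
    refine ⟨⟨fun i => ?_, fun i => ?_⟩, hv.2⟩
    · unfold twist
      rw [vadd_comm, hv.1]
    · have := twist_add (f := f) hm v i 1
      rwa [one_mul, one_nsmul, add_comm] at this
  · intro u hu
    simp only [Finset.coe_filter, Finset.mem_univ, true_and, Set.mem_ofPred_eq] at hu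
    ext k
    simp only
    rw [h1 u hu.1.2]
    simp [ext, Nat.mod_eq_of_lt k.2]
  · intro v _
    ext k
    exact twist_lt hm v k.2

/-- The data that describe the multiples of `j` modulo `n`: `r` is the order of `j`. -/
structure FixData (n j r m a : ℕ) : Prop where
  rpos : 0 < r
  mul : n = m * r
  dvd : n ∣ r * j
  least : ∀ s, 0 < s → n ∣ s * j → r ≤ s
  bez : a * j % n = m % n

/-- By minimality `r` divides `n`, say `n = m * r`; then `m` divides `j`, the quotient `y` is
coprime to `r`, and an inverse of `y` modulo `r` serves as `a`. -/
theorem fixData_exists {n j r : ℕ} (hn : 0 < n) (hr : 0 < r) (hd : n ∣ r * j)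
    (hl : ∀ s, 0 < s → n ∣ s * j → r ≤ s) :
    n = n / r * r ∧ ∃ a < n, a * j % n = n / r % n := by
  have hrn : r ∣ n := by
    rw [Nat.dvd_iff_mod_eq_zero]
    by_contra h
    have h1 : n ∣ n % r * j := by
      have h2 : n ∣ (r * (n / r) + n % r) * j := by rw [Nat.div_add_mod]; exact dvd_mul_right _ _
      rw [add_mul] at h2
      refine (Nat.dvd_add_right ?_).mp h2
      rw [mul_right_comm]
      exact hd.mul_right _
    have := hl _ (Nat.pos_of_ne_zero h) h1
    exact absurd (Nat.mod_lt n hr) (by omega)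
  have hmul : n = n / r * r := (Nat.div_mul_cancel hrn).symm
  refine ⟨hmul, ?_⟩
  obtain ⟨m, hm⟩ : ∃ m, m = n / r := ⟨_, rfl⟩
  rw [← hm] at hmul ⊢
  have hmpos : 0 < m := Nat.pos_of_ne_zero fun h => by simp [h] at hmul; omega
  obtain ⟨y, hy⟩ : m ∣ j := by
    rw [hmul, mul_comm m r] at hd
    exact Nat.dvd_of_mul_dvd_mul_left hr hd
  -- Dividing `r` by a common factor of `y` and `r` would give a smaller multiplier that still
  -- annihilates `j`.
  have hcop : Nat.Coprime y r := by
    have he : 0 < Nat.gcd y r := Nat.gcd_pos_of_pos_right _ hr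
    obtain ⟨y', hy'⟩ := Nat.gcd_dvd_left y r
    obtain ⟨r', hr'⟩ := Nat.gcd_dvd_right y r
    have hr'0 : 0 < r' := Nat.pos_of_ne_zero fun h => by rw [h] at hr'; omega
    have := hl r' hr'0 ⟨y', by rw [hmul, hy]; nth_rw 1 [hy']; nth_rw 2 [hr']; ring⟩
    by_contra hne
    have : 2 ≤ Nat.gcd y r := by
      have : Nat.gcd y r ≠ 1 := hne
      omega
    nlinarith
  obtain ⟨a, ha⟩ : ∃ a, a * y ≡ 1 [MOD r] := by
    rcases Nat.lt_or_ge 1 r with h1 | h1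
    · obtain ⟨a, ha⟩ := Nat.exists_mul_mod_eq_one_of_coprime hcop h1
      exact ⟨a, by rw [mul_comm]; unfold Nat.ModEq; rw [ha.2, Nat.mod_eq_of_lt h1]⟩
    · obtain rfl : r = 1 := by omega
      exact ⟨0, Nat.modEq_one⟩
  refine ⟨a % n, Nat.mod_lt _ hn, ?_⟩
  have h1 : m * (a * y) ≡ m * 1 [MOD m * r] := ha.mul_left' m
  rw [← hmul] at h1
  have h2 : a % n * j ≡ a * j [MOD n] := (Nat.mod_modEq a n).mul_right j
  refine h2.trans ?_
  rw [hy]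
  convert h1 using 1 <;> ring

/-- Iterating the relation `r` times returns to the same index modulo `n`, and `a` times advances by
`m`. Conversely `j = m * y`, so a shift by `j` acts as `-(y * a) • g`; combined with `g` this is a
multiple of `r • g`, which acts trivially. -/
theorem fixed_iff {n j r m a : ℕ} {g : H} (hd : FixData n j r m a) {s : ℕ → X}
    (hs : ∀ i i', i % n = i' % n → s i = s i') :
    (∀ i, g +ᵥ s (i + j) = s i) ↔
      (∀ i, r • g +ᵥ s i = s i) ∧ ∀ i, s (i + m) = -(a • g) +ᵥ s i := by
  constructor
  · intro h
    have hk : ∀ k i, k • g +ᵥ s (i + k * j) = s i := by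
      intro k
      induction k with
      | zero => simp
      | succ k ih =>
        intro i
        rw [Nat.succ_mul, ← add_assoc, add_nsmul, one_nsmul, add_vadd, h, ih]
    refine ⟨fun i => ?_, fun i => ?_⟩
    · have := hk r i
      rwa [hs (i + r * j) i] at this
      obtain ⟨t, ht⟩ := hd.dvd
      simp [ht]
    · rw [← hk a i, neg_vadd_vadd]
      exact hs _ _ (Nat.ModEq.add_left i hd.bez).symm
  · rintro ⟨h1, h2⟩ i
    obtain ⟨y, hy⟩ : m ∣ j := by
      have := hd.dvd
      rw [hd.mul, mul_comm m r] at this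
      exact Nat.dvd_of_mul_dvd_mul_left hd.rpos this
    have h3 : ∀ k i, s (i + m * k) = -((k * a : ℕ) • g) +ᵥ s i := by
      intro k
      induction k with
      | zero => simp
      | succ k ih =>
        intro i
        rw [Nat.mul_succ, ← add_assoc, h2, ih, ← add_vadd]
        congr 1
        rw [Nat.succ_mul, add_nsmul]
        abel
    have h4 : ∀ k : ℤ, (k * r) • g +ᵥ s i = s i := by
      intro k
      have : ∀ k : ℕ, (k * r) • g +ᵥ s i = s i := by
        intro k
        induction k with
        | zero => simp
        | succ k ih => rw [Nat.succ_mul, add_nsmul, add_vadd, h1, ih]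
      obtain ⟨k, rfl | rfl⟩ := k.eq_nat_or_neg
      · have := this k
        exact_mod_cast this
      · have := this k
        rw [neg_mul, neg_smul, neg_vadd_eq_iff]
        symm
        exact_mod_cast this
    -- `(1 - y * a) * j` is divisible by `n`, because `a * j` is congruent to `m` and `y * m = j`.
    -- So is the product of `j` with the remainder of `1 - y * a` modulo `r`, and minimality of `r`
    -- makes that remainder `0`.
    have h5 : (r : ℤ) ∣ 1 - y * a := by
      rw [Int.dvd_iff_emod_eq_zero]
      by_contra hne
      have hr0 : (0 : ℤ) < r := by exact_mod_cast hd.rpos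
      have e1 := Int.emod_nonneg (1 - (y : ℤ) * a) hr0.ne'
      have e2 := Int.emod_lt_of_pos (1 - (y : ℤ) * a) hr0
      obtain ⟨t, ht⟩ := Int.eq_ofNat_of_zero_le e1
      have h6 : (n : ℤ) ∣ (1 - y * a) * j := by
        have h7 : a * j ≡ m [MOD n] := hd.bez
        have h8 := (h7.mul_left y)
        rw [mul_comm y m, ← hy] at h8
        have h9 := (Nat.modEq_iff_dvd.mp h8)
        push_cast at h9
        convert h9 using 1
        ring
      have h7 : (n : ℤ) ∣ (r : ℤ) * j := by exact_mod_cast hd.dvd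
      have h8 : (n : ℤ) ∣ (t : ℤ) * j := by
        rw [← ht, Int.emod_def, sub_mul]
        refine dvd_sub h6 ?_
        rw [mul_right_comm]
        exact h7.mul_right _
      have := hd.least t (by omega) (by exact_mod_cast h8)
      omega
    obtain ⟨k, hk⟩ := h5
    rw [hy, h3, ← add_vadd]
    have e : g + -((y * a : ℕ) • g) = (k * r) • g := by
      rw [mul_comm k, ← hk, sub_smul, one_smul, ← sub_eq_add_neg]
      congr 1
      exact_mod_cast (natCast_zsmul g (y * a)).symm
    rw [e, h4]

end Fixed

end Auto

/-! ### Numbers that represent words -/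

section Orbit

variable {H X : Type*} [AddCommGroup H] [Fintype H] [AddAction H X] (ι : H → ℕ) (code : X → ℕ)

/-- The smallest code in the orbit of `x`. -/
noncomputable def clsOf (H : Type*) {X : Type*} [AddCommGroup H] [Fintype H] [AddAction H X]
    (code : X → ℕ) (x : X) : ℕ :=
  Finset.univ.inf' ⟨(0 : H), Finset.mem_univ _⟩ fun h : H => code (h +ᵥ x)

/-- The smallest index of an element that takes `x` to the element of its orbit with the
smallest code. -/
noncomputable def shiftOf (x : X) : ℕ :=
  sInf {m | ∃ h : H, code (h +ᵥ x) = clsOf H code x ∧ ι h = m}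

/-- A code for `x` that compares first orbits, then shifts. -/
noncomputable def kapOf (M : ℕ) (x : X) : ℕ := clsOf H code x * M + shiftOf ι code x

variable {ι code}

theorem clsOf_le (h : H) (x : X) : clsOf H code x ≤ code (h +ᵥ x) :=
  Finset.inf'_le (fun h : H => code (h +ᵥ x)) (Finset.mem_univ h)

theorem exists_clsOf (x : X) : ∃ h : H, code (h +ᵥ x) = clsOf H code x := by
  obtain ⟨h, -, hh⟩ := Finset.exists_mem_eq_inf' (s := (Finset.univ : Finset H))
    ⟨(0 : H), Finset.mem_univ _⟩ fun h : H => code (h +ᵥ x)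
  exact ⟨h, hh.symm⟩

theorem clsOf_vadd (h : H) (x : X) : clsOf H code (h +ᵥ x) = clsOf H code x := by
  apply le_antisymm
  · obtain ⟨g, hg⟩ := exists_clsOf (H := H) (code := code) x
    rw [← hg]
    have := clsOf_le (code := code) (g - h) (h +ᵥ x)
    rwa [← add_vadd, sub_add_cancel] at this
  · obtain ⟨g, hg⟩ := exists_clsOf (H := H) (code := code) (h +ᵥ x)
    rw [← hg, ← add_vadd]
    exact clsOf_le _ _

theorem exists_of_clsOf_eq (hc : Function.Injective code) {x y : X}
    (h : clsOf H code x = clsOf H code y) : ∃ g : H, y = g +ᵥ x := by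
  obtain ⟨g, hg⟩ := exists_clsOf (H := H) (code := code) x
  obtain ⟨g', hg'⟩ := exists_clsOf (H := H) (code := code) y
  have := hc (hg.trans (h.trans hg'.symm))
  exact ⟨-g' + g, by rw [add_vadd, this, neg_vadd_vadd]⟩

theorem shiftOf_spec (ι : H → ℕ) (x : X) :
    ∃ h : H, code (h +ᵥ x) = clsOf H code x ∧ ι h = shiftOf ι code x := by
  obtain ⟨g, hg⟩ := exists_clsOf (H := H) (code := code) x
  exact Nat.sInf_mem (s := {m | ∃ h : H, code (h +ᵥ x) = clsOf H code x ∧ ι h = m}) ⟨ι g, g, hg, rfl⟩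

theorem shiftOf_le {x : X} {h : H} (hh : code (h +ᵥ x) = clsOf H code x) :
    shiftOf ι code x ≤ ι h := Nat.sInf_le ⟨h, hh, rfl⟩

theorem mul_add_lt_iff {M a b s t : ℕ} (hs : s < M) (ht : t < M) :
    a * M + s < b * M + t ↔ a < b ∨ a = b ∧ s < t := by
  rcases lt_trichotomy a b with h | h | h
  · have : (a + 1) * M ≤ b * M := Nat.mul_le_mul_right _ h
    rw [Nat.succ_mul] at this
    constructor
    · exact fun _ => Or.inl h
    · intro _; omega
  · subst h; omega
  · have : (b + 1) * M ≤ a * M := Nat.mul_le_mul_right _ h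
    rw [Nat.succ_mul] at this
    constructor
    · intro _; omega
    · rintro (h' | ⟨h', -⟩) <;> omega

variable {M : ℕ} (hM : ∀ h, ι h < M)
include hM

theorem shiftOf_lt (x : X) : shiftOf ι code x < M := by
  obtain ⟨h, -, hh⟩ := shiftOf_spec (code := code) ι x
  rw [← hh]; exact hM h

theorem kapOf_lt_iff {x y : X} : kapOf ι code M x < kapOf ι code M y ↔
    clsOf H code x < clsOf H code y ∨
      clsOf H code x = clsOf H code y ∧ shiftOf ι code x < shiftOf ι code y :=
  mul_add_lt_iff (shiftOf_lt hM x) (shiftOf_lt hM y)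

/-- Equal classes and equal shifts mean that one and the same translation takes both elements to the
element of smallest code. -/
theorem kapOf_injective (hι : Function.Injective ι) (hc : Function.Injective code) :
    Function.Injective (kapOf (X := X) ι code M) := by
  intro x y hxy
  have h1 := (kapOf_lt_iff (code := code) hM (x := x) (y := y)).not.mp (by omega)
  have h2 := (kapOf_lt_iff (code := code) hM (x := y) (y := x)).not.mp (by omega)
  have hcls : clsOf H code x = clsOf H code y := by omega
  have hs : shiftOf ι code x = shiftOf ι code y := by omega
  obtain ⟨h, e1, e2⟩ := shiftOf_spec (code := code) ι x
  obtain ⟨h', e1', e2'⟩ := shiftOf_spec (code := code) ι y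
  obtain rfl : h = h' := hι (by omega)
  exact (vadd_left_cancel_iff h).mp (hc (by omega))

theorem orbitOrder_kapOf (hι : Function.Injective ι) (hc : Function.Injective code) :
    Auto.OrbitOrder H (kapOf (X := X) ι code M) (clsOf H code) where
  inj := kapOf_injective hM hι hc
  vadd := clsOf_vadd
  lt h := (kapOf_lt_iff hM).mpr (Or.inl h)
  eq h := exists_of_clsOf_eq hc h

end Orbit

/-! ### Lexicographic order -/

/-- The number with the digits `f 0, …, f (n - 1)` in base `B`. -/
def lexCode (B n : ℕ) (f : ℕ → ℕ) : ℕ := ∑ i ∈ Finset.range n, f i * B ^ (n - 1 - i)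

theorem lexCode_succ (B n : ℕ) (f : ℕ → ℕ) : lexCode B (n + 1) f = lexCode B n f * B + f n := by
  unfold lexCode
  rw [Finset.sum_range_succ, Finset.sum_mul]
  congr 1
  · refine Finset.sum_congr rfl fun i hi => ?_
    have := Finset.mem_range.mp hi
    rw [show n + 1 - 1 - i = n - 1 - i + 1 by omega, pow_succ, mul_assoc]
  · simp

theorem lexCode_lt {B n : ℕ} {f : ℕ → ℕ} (hf : ∀ i < n, f i < B) : lexCode B n f < B ^ n := by
  induction n with
  | zero => simp [lexCode]
  | succ n ih =>
    rw [lexCode_succ, pow_succ]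
    have h1 := ih fun i hi => hf i (by omega)
    have h2 := hf n (by omega)
    nlinarith

theorem lexCode_lt_iff {B n : ℕ} {f g : ℕ → ℕ} (hf : ∀ i < n, f i < B) (hg : ∀ i < n, g i < B) :
    lexCode B n f < lexCode B n g ↔ ∃ k < n, (∀ j < k, f j = g j) ∧ f k < g k := by
  -- The criterion for equality is carried along because the step for the last digit needs it.
  have : (lexCode B n f < lexCode B n g ↔ ∃ k < n, (∀ j < k, f j = g j) ∧ f k < g k) ∧
      (lexCode B n f = lexCode B n g ↔ ∀ j < n, f j = g j) := by
    induction n with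
    | zero => simp [lexCode]
    | succ n ih =>
      obtain ⟨h1, h2⟩ := ih (fun i hi => hf i (by omega)) fun i hi => hg i (by omega)
      have h3 := mul_add_lt_iff (a := lexCode B n f) (b := lexCode B n g) (hf n (by omega))
        (hg n (by omega))
      have h4 := mul_add_lt_iff (a := lexCode B n g) (b := lexCode B n f) (hg n (by omega))
        (hf n (by omega))
      rw [lexCode_succ, lexCode_succ]
      constructor
      · rw [h3, h1, h2]
        constructor
        · rintro (⟨k, hk, h⟩ | ⟨h, h'⟩)
          · exact ⟨k, by omega, h⟩
          · exact ⟨n, by omega, h, h'⟩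
        · rintro ⟨k, hk, h⟩
          rcases Nat.lt_succ_iff_lt_or_eq.mp hk with hk | rfl
          · exact Or.inl ⟨k, hk, h⟩
          · exact Or.inr h
      · have h5 : lexCode B n f * B + f n = lexCode B n g * B + g n ↔
            lexCode B n f = lexCode B n g ∧ f n = g n := by omega
        rw [h5, h2]
        constructor
        · rintro ⟨h, h'⟩ j hj
          rcases Nat.lt_succ_iff_lt_or_eq.mp hj with hj | rfl
          · exact h j hj
          · exact h'
        · exact fun h => ⟨fun j hj => h j (by omega), h n (by omega)⟩
  exact this.1

/-! ### Words -/

section Words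

variable {q : ℕ}

/-- The translations act on the words. -/
instance wordAction {d : ℕ} (n : Fin d → ℕ) [∀ i, NeZero (n i)] : AddAction (Pos n) (Word q n) where
  vadd := translate
  zero_vadd w := by funext p; change w _ = w _; congr 1; funext i; simp
  add_vadd g h w := by
    funext p; change w _ = w _; congr 1; funext i
    simp [add_assoc]

theorem vadd_eq_translate {d : ℕ} {n : Fin d → ℕ} [∀ i, NeZero (n i)] (g : Pos n) (w : Word q n) :
    g +ᵥ w = translate g w := rfl

/-- The sizes in all dimensions but the last. -/
abbrev low {d : ℕ} (n : Fin (d + 1) → ℕ) : Fin d → ℕ := fun i => n i.castSucc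

/-- A strict upper bound for the codes of words. -/
def bnd (q : ℕ) : {d : ℕ} → (Fin d → ℕ) → ℕ
  | 0, _ => q + 1
  | d + 1, n => (bnd q (low n) * ∏ i, low n i) ^ n (Fin.last d)

theorem last_pos {d : ℕ} (n : Fin (d + 1) → ℕ) [∀ i, NeZero (n i)] : 0 < n (Fin.last d) :=
  Nat.pos_of_ne_zero (NeZero.ne _)

/-- The code of a word. -/
noncomputable def code : {d : ℕ} → (n : Fin d → ℕ) → [∀ i, NeZero (n i)] → Word q n → ℕ
  | 0, _, _, u => u (fun i => i.elim0) + 1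
  | d + 1, n, _, u => lexCode (bnd q (low n) * ∏ i, low n i) (n (Fin.last d)) fun i =>
      kapOf (index (n := low n)) (code (low n)) (∏ i, low n i) (Auto.ext (last_pos n) (slice u) i)

/-- The code of the orbit of a word. -/
noncomputable abbrev cls {d : ℕ} (n : Fin d → ℕ) [∀ i, NeZero (n i)] (u : Word q n) : ℕ :=
  clsOf (Pos n) (code n) u

/-- The code of a word as a slice. -/
noncomputable abbrev kap {d : ℕ} (n : Fin d → ℕ) [∀ i, NeZero (n i)] (u : Word q n) : ℕ :=
  kapOf (index (n := n)) (code n) (∏ i, n i) u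

theorem index_lt {d : ℕ} {n : Fin d → ℕ} (g : Pos n) : index g < ∏ i, n i := by
  rw [index_eq_finPiFinEquiv]; exact (finPiFinEquiv g).2

theorem index_injective {d : ℕ} {n : Fin d → ℕ} : Function.Injective (index (n := n)) := by
  intro g h e
  rw [index_eq_finPiFinEquiv, index_eq_finPiFinEquiv] at e
  exact finPiFinEquiv.injective (Fin.ext e)

theorem index_succ {d : ℕ} {n : Fin (d + 1) → ℕ} (g : Pos n) :
    index g = index (n := low n) (fun i => g i.castSucc) + g (Fin.last d) * ∏ i, low n i := by
  unfold index
  rw [Fin.sum_univ_castSucc]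
  congr 1
  · refine Finset.sum_congr rfl fun i _ => ?_
    congr 1
    rw [Fin.Iio_castSucc, Finset.prod_map]
    rfl
  · congr 1
    rw [Fin.Iio_last_eq_map, Finset.prod_map]
    rfl

theorem slice_translate {d : ℕ} {n : Fin (d + 1) → ℕ} (g : Pos n) (u : Word q n)
    (k : Fin (n (Fin.last d))) : slice (translate g u) k =
      translate (n := low n) (fun i => g i.castSucc) (slice u (k + g (Fin.last d))) := by
  funext p
  unfold slice translate
  congr 1
  funext i
  refine Fin.lastCases ?_ (fun i => ?_) i
  · simp
  · simp

theorem slice_injective {d : ℕ} {n : Fin (d + 1) → ℕ} :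
    Function.Injective (slice (q := q) (n := n)) := by
  intro u v h
  funext p
  have := congrFun (congrFun h (p (Fin.last d))) (fun i => p i.castSucc)
  unfold slice at this
  have e : Fin.snoc (α := fun i => Fin (n i)) (fun i => p i.castSucc) (p (Fin.last d)) = p :=
    Fin.snoc_init_self p
  rwa [e] at this

theorem isCanonicalFor_iff {d : ℕ} {n : Fin d → ℕ} [∀ i, NeZero (n i)]
    (hc : Function.Injective (code (q := q) n))
    (hlt : ∀ u v : Word q n, wordLT n u v ↔ code n u < code n v) (u c : Word q n) :
    IsCanonicalFor (wordLT n) u c ↔ TransEquiv u c ∧ code n c = cls n u := by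
  unfold IsCanonicalFor
  refine and_congr_right fun ⟨g, hg⟩ => ?_
  constructor
  · intro h
    obtain ⟨k, hk⟩ := exists_clsOf (H := Pos n) (code := code n) u
    by_cases e : k +ᵥ u = c
    · rw [← e, hk]
    · have h1 := (hlt _ _).mp (h (k +ᵥ u) ⟨k, rfl⟩ e)
      have h2 := clsOf_le (code := code n) g u
      rw [vadd_eq_translate, hg] at h2
      omega
  · rintro h v ⟨k, rfl⟩ hne
    rw [hlt, h]
    refine lt_of_le_of_ne (clsOf_le k u) fun e => hne (hc ?_)
    rw [h, e]

theorem minIndex_eq {d : ℕ} {n : Fin d → ℕ} [∀ i, NeZero (n i)]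
    (hc : Function.Injective (code (q := q) n)) {u c : Word q n} (h : code n c = cls n u) :
    minIndex u c = shiftOf (index (n := n)) (code n) u := by
  unfold minIndex shiftOf
  congr 1
  ext m
  refine exists_congr fun g => and_congr_left fun _ => ?_
  rw [← vadd_eq_translate]
  constructor
  · rintro rfl; exact h
  · exact fun e => hc (e.trans h.symm)

/-- The three claims need each other in the induction on the dimension. The bound makes the weights
`kap` of the slices valid digits; injectivity identifies slices with equal digits; and the order of
the lower dimension turns the canonical words and shifts in `wordLT` into `clsOf` and `shiftOf`. -/
theorem code_spec {d : ℕ} (n : Fin d → ℕ) [∀ i, NeZero (n i)] :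
    Function.Injective (code (q := q) n) ∧ (∀ u : Word q n, code n u < bnd q n) ∧
      ∀ u v : Word q n, wordLT n u v ↔ code n u < code n v := by
  induction d with
  | zero =>
    have e : ∀ p : Pos n, p = fun i => i.elim0 := fun p => funext fun i => i.elim0
    refine ⟨fun u v h => ?_, fun u => ?_, fun u v => ?_⟩
    · funext p
      rw [e p]
      simp only [code] at h
      exact Fin.ext (by omega)
    · simp only [code, bnd]
      have := (u fun i => i.elim0).2
      omega
    · simp only [code, wordLT]
      rw [Fin.lt_def]
      omega
  | succ d ih =>
    obtain ⟨h1, h2, h3⟩ := ih (low n)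
    have hk : ∀ x : Word q (low n), kap (low n) x < bnd q (low n) * ∏ i, low n i := by
      intro x
      obtain ⟨g, hg⟩ := exists_clsOf (H := Pos (low n)) (code := code (low n)) x
      have a1 := shiftOf_lt (index_lt (n := low n)) (code := code (low n)) x
      have a2 := h2 (g +ᵥ x)
      rw [hg] at a2
      have : (clsOf (Pos (low n)) (code (low n)) x + 1) * (∏ i, low n i) ≤
        bnd q (low n) * ∏ i, low n i := Nat.mul_le_mul_right _ a2
      unfold kap kapOf
      rw [Nat.succ_mul] at this
      omega
    have hki := kapOf_injective (index_lt (n := low n)) index_injective h1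
    have hext : ∀ (u : Word q n) (k : Fin (n (Fin.last d))),
        Auto.ext (last_pos n) (slice u) k = slice u k := by
      intro u k
      unfold Auto.ext
      congr 1
      exact Fin.ext (Nat.mod_eq_of_lt k.2)
    have hlt : ∀ u v : Word q n, code n u < code n v ↔ ∃ k : Fin (n (Fin.last d)),
        (∀ j < k, slice u j = slice v j) ∧ kap (low n) (slice u k) < kap (low n) (slice v k) := by
      intro u v
      simp only [code]
      rw [lexCode_lt_iff (fun i _ => hk _) (fun i _ => hk _)]
      constructor
      · rintro ⟨k, hk, e, l⟩
        refine ⟨⟨k, hk⟩, fun j hj => ?_, ?_⟩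
        · have := hki (e j hj)
          rwa [hext, hext] at this
        · rwa [← hext, ← hext]
      · rintro ⟨k, e, l⟩
        refine ⟨k, k.2, fun j hj => ?_, ?_⟩
        · have a1 := hext u ⟨j, hj.trans k.2⟩
          have a2 := hext v ⟨j, hj.trans k.2⟩
          simp only at a1 a2
          rw [a1, a2, e ⟨j, hj.trans k.2⟩ (Fin.lt_def.mpr hj)]
        · rwa [hext, hext]
    refine ⟨fun u v h => ?_, fun u => ?_, fun u v => ?_⟩
    · have a1 := (hlt u v).not.mp (by omega)
      have a2 := (hlt v u).not.mp (by omega)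
      apply slice_injective
      funext k
      -- At a slice before which all slices agree, neither weight is smaller than the other, so the
      -- slices agree there too.
      push Not at a1 a2
      induction k using WellFoundedLT.induction with
      | ind k ih' =>
        have b1 := a1 k ih'
        have b2 := a2 k fun j hj => (ih' j hj).symm
        exact hki (le_antisymm b2 b1)
    · exact lexCode_lt fun i _ => hk _
    · rw [hlt]
      simp only [wordLT]
      refine exists_congr fun k => and_congr_right fun _ => ?_
      rw [kapOf_lt_iff index_lt]
      simp only [isCanonicalFor_iff h1 h3]
      constructor
      · rintro ⟨-, a, b, ⟨-, ha⟩, ⟨-, hb⟩, h⟩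
        rw [h3, ha, hb, minIndex_eq h1 ha, minIndex_eq h1 hb] at h
        refine h.imp_right fun ⟨e, h⟩ => ⟨?_, h⟩
        change cls _ _ = cls _ _
        rw [← ha, ← hb, e]
      · intro h
        obtain ⟨g, hg⟩ := exists_clsOf (H := Pos (low n)) (code := code (low n)) (slice u k)
        obtain ⟨g', hg'⟩ := exists_clsOf (H := Pos (low n)) (code := code (low n)) (slice v k)
        refine ⟨fun e => ?_, g +ᵥ slice u k, g' +ᵥ slice v k, ⟨⟨g, rfl⟩, hg⟩, ⟨⟨g', rfl⟩, hg'⟩, ?_⟩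
        · rw [e] at h; omega
        · rw [h3, minIndex_eq h1 hg, minIndex_eq h1 hg', hg, hg']
          exact h.imp_right fun ⟨e, h⟩ => ⟨h1 (hg.trans (e.trans hg'.symm)), h⟩

theorem code_injective {d : ℕ} (n : Fin d → ℕ) [∀ i, NeZero (n i)] :
    Function.Injective (code (q := q) n) := (code_spec n).1

theorem code_lt {d : ℕ} (n : Fin d → ℕ) [∀ i, NeZero (n i)] (u : Word q n) :
    code n u < bnd q n := (code_spec n).2.1 u

theorem wordLT_iff {d : ℕ} {n : Fin d → ℕ} [∀ i, NeZero (n i)] {u v : Word q n} :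
    wordLT n u v ↔ code n u < code n v := (code_spec n).2.2 u v

theorem kap_lt {d : ℕ} (n : Fin d → ℕ) [∀ i, NeZero (n i)] (x : Word q n) :
    kap n x < bnd q n * ∏ i, n i := by
  obtain ⟨g, hg⟩ := exists_clsOf (H := Pos n) (code := code n) x
  have a1 := shiftOf_lt (index_lt (n := n)) (code := code n) x
  have a2 := code_lt n (g +ᵥ x)
  rw [hg] at a2
  have : (clsOf (Pos n) (code n) x + 1) * (∏ i, n i) ≤ bnd q n * ∏ i, n i :=
    Nat.mul_le_mul_right _ a2
  unfold kap kapOf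
  rw [Nat.succ_mul] at this
  omega

theorem orbitOrder_kap {d : ℕ} (n : Fin d → ℕ) [∀ i, NeZero (n i)] :
    Auto.OrbitOrder (Pos n) (kap (q := q) n) (cls n) :=
  orbitOrder_kapOf index_lt index_injective (code_injective n)

end Words

/-! ### Counting fixed words slice by slice -/

section Count

variable {q : ℕ}

open Classical in
/-- The number of words that are fixed by `g`. -/
noncomputable def fixCount (q : ℕ) {d : ℕ} (n : Fin d → ℕ) [∀ i, NeZero (n i)] (g : Pos n) : ℕ :=
  ∑ u : Word q n, if g +ᵥ u = u then 1 else 0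

open Classical in
/-- The number of words that are fixed by `g` and have a larger orbit than `w`. -/
noncomputable def bigCount {d : ℕ} (n : Fin d → ℕ) [∀ i, NeZero (n i)] (g : Pos n)
    (w : Word q n) : ℕ :=
  ∑ u : Word q n, if g +ᵥ u = u ∧ cls n w < cls n u then 1 else 0

theorem bigCount_vadd {d : ℕ} {n : Fin d → ℕ} [∀ i, NeZero (n i)] (g k : Pos n) (w : Word q n) :
    bigCount n g (k +ᵥ w) = bigCount n g w := by
  unfold bigCount cls
  rw [clsOf_vadd]

theorem card_word {d : ℕ} (n : Fin d → ℕ) : Fintype.card (Word q n) = q ^ ∏ i, n i := by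
  simp [Word, Pos]

theorem prod_low {d : ℕ} {n : Fin (d + 1) → ℕ} : ∏ i, n i = n (Fin.last d) * ∏ i, low n i := by
  rw [Fin.prod_univ_castSucc, mul_comm]

theorem slice_bijective {d : ℕ} {n : Fin (d + 1) → ℕ} : Function.Bijective (slice (q := q) (n := n)) := by
  refine ⟨slice_injective, fun F => ⟨fun p => F (p (Fin.last d)) (fun i => p i.castSucc), ?_⟩⟩
  funext k p
  simp only [slice, Fin.snoc_last, Fin.snoc_castSucc]

theorem fixCount_le {d : ℕ} (n : Fin d → ℕ) [∀ i, NeZero (n i)] (g : Pos n) :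
    fixCount q n g ≤ q ^ ∏ i, n i := by
  rw [← card_word, Fintype.card_eq_sum_ones]
  exact Finset.sum_le_sum fun u _ => by split_ifs <;> omega

theorem bigCount_le {d : ℕ} (n : Fin d → ℕ) [∀ i, NeZero (n i)] (g : Pos n) (w : Word q n) :
    bigCount n g w ≤ q ^ ∏ i, n i := by
  rw [← card_word, Fintype.card_eq_sum_ones]
  exact Finset.sum_le_sum fun u _ => by split_ifs <;> omega

variable {d : ℕ} {n : Fin (d + 1) → ℕ} [∀ i, NeZero (n i)]

/-- The sequence of the slices of a word. -/
def slices (u : Word q n) : ℕ → Word q (low n) := Auto.ext (last_pos n) (slice u)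

/-- All coordinates of a translation but the last. -/
abbrev lowPos (g : Pos n) : Pos (low n) := fun i => g i.castSucc

theorem slices_vadd (g : Pos n) (u : Word q n) (i : ℕ) :
    slices (g +ᵥ u) i = lowPos g +ᵥ slices u (i + g (Fin.last d)) := by
  unfold slices Auto.ext
  rw [vadd_eq_translate, slice_translate, vadd_eq_translate]
  congr 2
  ext
  simp [Fin.val_add]

theorem slices_injective : Function.Injective (slices (q := q) (n := n)) := by
  intro u v h
  apply slice_injective
  funext k
  have := congrFun h k
  unfold slices Auto.ext at this
  simpa only [Nat.mod_eq_of_lt k.2, Fin.eta] using this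

theorem slices_mod (u : Word q n) {i j : ℕ} (h : i % n (Fin.last d) = j % n (Fin.last d)) :
    slices u i = slices u j := Auto.ext_mod _ _ h

theorem code_succ (u : Word q n) : code n u = lexCode (bnd q (low n) * ∏ i, low n i)
    (n (Fin.last d)) fun i => kap (low n) (slices u i) := rfl

theorem code_lt_code_iff {u v : Word q n} : code n u < code n v ↔ ∃ t < n (Fin.last d),
    (∀ j < t, slices u j = slices v j) ∧ kap (low n) (slices u t) < kap (low n) (slices v t) := by
  rw [code_succ, code_succ, lexCode_lt_iff (fun i _ => kap_lt _ _) fun i _ => kap_lt _ _]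
  refine exists_congr fun t => and_congr_right fun _ => and_congr_left fun _ =>
    forall_congr' fun j => forall_congr' fun _ => ?_
  exact (orbitOrder_kap (low n)).inj.eq_iff

theorem exists_pos (h : Pos (low n)) (j : ℕ) : ∃ k : Pos n, lowPos k = h ∧
    (k (Fin.last d) : ℕ) = j % n (Fin.last d) := by
  refine ⟨Fin.snoc (α := fun i => Fin (n i)) h ⟨j % n (Fin.last d), Nat.mod_lt _ (last_pos n)⟩,
    ?_, ?_⟩
  · funext i
    simp [lowPos]
  · simp

theorem slices_vadd' {k : Pos n} {h : Pos (low n)} {j : ℕ} (hk : lowPos k = h)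
    (hj : (k (Fin.last d) : ℕ) = j % n (Fin.last d)) (u : Word q n) (i : ℕ) :
    slices (k +ᵥ u) i = h +ᵥ slices u (j + i) := by
  rw [slices_vadd, hk]
  congr 1
  apply slices_mod
  rw [hj, add_comm j]
  simp

/-- If a translated suffix matched a prefix and then continued with a smaller slice, the translation
that moves this suffix to the front would produce a smaller word. -/
theorem minimal_slices {c : Word q n} (hc : ∀ k : Pos n, code n c ≤ code n (k +ᵥ c)) :
    Auto.Minimal (Pos (low n)) (kap (low n)) (slices c) (n (Fin.last d)) := by
  intro l hl l₂ hl₂ h hs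
  by_contra! hlt
  obtain ⟨k, hk, hj⟩ := exists_pos h (l - l₂)
  have := hc k
  refine absurd (code_lt_code_iff.mpr ⟨l₂, by omega, fun i hi => ?_, ?_⟩) (not_lt.mpr this)
  · rw [slices_vadd' hk hj, hs i hi]
  · rwa [slices_vadd' hk hj, Nat.sub_add_cancel hl₂]

/-- A start `j` modulo the last size and a translation `h` of the slices together are a translation
of the word, and comparing codes means looking at the first slice that differs. -/
theorem goodAll_slices {c u : Word q n} :
    Auto.GoodAll (Pos (low n)) (kap (low n)) (slices c) (n (Fin.last d)) (slices u) ↔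
      ∀ k : Pos n, code n c < code n (k +ᵥ u) := by
  constructor
  · intro h k
    obtain ⟨t, ht, h1, h2⟩ := h (k (Fin.last d)) (lowPos k)
    refine code_lt_code_iff.mpr ⟨t, ht, fun i hi => ?_, ?_⟩
    · rw [slices_vadd, add_comm i, h1 i hi]
    · rwa [slices_vadd, add_comm t]
  · intro h j g
    obtain ⟨k, hk, hj⟩ := exists_pos g j
    obtain ⟨t, ht, h1, h2⟩ := code_lt_code_iff.mp (h k)
    refine ⟨t, ht, fun i hi => ?_, ?_⟩
    · rw [h1 i hi, slices_vadd' hk hj]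
    · rwa [slices_vadd' hk hj] at h2

theorem vadd_eq_self_iff (g : Pos n) (u : Word q n) :
    g +ᵥ u = u ↔ ∀ i, lowPos g +ᵥ slices u (i + g (Fin.last d)) = slices u i := by
  rw [← slices_injective.eq_iff, funext_iff]
  exact forall_congr' fun i => by rw [slices_vadd]

/-- The twist `-(a • g)`, applied `r` times, is trivial on letters fixed by `r • g`; this is the
closing condition of `sum_twisted`. -/
theorem nsmul_vadd_of_fixed {H X : Type*} [AddCommGroup H] [AddAction H X] {g : H} {r a : ℕ}
    {x : X} (hx : r • g +ᵥ x = x) : r • -(a • g) +ᵥ x = x := by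
  have h1 : ∀ a : ℕ, a • r • g +ᵥ x = x := by
    intro a
    induction a with
    | zero => simp
    | succ a ih => rw [add_nsmul, one_nsmul, add_vadd, hx, ih]
  rw [smul_neg, neg_vadd_eq_iff, smul_comm, h1 a]

open Classical in
/-- Sums over the words fixed by `g` that satisfy a condition on their slices. -/
theorem sum_fixed {g : Pos n} {r m a : ℕ}
    (hd : Auto.FixData (n (Fin.last d)) (g (Fin.last d)) r m a) (hm : 0 < m)
    (Q : (ℕ → Word q (low n)) → Prop) :
    (∑ u : Word q n, if g +ᵥ u = u ∧ Q (slices u) then 1 else 0) =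
      ∑ v : Fin m → Word q (low n), if (∀ i, v i ∈ {x | r • lowPos g +ᵥ x = x}) ∧
        Q (Auto.twist (-(a • lowPos g)) hm v) then 1 else 0 := by
  refine Eq.trans ?_ ((Auto.sum_twisted (g := r • lowPos g) (f := -(a • lowPos g)) (last_pos n) hm
    hd.mul (fun _ => nsmul_vadd_of_fixed) Q).trans (by congr!))
  refine Fintype.sum_bijective _ slice_bijective _ _ fun u => ?_
  refine if_congr (and_congr_left fun _ => ?_) rfl rfl
  rw [vadd_eq_self_iff, Auto.fixed_iff hd fun i i' h => slices_mod u h]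
  rfl

theorem FixData_pos {n j r m a : ℕ} (hn : 0 < n) (hd : Auto.FixData n j r m a) : 0 < m :=
  Nat.pos_of_ne_zero fun h => by have := hd.mul; simp [h] at this; omega

/-- The `m` free slices are chosen independently among the words fixed by `r • lowPos g`. -/
theorem fixCount_succ {g : Pos n} {r m a : ℕ}
    (hd : Auto.FixData (n (Fin.last d)) (g (Fin.last d)) r m a) :
    fixCount q n g = fixCount q (low n) (r • lowPos g) ^ m := by
  classical
  have := sum_fixed (q := q) hd (FixData_pos (last_pos n) hd) (fun _ => True)
  simp only [and_true] at this
  unfold fixCount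
  rw [this, ← Finset.card_filter, ← Finset.card_filter]
  have e : (Finset.univ.filter fun v : Fin m → Word q (low n) =>
      ∀ i, v i ∈ {x | r • lowPos g +ᵥ x = x}) = Fintype.piFinset fun _ =>
        Finset.univ.filter fun x : Word q (low n) => r • lowPos g +ᵥ x = x := by
    ext v; simp
  rw [e, Fintype.card_piFinset_const]

/-- For the smallest word `c` of an orbit, a larger orbit is one all of whose members exceed `c`.
This is `GoodAll` for the slices, and the twisted sequences with this property are counted by walks.
-/
theorem bigCount_succ {g : Pos n} {r m a : ℕ}
    (hd : Auto.FixData (n (Fin.last d)) (g (Fin.last d)) r m a) {c : Word q n}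
    (hc : ∀ k : Pos n, code n c ≤ code n (k +ᵥ c)) :
    bigCount n g c = ∑ x ∈ Auto.states (Pos (low n)) (slices c) (n (Fin.last d)),
      Auto.walks (Pos (low n)) (kap (low n)) (slices c) (n (Fin.last d))
        {x | r • lowPos g +ᵥ x = x} m x (x.map (-(a • lowPos g) +ᵥ ·)) := by
  classical
  have hm := FixData_pos (last_pos n) hd
  rw [← Auto.sum_goodAll hm (orbitOrder_kap (low n)).inj (last_pos n)]
  refine Eq.trans ?_ ((sum_fixed hd hm fun s => Auto.GoodAll (Pos (low n)) (kap (low n)) (slices c)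
    (n (Fin.last d)) s).trans (by congr!))
  refine Finset.sum_congr rfl fun u _ => ?_
  have hcls : cls n c = code n c := by
    obtain ⟨k, hk⟩ := exists_clsOf (H := Pos n) (code := code n) c
    have h1 := hc k
    have h2 := clsOf_le (code := code n) (0 : Pos n) c
    rw [zero_vadd] at h2
    change clsOf _ _ _ = _
    omega
  have e : cls n c < cls n u ↔ ∀ k : Pos n, code n c < code n (k +ᵥ u) := by
    rw [hcls]
    constructor
    · exact fun h k => h.trans_le (clsOf_le k u)
    · intro h
      obtain ⟨k, hk⟩ := exists_clsOf (H := Pos n) (code := code n) u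
      change _ < clsOf _ _ _
      rw [← hk]; exact h k
  simp only [e, goodAll_slices]

theorem walks_le {Y : Set (Word q (low n))} {c : ℕ → Word q (low n)} {m : ℕ}
    (hm : m ≤ n (Fin.last d)) (hq : 0 < q) (x y : List (Word q (low n))) :
    Auto.walks (Pos (low n)) (kap (low n)) c (n (Fin.last d)) Y m x y ≤ q ^ ∏ i, n i := by
  classical
  have h1 : Auto.walks (Pos (low n)) (kap (low n)) c (n (Fin.last d)) Y m x y ≤
      Fintype.card (Fin m → Word q (low n)) := by
    rw [Fintype.card_eq_sum_ones]
    exact Finset.sum_le_sum fun u _ => by split_ifs <;> omega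
  refine h1.trans ?_
  rw [Fintype.card_fun, card_word, ← pow_mul, Fintype.card_fin, prod_low, mul_comm (n (Fin.last d))]
  exact Nat.pow_le_pow_right hq (Nat.mul_le_mul_left _ hm)

end Count

/-! ### Necklaces and fixed words -/

section Burnside

variable {q d : ℕ} {n : Fin d → ℕ} [∀ i, NeZero (n i)]

theorem eq_of_minimal {u v : Word q n} (hu : code n u = cls n u) (hv : code n v = cls n v)
    (h : cls n u = cls n v) : u = v :=
  code_injective n (by rw [hu, hv, h])

open Classical in
/-- The orbits with a property are counted by the words fixed by the translations. -/
theorem sum_fixed_eq (P : Word q n → Prop) (hP : ∀ (g : Pos n) (u : Word q n), P (g +ᵥ u) ↔ P u) :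
    (∑ g : Pos n, ∑ u : Word q n, if g +ᵥ u = u ∧ P u then 1 else 0) =
      (∏ i, n i) * (Finset.univ.filter fun u : Word q n => code n u = cls n u ∧ P u).card := by
  have hcard : Fintype.card (Pos n) = ∏ i, n i := by simp [Pos]
  -- `k u` is some translation that takes `u` to the smallest word of its orbit. Then `(g, u) ↦ (g -
  -- k u, k u +ᵥ u)` maps the pairs with `g +ᵥ u = u` bijectively to pairs of an arbitrary
  -- translation and a smallest word: the inverse puts `u = h +ᵥ c` and `g = h + k u`.
  choose k hk using fun u : Word q n => exists_clsOf (H := Pos n) (code := code n) u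
  have hcan : ∀ u, code n (k u +ᵥ u) = cls n (k u +ᵥ u) := fun u => by
    rw [hk]; exact (clsOf_vadd _ _).symm
  rw [← Fintype.sum_prod_type', ← Finset.card_filter, ← hcard, ← Finset.card_univ (α := Pos n),
    ← Finset.card_product]
  refine Finset.card_nbij' (fun p => (p.1 - k p.2, k p.2 +ᵥ p.2))
    (fun p => (p.1 + k (p.1 +ᵥ p.2), p.1 +ᵥ p.2)) ?_ ?_ ?_ ?_
  · rintro ⟨g, u⟩ h
    simp only [Finset.coe_filter, Finset.mem_univ, true_and, Set.mem_ofPred_eq, Finset.coe_product,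
      Finset.coe_univ, Set.mem_prod, Set.mem_univ] at h ⊢
    exact ⟨hcan u, (hP _ _).mpr h.2⟩
  · rintro ⟨h, c⟩ hc
    simp only [Finset.coe_filter, Finset.mem_univ, true_and, Set.mem_ofPred_eq, Finset.coe_product,
      Finset.coe_univ, Set.mem_prod, Set.mem_univ] at hc ⊢
    refine ⟨?_, (hP _ _).mpr hc.2⟩
    have : k (h +ᵥ c) +ᵥ (h +ᵥ c) = c := eq_of_minimal (hcan _) hc.1 (by
      rw [cls, clsOf_vadd, clsOf_vadd])
    rw [add_vadd, this]
  · rintro ⟨g, u⟩ h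
    simp only [Finset.coe_filter, Finset.mem_univ, true_and, Set.mem_ofPred_eq] at h
    have e : (g - k u) +ᵥ (k u +ᵥ u) = u := by rw [← add_vadd, sub_add_cancel, h.1]
    simp only [e, sub_add_cancel]
  · rintro ⟨h, c⟩ hc
    simp only [Finset.coe_filter, Finset.mem_univ, true_and, Set.mem_ofPred_eq, Finset.coe_product,
      Finset.coe_univ, Set.mem_prod, Set.mem_univ] at hc
    have : k (h +ᵥ c) +ᵥ (h +ᵥ c) = c := eq_of_minimal (hcan _) hc.1 (by
      rw [cls, clsOf_vadd, clsOf_vadd])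
    simp only [this, add_sub_cancel_right]

theorem isCanonical_self_iff {u : Word q n} : IsCanonical u u ↔ code n u = cls n u := by
  unfold IsCanonical
  rw [isCanonicalFor_iff (code_injective n) fun _ _ => wordLT_iff]
  exact and_iff_right ⟨0, (vadd_eq_translate _ _).symm.trans (zero_vadd (Pos n) u)⟩

theorem mk_eq_mk_iff {u v : Word q n} : Necklace.mk u = Necklace.mk v ↔ cls n u = cls n v := by
  refine (Quotient.eq (r := transSetoid q n)).trans ?_
  change TransEquiv u v ↔ _
  constructor
  · rintro ⟨g, rfl⟩
    exact (clsOf_vadd g u).symm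
  · intro h
    obtain ⟨g, hg⟩ := exists_of_clsOf_eq (H := Pos n) (code_injective n) h
    exact ⟨g, hg.symm⟩

open Classical in
theorem rank_eq_card (w : Word q n) : (Necklace.mk w).rank =
    (Finset.univ.filter fun u : Word q n => code n u = cls n u ∧ cls n u < cls n w).card := by
  unfold Necklace.rank
  have e : {y | Necklace.LT y (Necklace.mk w)} = Necklace.mk ''
      {u : Word q n | code n u = cls n u ∧ cls n u < cls n w} := by
    ext y
    simp only [Necklace.LT, isCanonical_self_iff, wordLT_iff, mk_eq_mk_iff, Set.mem_ofPred_eq,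
      Set.mem_image]
    constructor
    · rintro ⟨a, b, h1, h2, h3, h4, h5⟩
      exact ⟨a, ⟨h3, by omega⟩, h1⟩
    · rintro ⟨a, ⟨h1, h2⟩, rfl⟩
      obtain ⟨k, hk⟩ := exists_clsOf (H := Pos n) (code := code n) w
      have e : cls n (k +ᵥ w) = cls n w := clsOf_vadd _ _
      exact ⟨a, k +ᵥ w, rfl, e, h1, by rw [e, hk], by rw [hk, h1]; exact h2⟩
  rw [e, Set.InjOn.ncard_image, ← Set.ncard_coe_finset]
  · simp
  · intro u hu v hv h
    exact eq_of_minimal hu.1 hv.1 (mk_eq_mk_iff.mp h)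

/-- The rank of a necklace in terms of the words fixed by the translations. -/
theorem rank_eq (w : Word q n) : (Necklace.mk w).rank =
    (∑ g, fixCount q n g - ∑ g, bigCount n g w) / ∏ i, n i - 1 := by
  classical
  have h1 := sum_fixed_eq (fun _ : Word q n => True) fun _ _ => Iff.rfl
  have h2 := sum_fixed_eq (fun u : Word q n => cls n w < cls n u) fun g u => by
    rw [cls, cls, clsOf_vadd]
  simp only [and_true] at h1
  have hN : 0 < ∏ i, n i := Finset.prod_pos fun i _ => NeZero.pos _
  -- The smallest words of the orbits are those of smaller orbits, the one of `w` itself (the `1`),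
  -- and those of larger orbits.
  have h3 : (Finset.univ.filter fun u : Word q n => code n u = cls n u).card =
      (Finset.univ.filter fun u : Word q n => code n u = cls n u ∧ cls n u < cls n w).card + 1 +
      (Finset.univ.filter fun u : Word q n => code n u = cls n u ∧ cls n w < cls n u).card := by
    obtain ⟨k, hk⟩ := exists_clsOf (H := Pos n) (code := code n) w
    have e : cls n (k +ᵥ w) = cls n w := clsOf_vadd _ _
    rw [← Finset.card_singleton (k +ᵥ w), ← Finset.card_union_of_disjoint,
      ← Finset.card_union_of_disjoint]
    · congr 1
      ext u
      simp only [Finset.mem_filter, Finset.mem_univ, true_and, Finset.mem_union,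
        Finset.mem_singleton]
      constructor
      · intro h
        rcases lt_trichotomy (cls n u) (cls n w) with h' | h' | h'
        · exact Or.inl (Or.inl ⟨h, h'⟩)
        · exact Or.inl (Or.inr (eq_of_minimal h (hk.trans e.symm) (h'.trans e.symm)))
        · exact Or.inr ⟨h, h'⟩
      · rintro ((h | rfl) | h)
        exacts [h.1, hk.trans e.symm, h.1]
    · rw [Finset.disjoint_left]
      simp only [Finset.mem_filter, Finset.mem_univ, true_and, Finset.mem_union,
        Finset.mem_singleton]
      rintro u (h | rfl) h' <;> omega
    · rw [Finset.disjoint_left]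
      simp only [Finset.mem_filter, Finset.mem_univ, true_and, Finset.mem_singleton]
      rintro u h rfl
      omega
  have h4 : ∑ g, fixCount q n g = (∏ i, n i) *
      (Finset.univ.filter fun u : Word q n => code n u = cls n u).card := by
    rw [← h1]
    unfold fixCount
    congr!
  have h5 : ∑ g, bigCount n g w = (∏ i, n i) * (Finset.univ.filter fun u : Word q n =>
      code n u = cls n u ∧ cls n w < cls n u).card := by
    refine Eq.trans ?_ (h2.trans (by congr!))
    unfold bigCount
    congr!
  rw [h4, h5, ← Nat.mul_sub, Nat.mul_div_cancel_left _ hN, rank_eq_card, h3]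
  omega

end Burnside

/-! ### Numbered groups and tables for the automaton -/

/-- A numbering of a finite group by the numbers below `N`, with `0` for the neutral element. -/
structure Numbering {H : Type*} [AddCommGroup H] (ix : H → ℕ) (el : ℕ → H) (N : ℕ) : Prop where
  lt : ∀ h, ix h < N
  el_ix : ∀ h, el (ix h) = h
  ix_el : ∀ t < N, ix (el t) = t
  zero : ix 0 = 0

namespace Numbering

variable {H : Type*} [AddCommGroup H] {ix : H → ℕ} {el : ℕ → H} {N : ℕ}

theorem pos (hN : Numbering ix el N) : 0 < N := (Nat.zero_le _).trans_lt (hN.lt 0)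

theorem el_zero (hN : Numbering ix el N) : el 0 = 0 := by
  have := hN.el_ix 0
  rwa [hN.zero] at this

end Numbering

namespace Auto

section Tables

variable {H X : Type*} [AddCommGroup H] [AddAction H X] {κ : X → ℕ} {c : ℕ → X} {n : ℕ}
  {ix : H → ℕ} {el : ℕ → H} {N : ℕ}

/-- The state with the number `p`. -/
def st (el : ℕ → H) (N : ℕ) (c : ℕ → X) (p : ℕ) : List X := wd c (p / N) (el (p % N))

theorem length_st (p : ℕ) : (st el N c p).length = p / N := length_wd _ _

theorem div_lt_of_lt {p : ℕ} (hp : p < N * n) : p / N < n :=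
  Nat.div_lt_of_lt_mul hp

theorem mul_add_lt {l t : ℕ} (hl : l < n) (ht : t < N) : l * N + t < N * n := by
  have : (l + 1) * N ≤ n * N := Nat.mul_le_mul_right _ hl
  rw [mul_comm N]
  linarith [add_mul l 1 N]

theorem mul_add_div' {l t : ℕ} (ht : t < N) : (l * N + t) / N = l := by
  rw [add_comm, Nat.add_mul_div_right _ _ (by omega), Nat.div_eq_of_lt ht, zero_add]

theorem exists_num (hN : Numbering ix el N) {l : ℕ} (hl : l < n) (h : H) :
    ∃ p < N * n, p / N = l ∧ el (p % N) = h := by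
  have h1 := hN.lt h
  exact ⟨l * N + ix h, mul_add_lt hl h1, mul_add_div' h1,
    by rw [Nat.mul_add_mod', Nat.mod_eq_of_lt h1, hN.el_ix]⟩

theorem exists_st (hN : Numbering ix el N) {x : List X} (hx : InS H c n x) :
    ∃ p < N * n, st el N c p = x := by
  obtain ⟨l, hl, h, rfl⟩ := hx
  obtain ⟨p, hp, rfl, rfl⟩ := exists_num hN hl h
  exact ⟨p, hp, rfl⟩

theorem inS_st {p : ℕ} (hp : p < N * n) : InS H c n (st el N c p) :=
  ⟨_, div_lt_of_lt hp, _, rfl⟩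

open Classical in
theorem image_st [Fintype H] (hN : Numbering ix el N) :
    (Finset.range (N * n)).image (st el N c) = states H c n := by
  ext x
  rw [mem_states, Finset.mem_image]
  constructor
  · rintro ⟨p, hp, rfl⟩
    exact inS_st (Finset.mem_range.mp hp)
  · intro hx
    obtain ⟨p, hp, rfl⟩ := exists_st hN hx
    exact ⟨p, Finset.mem_range.mpr hp, rfl⟩

/-- The state `p'` is a suffix of the state `p`, in terms of the table `E` of the letters. -/
def SufP (E : ℕ → ℕ) (N p p' : ℕ) : Prop :=
  p' / N ≤ p / N ∧ ∀ i < p' / N, E (i * N + p' % N) = E ((p / N - p' / N + i) * N + p % N)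

/-- The state `p'` is a suffix of the state `p` followed by the letter `v`. -/
def SnocP (E : ℕ → ℕ) (N p v p' : ℕ) : Prop :=
  p' < N ∨ SufP E N p (p' - N) ∧ E (p' - N) = E v

/-- No smaller number denotes the same state. -/
def FirstP (E : ℕ → ℕ) (N p : ℕ) : Prop := ∀ y < p, ¬ (y / N = p / N ∧ SufP E N p y)

/-- The table of the letters. -/
def LetterTable (κ : X → ℕ) (c : ℕ → X) (el : ℕ → H) (N n : ℕ) (E : ℕ → ℕ) : Prop :=
  ∀ p < N * n, E p = κ (el (p % N) +ᵥ c (p / N))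

variable {E : ℕ → ℕ}

theorem LetterTable.at (hE : LetterTable κ c el N n E) {l t : ℕ} (hl : l < n) (ht : t < N) :
    E (l * N + t) = κ (el t +ᵥ c l) := by
  rw [hE _ (mul_add_lt hl ht), mul_add_div' ht, Nat.mul_add_mod', Nat.mod_eq_of_lt ht]

theorem sufP_iff (hE : LetterTable κ c el N n E) (hκ : Function.Injective κ) (h0 : 0 < N) {p p' : ℕ}
    (hp : p < N * n) : SufP E N p p' ↔ st el N c p' <:+ st el N c p := by
  unfold SufP st
  rw [wd_suffix_wd]
  refine and_congr_right fun hle => forall_congr' fun i => imp_congr_right fun hi => ?_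
  have := div_lt_of_lt hp
  rw [hE.at (by omega) (Nat.mod_lt _ h0), hE.at (by omega) (Nat.mod_lt _ h0), hκ.eq_iff]

theorem firstP_iff (hE : LetterTable κ c el N n E) (hκ : Function.Injective κ) (h0 : 0 < N) {p : ℕ}
    (hp : p < N * n) : FirstP E N p ↔ ∀ y < p, st el N c y ≠ st el N c p := by
  refine forall_congr' fun y => imp_congr_right fun hy => not_congr ?_
  rw [sufP_iff hE hκ h0 hp]
  constructor
  · rintro ⟨h1, h2⟩
    exact h2.eq_of_length (by rw [length_st, length_st, h1])
  · intro h
    have := congrArg List.length h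
    rw [length_st, length_st] at this
    exact ⟨this, h ▸ List.suffix_rfl⟩

/-- The numbers below `N` denote the empty state. Adding `N` lengthens the prefix by one letter and
keeps the translation, so the last letter of the state `y + N` is the entry `y` of the table. -/
theorem snocP_iff (hE : LetterTable κ c el N n E) (hκ : Function.Injective κ) (h0 : 0 < N)
    {p p' l t : ℕ} (hp : p < N * n) (hp' : p' < N * n) (hl : l < n) (ht : t < N) :
    SnocP E N p (l * N + t) p' ↔ st el N c p' <:+ st el N c p ++ [el t +ᵥ c l] := by
  unfold SnocP
  rcases lt_or_ge p' N with h | h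
  · have : st el N c p' = [] := by
      rw [← List.length_eq_zero_iff, length_st, Nat.div_eq_of_lt h]
    simp [h, this]
  · obtain ⟨y, rfl⟩ : ∃ y, p' = y + N := ⟨p' - N, by omega⟩
    have e : st el N c (y + N) = wd c (y / N + 1) (el (y % N)) := by
      rw [st, Nat.add_div_right _ h0, Nat.add_mod_right]
    rw [Nat.add_sub_cancel, sufP_iff hE hκ h0 hp, e, wd_suffix_snoc, hE.at hl ht,
      hE y (by omega), hκ.eq_iff, and_comm, st]
    exact or_iff_right (by omega)

/-- The letter `v` may follow the state `p`. -/
def GoodP (E : ℕ → ℕ) (S : ℕ → ℕ → ℕ) (N n l r p : ℕ) : Prop :=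
  ∀ y < N * n, SufP E N p y → E (y / N * N) <
    E (l * N + S r (y % N)) + if y / N + 1 < n then 1 else 0

/-- The state after the state `p` and the letter `v` is `p'`. -/
def LongestP (E : ℕ → ℕ) (N n p v p' : ℕ) : Prop :=
  SnocP E N p v p' ∧ ∀ y < N * n, SnocP E N p v y → y / N ≤ p' / N

/-- The table of subtraction. -/
def SubTable (ix : H → ℕ) (el : ℕ → H) (N : ℕ) (S : ℕ → ℕ → ℕ) : Prop :=
  ∀ s < N, ∀ t < N, S s t = ix (el s - el t)

variable {S : ℕ → ℕ → ℕ}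

/-- Addition from the table of subtraction alone, as `s - (0 - t)`. -/
theorem SubTable.add (hN : Numbering ix el N) (hS : SubTable ix el N S) {s t : ℕ} (hs : s < N)
    (ht : t < N) : S s (S 0 t) = ix (el s + el t) := by
  rw [hS 0 hN.pos t ht, hS s hs _ (hN.lt _), hN.el_ix, hN.el_zero]
  congr 1
  abel

/-- The entry `E (y / N * N)` belongs to the neutral element, hence is the weight of the letter
itself; `S r (y % N)` numbers the translation that remains of `r` after the translation of the
prefix has been undone. -/
theorem goodP_iff (hN : Numbering ix el N) (hS : SubTable ix el N S)
    (hE : LetterTable κ c el N n E) (hκ : Function.Injective κ) {p l r : ℕ} (hp : p < N * n)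
    (hl : l < n) (hr : r < N) :
    GoodP E S N n l r p ↔ Good H κ c n (st el N c p) (el r +ᵥ c l) := by
  have h0 := hN.pos
  have key : ∀ y < N * n, (E (y / N * N) < E (l * N + S r (y % N)) + if y / N + 1 < n then 1 else 0) ↔
      κ (c (y / N)) < κ (-el (y % N) +ᵥ (el r +ᵥ c l)) + if y / N + 1 < n then 1 else 0 := by
    intro y hy
    have h1 := hE.at (div_lt_of_lt hy) h0
    have h2 := Nat.mod_lt y h0
    rw [add_zero, hN.el_zero, zero_vadd] at h1
    rw [h1, hS _ hr _ h2, hE.at hl (hN.lt _), hN.el_ix, ← add_vadd, sub_eq_neg_add]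
  constructor
  · intro h l' hl' h' hs
    obtain ⟨y, hy, rfl, rfl⟩ := exists_num hN hl' h'
    exact (key y hy).mp (h y hy ((sufP_iff hE hκ h0 hp).mpr hs))
  · intro h y hy hs
    rw [sufP_iff hE hκ h0 hp] at hs
    exact (key y hy).mpr (h _ (div_lt_of_lt hy) _ hs)

theorem longestP_iff (hN : Numbering ix el N) (hE : LetterTable κ c el N n E)
    (hκ : Function.Injective κ) {p p' l r : ℕ} (hp : p < N * n) (hp' : p' < N * n)
    (hl : l < n) (hr : r < N) :
    LongestP E N n p (l * N + r) p' ↔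
      IsState H c n (st el N c p ++ [el r +ᵥ c l]) (st el N c p') := by
  have h0 := hN.pos
  unfold LongestP IsState
  rw [snocP_iff hE hκ h0 hp hp' hl hr, and_iff_right (inS_st hp')]
  refine and_congr_right fun _ => ⟨fun h z hz hs => ?_, fun h y hy hs => ?_⟩
  · obtain ⟨y, hy, rfl⟩ := exists_st hN hz
    rw [length_st, length_st]
    exact h y hy ((snocP_iff hE hκ h0 hp hy hl hr).mpr hs)
  · have := h _ (inS_st hy) ((snocP_iff hE hκ h0 hp hy hl hr).mp hs)
    rwa [length_st, length_st] at this

open Classical in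
/-- The number of letters in the orbit of `c (p / N)`, fixed by the translation with the
number `s`, that lead from the state `p` to the state `p'`. -/
noncomputable def orbitTrans (E : ℕ → ℕ) (S : ℕ → ℕ → ℕ) (N n s p p' : ℕ) : ℕ :=
  ∑ r ∈ Finset.range N, if (∀ r' < r, E (p / N * N + r') ≠ E (p / N * N + r)) ∧
    E (p / N * N + S r (S 0 s)) = E (p / N * N + r) ∧ GoodP E S N n (p / N) r p ∧
    LongestP E N n p (p / N * N + r) p' then 1 else 0

open Classical in
-- The orbit of a letter is run through by all `N` translations, where only the first one that
-- yields a given letter counts (`sum_first`). The letters of larger orbit contribute only if the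
-- target is empty, that is, if `p' < N`.
theorem trans_st [Fintype H] [Fintype X] (hN : Numbering ix el N) (hS : SubTable ix el N S)
    (hE : LetterTable κ c el N n E) {cls : X → ℕ} (ho : OrbitOrder H κ cls)
    (hm : Minimal H κ c n) {g : H} {p p' : ℕ} (hp : p < N * n) (hp' : p' < N * n) :
    trans H κ c n {x | g +ᵥ x = x} (st el N c p) (st el N c p') =
      (if p' < N then ∑ a : X, (if g +ᵥ a = a ∧ cls (c (p / N)) < cls a then 1 else 0) else 0) +
        orbitTrans E S N n (ix g) p p' := by
  have h0 := hN.pos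
  have hl := div_lt_of_lt hp
  have hn : 0 < n := (Nat.zero_le _).trans_lt hl
  have e1 : st el N c p' = [] ↔ p' < N := by
    rw [← List.length_eq_zero_iff, length_st, Nat.div_eq_zero_iff]
    omega
  have e := trans_eq ho hm hn (Y := {x | g +ᵥ x = x}) hl (el (p % N)) (st el N c p')
  rw [show st el N c p = wd c (p / N) (el (p % N)) from rfl, e]
  congr 1
  · refine if_congr e1 (Finset.sum_congr rfl fun a _ => ?_) rfl
    exact if_congr Iff.rfl rfl rfl
  · have h2 := sum_first (fun r => el r +ᵥ c (p / N)) (fun a => if a ∈ {x | g +ᵥ x = x} ∧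
      Step H κ c n (wd c (p / N) (el (p % N))) a (st el N c p') then 1 else 0) N
    have h3 : ∀ a : X, (∃ r : H, a = r +ᵥ c (p / N)) ↔
        a ∈ (Finset.range N).image fun r => el r +ᵥ c (p / N) := by
      intro a
      rw [Finset.mem_image]
      constructor
      · rintro ⟨h, rfl⟩
        exact ⟨ix h, Finset.mem_range.mpr (hN.lt h), by rw [hN.el_ix]⟩
      · rintro ⟨r, -, rfl⟩
        exact ⟨_, rfl⟩
    simp only [h3, ite_and (_ ∈ Finset.image _ _)]
    rw [Finset.sum_ite_mem, Finset.univ_inter, ← h2]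
    refine Finset.sum_congr rfl fun r hr => ?_
    rw [Finset.mem_range] at hr
    rw [← ite_and]
    refine if_congr (and_congr (forall_congr' fun r' => imp_congr_right fun hr' => ?_)
      (and_congr ?_ (and_congr ?_ ?_))) rfl rfl
    · rw [hE.at hl (by omega), hE.at hl hr, ho.inj.ne_iff]
    · rw [SubTable.add hN hS hr (hN.lt g), hE.at hl (hN.lt _), hE.at hl hr, hN.el_ix, hN.el_ix,
        ho.inj.eq_iff, add_comm, add_vadd]
      rfl
    · exact (goodP_iff hN hS hE ho.inj hp hl hr).symm
    · exact (longestP_iff hN hE ho.inj hp hp' hl hr).symm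

open Classical in
theorem walks_st_zero [Fintype X] (hE : LetterTable κ c el N n E) (hκ : Function.Injective κ)
    (h0 : 0 < N) {Y : Set X} {p p' : ℕ} (hp : p < N * n) :
    walks H κ c n Y 0 (st el N c p) (st el N c p') =
      if p' / N = p / N ∧ SufP E N p p' then 1 else 0 := by
  rw [walks_zero (inS_st hp)]
  refine if_congr ?_ rfl rfl
  rw [sufP_iff hE hκ h0 hp]
  constructor
  · intro h
    have := congrArg List.length h
    rw [length_st, length_st] at this
    exact ⟨this.symm, h ▸ List.suffix_rfl⟩
  · rintro ⟨h1, h2⟩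
    exact (h2.eq_of_length (by rw [length_st, length_st, h1])).symm

open Classical in
-- A prefix may be fixed by a nonzero translation, so several numbers can denote one state; counting
-- only the first of them removes the repetitions.
theorem sum_states [Fintype H] (hN : Numbering ix el N) (hE : LetterTable κ c el N n E)
    (hκ : Function.Injective κ) (w : List X → ℕ) :
    ∑ z ∈ states H c n, w z =
      ∑ p ∈ Finset.range (N * n), if FirstP E N p then w (st el N c p) else 0 := by
  rw [← image_st hN]
  refine Eq.trans (by congr!) ((sum_first (st el N c) w (N * n)).symm.trans ?_)
  refine Finset.sum_congr rfl fun p hp => ?_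
  have := firstP_iff hE hκ hN.pos (Finset.mem_range.mp hp)
  by_cases h : FirstP E N p
  · rw [if_pos h, if_pos (this.mp h)]
  · rw [if_neg h, if_neg (mt this.mpr h)]

theorem st_map (hN : Numbering ix el N) (hS : SubTable ix el N S) {p : ℕ} (g : H) :
    (st el N c p).map (-g +ᵥ ·) = st el N c (p / N * N + S (p % N) (ix g)) := by
  have h0 := hN.pos
  have h1 := Nat.mod_lt p h0
  rw [hS _ h1 _ (hN.lt g), st, map_wd, st, mul_add_div' (hN.lt _), Nat.mul_add_mod',
    Nat.mod_eq_of_lt (hN.lt _), hN.el_ix, hN.el_ix, sub_eq_neg_add]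

end Tables

end Auto

/-! ### Derived expressions -/

namespace Expr

/-- An expression used as a condition holds if its value is not zero. -/
def Holds (e : Expr) (σ : Store) : Prop := e.eval σ ≠ 0

/-- Truncated subtraction provides all tests: `1 - e` is `1` if `e` is zero and `0` otherwise, and
`f - e` is nonzero exactly if `e < f`. -/
def neg (e : Expr) : Expr := .sub (.const 1) e
def lt (e f : Expr) : Expr := .sub f e
def le (e f : Expr) : Expr := neg (.sub e f)
def eq (e f : Expr) : Expr := neg (.add (.sub e f) (.sub f e))
def or (e f : Expr) : Expr := .add e f
def and (e f : Expr) : Expr := .mul e f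
def imp (e f : Expr) : Expr := .or (neg e) f
def all (x v : ℕ) (e : Expr) : Expr := neg (.sum x v (neg e))
/-- `f` if `e` holds, and `0` otherwise. -/
def cond (e f : Expr) : Expr := .mul (neg (neg e)) f
def mod (e f : Expr) : Expr := .sub e (.mul f (.div e f))
/-- The smallest value of `y` below the value of `v` with `e`. -/
def least (x y v : ℕ) (e : Expr) : Expr := .sum x v (cond (all y v (imp (le (.var y) (.var x)) (neg e)))
  (.const 1))

variable (e f : Expr) (σ : Store)

theorem holds_neg : (neg e).Holds σ ↔ ¬ e.Holds σ := by
  simp only [Holds, neg, eval]; omega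

theorem holds_lt : (lt e f).Holds σ ↔ e.eval σ < f.eval σ := by
  simp only [Holds, lt, eval]; omega

theorem holds_le : (le e f).Holds σ ↔ e.eval σ ≤ f.eval σ := by
  simp only [Holds, le, neg, eval]; omega

theorem holds_eq : (eq e f).Holds σ ↔ e.eval σ = f.eval σ := by
  simp only [Holds, eq, neg, eval]; omega

theorem holds_or : (or e f).Holds σ ↔ e.Holds σ ∨ f.Holds σ := by
  simp only [Holds, or, eval]; omega

theorem holds_and : (and e f).Holds σ ↔ e.Holds σ ∧ f.Holds σ := by
  simp only [Holds, and, eval, mul_ne_zero_iff]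

theorem holds_imp : (imp e f).Holds σ ↔ (e.Holds σ → f.Holds σ) := by
  rw [imp, holds_or, holds_neg]; tauto

theorem holds_all (x v : ℕ) :
    (all x v e).Holds σ ↔ ∀ i < σ.r v, e.Holds (σ.setR x i) := by
  rw [all, holds_neg]
  simp only [Holds, neg, eval, ne_eq, not_not, Finset.sum_eq_zero_iff, Finset.mem_range]
  refine forall_congr' fun i => imp_congr_right fun _ => ?_
  omega

open Classical in
theorem eval_cond : (cond e f).eval σ = if e.Holds σ then f.eval σ else 0 := by
  by_cases h : e.Holds σ
  · rw [if_pos h]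
    simp [cond, neg, eval, Nat.sub_eq_zero_of_le (Nat.one_le_iff_ne_zero.mpr h)]
  · rw [if_neg h]
    rw [Holds, not_not] at h
    simp [cond, neg, eval, h]

theorem eval_mod : (mod e f).eval σ = e.eval σ % f.eval σ := by
  simp only [mod, eval]
  have := Nat.div_add_mod (e.eval σ) (f.eval σ)
  omega

/-- The sum counts those `x` for which no `y ≤ x` satisfies the condition. These are the numbers
below the smallest solution `k`, so there are `k` of them. -/
theorem eval_least {e : Expr} {σ : Store} {x y v : ℕ} {P : ℕ → Prop} (hxy : x ≠ y) (hvx : v ≠ x)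
    (he : ∀ i j, j < σ.r v → (e.Holds ((σ.setR x i).setR y j) ↔ P j)) {k : ℕ} (hk : k < σ.r v)
    (hP : P k) (hlt : ∀ j < k, ¬ P j) : (least x y v e).eval σ = k := by
  classical
  have h1 : ∀ i, (cond (all y v (imp (le (.var y) (.var x)) (neg e))) (.const 1)).eval (σ.setR x i) =
      if i < k then 1 else 0 := by
    intro i
    rw [eval_cond]
    refine if_congr ?_ rfl rfl
    simp only [holds_all, holds_imp, holds_le, holds_neg, eval, Store.setR_r_ne _ _ hvx,
      Store.setR_r_same, Store.setR_r_ne _ _ hxy]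
    constructor
    · intro h
      by_contra! hki
      exact h k hk hki ((he i k hk).mpr hP)
    · intro hi j hj hji
      rw [he i j hj]
      exact hlt j (by omega)
  unfold least
  simp only [eval] at h1 ⊢
  rw [Finset.sum_congr rfl fun i _ => h1 i, ← Finset.card_filter]
  have : (Finset.range (σ.r v)).filter (· < k) = Finset.range k := by ext i; simp; omega
  rw [this, Finset.card_range]

end Expr

/-! ### What a statement does not change -/

namespace Store

theorem setR_self (σ : Store) (x : ℕ) : σ.setR x (σ.r x) = σ := by
  ext <;> simp [setR]

theorem setR_setR (σ : Store) (x u v : ℕ) : (σ.setR x u).setR x v = σ.setR x v := by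
  simp [setR]

theorem setR_setA (σ : Store) (x u a : ℕ) (f : ℕ → ℕ → ℕ) :
    (σ.setR x u).setA a f = (σ.setA a f).setR x u := rfl

theorem setA_setA (σ : Store) (a : ℕ) (f g : ℕ → ℕ → ℕ) : (σ.setA a f).setA a g = σ.setA a g := by
  simp [setA]

theorem setA_self (σ : Store) (a : ℕ) : σ.setA a (σ.A a) = σ := by
  ext <;> simp [setA]

end Store

namespace Stmt

/-- The variables that are assigned. -/
def vars : Stmt → List ℕ
  | .assign x _ => [x]
  | .store _ _ _ _ => []
  | .seq s t => s.vars ++ t.vars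
  | .loop _ _ s => s.vars

theorem exec_r {s : Stmt} {x : ℕ} (hx : x ∉ s.vars) (σ : Store) : (s.exec σ).r x = σ.r x := by
  induction s generalizing σ with
  | assign y e => exact Store.setR_r_ne _ _ (by simpa [vars] using hx)
  | store a i j e => rfl
  | seq s t hs ht =>
    simp only [vars, List.mem_append, not_or] at hx
    rw [exec, ht hx.2, hs hx.1]
  | loop y v s ih =>
    rw [exec]
    by_cases e : x = y
    · rw [e, Store.setR_r_same]
    · rw [Store.setR_r_ne _ _ e]
      generalize σ.r v = k
      induction k with
      | zero => rfl
      | succ k ihk => rw [iter, ih hx, Store.setR_r_ne _ _ e, ihk]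

theorem exec_base (s : Stmt) (σ : Store) : (s.exec σ).base = σ.base := by
  induction s generalizing σ with
  | assign y e => rfl
  | store b i j e => rfl
  | seq s t hs ht => rw [exec, ht, hs]
  | loop y v s ih =>
    rw [exec, Store.setR_base]
    generalize σ.r v = k
    induction k with
    | zero => rfl
    | succ k ihk => rw [iter, ih, Store.setR_base, ihk]

theorem exec_raw (s : Stmt) (σ : Store) : (s.exec σ).raw = σ.raw := by
  induction s generalizing σ with
  | assign y e => rfl
  | store b i j e => rfl
  | seq s t hs ht => rw [exec, ht, hs]
  | loop y v s ih =>
    rw [exec, Store.setR_raw]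
    generalize σ.r v = k
    induction k with
    | zero => rfl
    | succ k ihk => rw [iter, ih, Store.setR_raw, ihk]

end Stmt

/-! ### Running times -/

/-- Weights for the variables in `S`, none of which is bound in the expression, bound the time by a
power of `M`. -/
def Expr.Fixed (S : List ℕ) : Expr → Bool
  | .const _ => true
  | .var _ => true
  | .add e f => e.Fixed S && f.Fixed S
  | .sub e f => e.Fixed S && f.Fixed S
  | .mul e f => e.Fixed S && f.Fixed S
  | .div e f => e.Fixed S && f.Fixed S
  | .get _ e f => e.Fixed S && f.Fixed S
  | .raw e => e.Fixed S
  | .sum x v e => decide (v ∈ S) && decide (x ∉ S) && e.Fixed S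

/-- All ranges are given by variables in `S`, which are not changed. -/
def Stmt.Fixed (S : List ℕ) : Stmt → Bool
  | .assign x e => decide (x ∉ S) && e.Fixed S
  | .store _ i j e => i.Fixed S && j.Fixed S && e.Fixed S
  | .seq s t => s.Fixed S && t.Fixed S
  | .loop x v s => decide (v ∈ S) && decide (x ∉ S) && s.Fixed S

/-- The exponent of the running time if the variable `v` is at most the `wt v`-th power. -/
def Expr.depth (wt : ℕ → ℕ) : Expr → ℕ
  | .const _ => 0
  | .var _ => 0
  | .add e f => max (e.depth wt) (f.depth wt)
  | .sub e f => max (e.depth wt) (f.depth wt)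
  | .mul e f => max (e.depth wt) (f.depth wt)
  | .div e f => max (e.depth wt) (f.depth wt)
  | .get _ e f => max (e.depth wt) (f.depth wt)
  | .raw e => e.depth wt
  | .sum _ v e => wt v + e.depth wt

def Stmt.depth (wt : ℕ → ℕ) : Stmt → ℕ
  | .assign _ e => e.depth wt
  | .store _ i j e => max (max (i.depth wt) (j.depth wt)) (e.depth wt)
  | .seq s t => max (s.depth wt) (t.depth wt)
  | .loop _ v s => wt v + s.depth wt

/-- The constant factor of the running time. -/
def Expr.size : Expr → ℕ
  | .const _ => 1
  | .var _ => 2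
  | .add e f => e.size + f.size + 1
  | .sub e f => e.size + f.size + 1
  | .mul e f => e.size + f.size + 1
  | .div e f => e.size + f.size + 1
  | .get _ e f => e.size + f.size + 9
  | .raw e => e.size + 3
  | .sum _ _ e => e.size + 16

def Stmt.size : Stmt → ℕ
  | .assign _ e => e.size + 2
  | .store _ i j e => i.size + j.size + e.size + 9
  | .seq s t => s.size + t.size
  | .loop _ _ s => s.size + 15

section Time

variable {S : List ℕ} {wt : ℕ → ℕ} {M : ℕ}

theorem sum_cost_le {k K w D a : ℕ} {f : ℕ → ℕ} (hM : 1 ≤ M) (hk : k ≤ M ^ w)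
    (hf : ∀ i < k, f i ≤ K * M ^ D) :
    ∑ i ∈ Finset.range k, (f i + a) + 8 ≤ (K + (a + 8)) * M ^ (w + D) := by
  have h1 : 1 ≤ M ^ D := Nat.one_le_pow _ _ hM
  have h2 : 1 ≤ M ^ w := Nat.one_le_pow _ _ hM
  have h3 : ∑ i ∈ Finset.range k, (f i + a) ≤ k * ((K + a) * M ^ D) := by
    have : ∀ i ∈ Finset.range k, f i + a ≤ (K + a) * M ^ D := fun i hi => by
      have := hf i (Finset.mem_range.mp hi)
      nlinarith
    simpa using Finset.sum_le_card_nsmul _ _ _ this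
  have h4 := Nat.mul_le_mul_right ((K + a) * M ^ D) hk
  rw [pow_add]
  nlinarith [Nat.mul_le_mul h2 h1]

/-- Nested ranges multiply and parallel parts add: exponents are added along the nesting and
maximized over the parts, and all constants go into `size`. -/
theorem Expr.cost_le (hM : 1 ≤ M) (e : Expr) (he : e.Fixed S = true) (σ : Store)
    (hσ : ∀ v ∈ S, σ.r v ≤ M ^ wt v) : e.cost σ ≤ e.size * M ^ e.depth wt := by
  have one : ∀ a, 1 ≤ M ^ a := fun a => Nat.one_le_pow _ _ hM
  have bin : ∀ {c₁ c₂ s₁ s₂ d₁ d₂ k : ℕ}, c₁ ≤ s₁ * M ^ d₁ → c₂ ≤ s₂ * M ^ d₂ →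
      c₁ + c₂ + k ≤ (s₁ + s₂ + k) * M ^ max d₁ d₂ := by
    intro c₁ c₂ s₁ s₂ d₁ d₂ k h1 h2
    have h3 := h1.trans (Nat.mul_le_mul_left s₁ (Nat.pow_le_pow_right hM (le_max_left d₁ d₂)))
    have h4 := h2.trans (Nat.mul_le_mul_left s₂ (Nat.pow_le_pow_right hM (le_max_right d₁ d₂)))
    nlinarith [one (max d₁ d₂)]
  induction e generalizing σ with
  | const c => simp [Expr.cost, Expr.size, Expr.depth]
  | var x => simp [Expr.cost, Expr.size, Expr.depth]
  | add e f ihe ihf | sub e f ihe ihf | mul e f ihe ihf | div e f ihe ihf | get a e f ihe ihf =>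
    simp only [Expr.Fixed, Bool.and_eq_true] at he
    exact bin (ihe he.1 σ hσ) (ihf he.2 σ hσ)
  | raw e ihe =>
    simp only [Expr.cost, Expr.size, Expr.depth]
    nlinarith [ihe he σ hσ, one (e.depth wt)]
  | sum x v e ihe =>
    simp only [Expr.Fixed, Bool.and_eq_true, decide_eq_true_eq] at he
    simp only [Expr.cost, Expr.size, Expr.depth]
    refine sum_cost_le hM (hσ v he.1.1) fun i _ => ihe he.2 _ fun u hu => ?_
    rw [Store.setR_r_ne _ _ (by rintro rfl; exact he.1.2 hu)]
    exact hσ u hu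

theorem Stmt.exec_r_of_fixed {s : Stmt} (hs : s.Fixed S = true) {x : ℕ} (hx : x ∈ S) (σ : Store) :
    (s.exec σ).r x = σ.r x := by
  refine Stmt.exec_r (fun h => ?_) σ
  induction s with
  | assign y e =>
    simp only [Stmt.Fixed, Bool.and_eq_true, decide_eq_true_eq] at hs
    simp only [Stmt.vars, List.mem_singleton] at h
    exact hs.1 (h ▸ hx)
  | store a i j e => simp [Stmt.vars] at h
  | seq s t ihs iht =>
    simp only [Stmt.Fixed, Bool.and_eq_true] at hs
    rcases List.mem_append.mp h with h | h
    exacts [ihs hs.1 h, iht hs.2 h]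
  | loop y v s ih =>
    simp only [Stmt.Fixed, Bool.and_eq_true] at hs
    exact ih hs.2 h

theorem iter_r_of_fixed {s : Stmt} (hs : s.Fixed S = true) {x y : ℕ} (hy : y ∉ S) (hx : x ∈ S)
    (σ : Store) (k : ℕ) : (iter s.exec y σ k).r x = σ.r x := by
  have hne : x ≠ y := fun h => hy (h ▸ hx)
  induction k with
  | zero => rfl
  | succ k ih => rw [iter, Stmt.exec_r_of_fixed hs hx, Store.setR_r_ne _ _ hne, ih]

theorem Stmt.cost_le (hM : 1 ≤ M) (s : Stmt) (hs : s.Fixed S = true) (σ : Store)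
    (hσ : ∀ v ∈ S, σ.r v ≤ M ^ wt v) : s.cost σ ≤ s.size * M ^ s.depth wt := by
  have one : ∀ a, 1 ≤ M ^ a := fun a => Nat.one_le_pow _ _ hM
  have mono : ∀ {a b : ℕ}, a ≤ b → M ^ a ≤ M ^ b := fun h => Nat.pow_le_pow_right hM h
  induction s generalizing σ with
  | assign x e =>
    simp only [Stmt.Fixed, Bool.and_eq_true] at hs
    simp only [Stmt.cost, Stmt.size, Stmt.depth]
    nlinarith [Expr.cost_le hM e hs.2 σ hσ, one (e.depth wt)]
  | store a i j e =>
    simp only [Stmt.Fixed, Bool.and_eq_true] at hs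
    simp only [Stmt.cost, Stmt.size, Stmt.depth]
    have h1 := (Expr.cost_le hM i hs.1.1 σ hσ).trans (Nat.mul_le_mul_left _ (mono (b :=
      max (max (i.depth wt) (j.depth wt)) (e.depth wt)) (by omega)))
    have h2 := (Expr.cost_le hM j hs.1.2 σ hσ).trans (Nat.mul_le_mul_left _ (mono (b :=
      max (max (i.depth wt) (j.depth wt)) (e.depth wt)) (by omega)))
    have h3 := (Expr.cost_le hM e hs.2 σ hσ).trans (Nat.mul_le_mul_left _ (mono (b :=
      max (max (i.depth wt) (j.depth wt)) (e.depth wt)) (by omega)))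
    nlinarith [one (max (max (i.depth wt) (j.depth wt)) (e.depth wt))]
  | seq s t ihs iht =>
    simp only [Stmt.Fixed, Bool.and_eq_true] at hs
    simp only [Stmt.cost, Stmt.size, Stmt.depth]
    have h1 := (ihs hs.1 σ hσ).trans (Nat.mul_le_mul_left _ (mono (le_max_left _ (t.depth wt))))
    have h2 := (iht hs.2 (s.exec σ) fun v hv => by
      rw [Stmt.exec_r_of_fixed hs.1 hv]; exact hσ v hv).trans
      (Nat.mul_le_mul_left _ (mono (le_max_right (s.depth wt) _)))
    rw [add_mul]
    exact Nat.add_le_add h1 h2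
  | loop x v s ih =>
    simp only [Stmt.Fixed, Bool.and_eq_true, decide_eq_true_eq] at hs
    simp only [Stmt.cost, Stmt.size, Stmt.depth]
    refine sum_cost_le hM (hσ v hs.1.1) fun i _ => ih hs.2 _ fun u hu => ?_
    rw [Store.setR_r_ne _ _ (by rintro rfl; exact hs.1.2 hu), iter_r_of_fixed hs.2 hs.1.2 hu]
    exact hσ u hu

end Time

/-! ### Rules for statements -/

namespace Stmt

/-- A statement stores only numbers up to `V`, and leads to a state with `Q`. -/
def Post (V : ℕ) (s : Stmt) (σ : Store) (Q : Store → Prop) : Prop := s.Safe V σ ∧ Q (s.exec σ)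

/-- Fill the row `i` of an array. -/
def row (a : ℕ) (i : Expr) (y v : ℕ) (e : Expr) : Stmt := .loop y v (.store a i (.var y) e)

/-- Fill a rectangle of an array. -/
def tab (a x v y w : ℕ) (e : Expr) : Stmt := .loop x v (row a (.var x) y w e)

/-- Fill the rows of an array by recursion. -/
def recur (a x v y w : ℕ) (e : Expr) : Stmt := .loop x v (row a (.add (.var x) (.const 1)) y w e)

variable {V : ℕ} {s t : Stmt} {σ : Store} {Q : Store → Prop}

theorem Post.mono {Q' : Store → Prop} (h : s.Post V σ Q) (hQ : ∀ σ', Q σ' → Q' σ') : s.Post V σ Q' :=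
  ⟨h.1, hQ _ h.2⟩

theorem Post.seq (h : s.Post V σ fun σ' => t.Post V σ' Q) : (Stmt.seq s t).Post V σ Q :=
  ⟨⟨h.1, h.2.1⟩, h.2.2⟩

theorem Post.assign {x : ℕ} {e : Expr} {k : ℕ} (he : e.eval σ = k) (hk : k ≤ V)
    (hQ : Q (σ.setR x k)) : (Stmt.assign x e).Post V σ Q := by
  subst he; exact ⟨hk, hQ⟩

theorem Post.loop {x v : ℕ} (I : ℕ → Store → Prop) (h0 : I 0 σ)
    (hs : ∀ i < σ.r v, ∀ σ', I i σ' → s.Post V (σ'.setR x i) (I (i + 1)))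
    (hQ : ∀ σ', I (σ.r v) σ' → Q (σ'.setR x (σ.r x))) : (Stmt.loop x v s).Post V σ Q := by
  have h : ∀ i ≤ σ.r v, I i (iter s.exec x σ i) := by
    intro i hi
    induction i with
    | zero => exact h0
    | succ i ih => exact (hs i (by omega) _ (ih (by omega))).2
  exact ⟨fun i hi => (hs i hi _ (h i hi.le)).1, hQ _ (h _ le_rfl)⟩

/-- The row changes while it is being filled, so the hypotheses on `i` and `e` are required for
every content of the row `r`. -/
theorem Post.row {a y v r : ℕ} {i e : Expr} (F : ℕ → ℕ)
    (hi : ∀ f u, (∀ r' ≠ r, f r' = σ.A a r') → i.eval ((σ.setA a f).setR y u) = r)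
    (he : ∀ f, (∀ r' ≠ r, f r' = σ.A a r') → ∀ j < σ.r v, e.eval ((σ.setA a f).setR y j) = F j)
    (hF : ∀ j < σ.r v, F j ≤ V)
    (hQ : ∀ f, (∀ j < σ.r v, f r j = F j) → (∀ r' ≠ r, f r' = σ.A a r') → Q (σ.setA a f)) :
    (Stmt.row a i y v e).Post V σ Q := by
  refine Post.loop (fun k σ' => ∃ f u, σ' = (σ.setA a f).setR y u ∧ (∀ j < k, f r j = F j) ∧
    ∀ r' ≠ r, f r' = σ.A a r') ⟨σ.A a, σ.r y, ?_, by simp, fun _ _ => rfl⟩ ?_ ?_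
  · rw [Store.setA_self, Store.setR_self]
  · rintro k hk σ' ⟨f, u, rfl, h1, h2⟩
    rw [Store.setR_setR]
    refine ⟨(he f h2 k hk).trans_le (hF k hk), upd f r k (F k), k, ?_, fun j hj => ?_, fun r' hr' => ?_⟩
    · rw [Stmt.exec, hi f k h2, he f h2 k hk, Store.setR_setA, Store.setA_setA]
      simp [Expr.eval]
    · unfold upd
      split_ifs with h
      · rw [h.2]
      · exact h1 j (by omega)
    · rw [← h2 r' hr']
      funext j
      simp [upd, hr']
  · rintro σ' ⟨f, u, rfl, h1, h2⟩
    rw [Store.setR_setR]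
    have : (σ.setA a f).setR y (σ.r y) = σ.setA a f := Store.setR_self (σ.setA a f) y
    rw [this]
    exact hQ f h1 h2

theorem Post.tab {a x v y w : ℕ} {e : Expr} (hxy : x ≠ y) (hwx : w ≠ x) (F : ℕ → ℕ → ℕ)
    (he : ∀ f, ∀ i < σ.r v, ∀ j < σ.r w, e.eval (((σ.setA a f).setR x i).setR y j) = F i j)
    (hF : ∀ i < σ.r v, ∀ j < σ.r w, F i j ≤ V)
    (hQ : ∀ f, (∀ i < σ.r v, ∀ j < σ.r w, f i j = F i j) → Q (σ.setA a f)) :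
    (Stmt.tab a x v y w e).Post V σ Q := by
  refine Post.loop (fun k σ' => ∃ f u, σ' = (σ.setA a f).setR x u ∧
    ∀ i < k, ∀ j < σ.r w, f i j = F i j) ⟨σ.A a, σ.r x, ?_, by simp⟩ ?_ ?_
  · rw [Store.setA_self, Store.setR_self]
  · rintro k hk σ' ⟨f, u, rfl, h1⟩
    rw [Store.setR_setR]
    have hw : ((σ.setA a f).setR x k).r w = σ.r w := Store.setR_r_ne _ _ hwx
    refine Post.row (r := k) (F k) (fun f' u' _ => ?_) (fun f' _ j hj => ?_) (fun j hj => ?_)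
      fun f' h3 h4 => ⟨f', k, ?_, fun i hi j hj => ?_⟩
    · simp only [Expr.eval]
      rw [Store.setR_r_ne _ _ hxy, Store.setA_r, Store.setR_r_same]
    · rw [Store.setR_setA, Store.setA_setA]
      exact he f' k hk j (hw ▸ hj)
    · exact hF k hk j (hw ▸ hj)
    · rw [Store.setR_setA, Store.setA_setA]
    · rcases Nat.lt_succ_iff_lt_or_eq.mp hi with h | rfl
      · rw [h4 i h.ne]
        simpa using h1 i h j hj
      · exact h3 j (hw.symm ▸ hj)
  · rintro σ' ⟨f, u, rfl, h1⟩
    rw [Store.setR_setR]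
    have : (σ.setA a f).setR x (σ.r x) = σ.setA a f := Store.setR_self (σ.setA a f) x
    rw [this]
    exact hQ f h1

/-- While the row `i + 1` is filled the row `i` is complete, and this is all that the entries may
use. -/
theorem Post.recur {a x v y w : ℕ} {e : Expr} (hxy : x ≠ y) (hwx : w ≠ x) (F : ℕ → ℕ → ℕ)
    (h0 : ∀ j < σ.r w, σ.A a 0 j = F 0 j)
    (he : ∀ f, ∀ i < σ.r v, (∀ j < σ.r w, f i j = F i j) → ∀ j < σ.r w,
      e.eval (((σ.setA a f).setR x i).setR y j) = F (i + 1) j)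
    (hF : ∀ i ≤ σ.r v, ∀ j < σ.r w, F i j ≤ V)
    (hQ : ∀ f, (∀ i ≤ σ.r v, ∀ j < σ.r w, f i j = F i j) → Q (σ.setA a f)) :
    (Stmt.recur a x v y w e).Post V σ Q := by
  refine Post.loop (fun k σ' => ∃ f u, σ' = (σ.setA a f).setR x u ∧
    ∀ i ≤ k, ∀ j < σ.r w, f i j = F i j) ⟨σ.A a, σ.r x, ?_, ?_⟩ ?_ ?_
  · rw [Store.setA_self, Store.setR_self]
  · intro i hi j hj
    rw [Nat.le_zero.mp hi]; exact h0 j hj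
  · rintro k hk σ' ⟨f, u, rfl, h1⟩
    rw [Store.setR_setR]
    have hw : ((σ.setA a f).setR x k).r w = σ.r w := Store.setR_r_ne _ _ hwx
    refine Post.row (r := k + 1) (F (k + 1)) (fun f' u' _ => ?_) (fun f' h2 j hj => ?_)
      (fun j hj => ?_) fun f' h3 h4 => ⟨f', k, ?_, fun i hi j hj => ?_⟩
    · simp only [Expr.eval]
      rw [Store.setR_r_ne _ _ hxy, Store.setA_r, Store.setR_r_same]
    · rw [Store.setR_setA, Store.setA_setA]
      refine he f' k hk (fun j' hj' => ?_) j (hw ▸ hj)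
      rw [h2 k (by omega)]
      simpa using h1 k le_rfl j' hj'
    · exact hF (k + 1) hk j (hw ▸ hj)
    · rw [Store.setR_setA, Store.setA_setA]
    · rcases Nat.le_succ_iff.mp hi with h | rfl
      · rw [h4 i (by omega)]
        simpa using h1 i h j hj
      · exact h3 j (hw.symm ▸ hj)
  · rintro σ' ⟨f, u, rfl, h1⟩
    rw [Store.setR_setR]
    have : (σ.setA a f).setR x (σ.r x) = σ.setA a f := Store.setR_self (σ.setA a f) x
    rw [this]
    exact hQ f h1

end Stmt

/-! ### Numbering the translations -/

section Numbering

open Auto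

theorem index_zero {d : ℕ} {n : Fin d → ℕ} [∀ i, NeZero (n i)] : index (0 : Pos n) = 0 := by
  simp [index]

/-- The translation with a given index. -/
def posOf {d : ℕ} (n : Fin d → ℕ) [∀ i, NeZero (n i)] (t : ℕ) : Pos n :=
  if h : t < ∏ i, n i then finPiFinEquiv.symm ⟨t, h⟩ else 0

theorem index_posOf {d : ℕ} {n : Fin d → ℕ} [∀ i, NeZero (n i)] {t : ℕ} (ht : t < ∏ i, n i) :
    index (posOf n t) = t := by
  rw [index_eq_finPiFinEquiv, posOf, dif_pos ht, Equiv.apply_symm_apply]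

theorem posOf_index {d : ℕ} {n : Fin d → ℕ} [∀ i, NeZero (n i)] (g : Pos n) :
    posOf n (index g) = g :=
  index_injective (index_posOf (index_lt g))

theorem numbering {d : ℕ} (n : Fin d → ℕ) [∀ i, NeZero (n i)] :
    Numbering index (posOf n) (∏ i, n i) :=
  ⟨index_lt, posOf_index, fun _ => index_posOf, index_zero⟩

variable {q d : ℕ} {n : Fin (d + 1) → ℕ} [∀ i, NeZero (n i)]

/-- Quotient and remainder by the product of the lower sizes separate the last coordinate from the
others; the program uses them throughout. -/
theorem index_eq {d : ℕ} {n : Fin (d + 1) → ℕ} (g : Pos n) : index g = g (Fin.last d) * (∏ i, low n i) + index (lowPos g) := by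
  rw [index_succ, add_comm]

theorem index_div {d : ℕ} {n : Fin (d + 1) → ℕ} (g : Pos n) : index g / ∏ i, low n i = g (Fin.last d) := by
  rw [index_eq, mul_add_div' (index_lt _)]

theorem index_mod {d : ℕ} {n : Fin (d + 1) → ℕ} (g : Pos n) : index g % ∏ i, low n i = index (lowPos g) := by
  rw [index_eq, Nat.mul_add_mod', Nat.mod_eq_of_lt (index_lt _)]

theorem posOf_last {t : ℕ} (ht : t < ∏ i, n i) : (posOf n t (Fin.last d) : ℕ) = t / ∏ i, low n i := by
  rw [← index_div, index_posOf ht]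

theorem lowPos_posOf {t : ℕ} (ht : t < ∏ i, n i) :
    lowPos (posOf n t) = posOf (low n) (t % ∏ i, low n i) := by
  rw [← posOf_index (lowPos _), ← index_mod, index_posOf ht]

theorem index_sub {d : ℕ} {n : Fin (d + 1) → ℕ} (g h : Pos n) : index (g - h) = index (lowPos g - lowPos h) +
    (∏ i, low n i) * ((g (Fin.last d) + (n (Fin.last d) - h (Fin.last d))) % n (Fin.last d)) := by
  rw [index_eq, add_comm, mul_comm]
  congr 2
  rw [Pi.sub_apply, Fin.val_sub, add_comm]

theorem last_nsmul (k : ℕ) (g : Pos n) :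
    ((k • g) (Fin.last d) : ℕ) = k * g (Fin.last d) % n (Fin.last d) := by
  induction k with
  | zero => simp
  | succ k ih =>
    rw [add_nsmul, one_nsmul, Pi.add_apply, Fin.val_add, ih, add_mul, one_mul, Nat.mod_add_mod]

/-- A block of consecutive letters, as a word. -/
def block {d : ℕ} (n : Fin d → ℕ) (L : ℕ → Fin q) (b : ℕ) : Word q n :=
  fun p => L (b * (∏ i, n i) + index p)

/-- The slices of a block are consecutive blocks one dimension lower. Hence each dimension needs
from the one before only the tables of blocks. -/
theorem slices_block (L : ℕ → Fin q) (b i : ℕ) : slices (block n L b) i =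
    block (low n) L (b * n (Fin.last d) + i % n (Fin.last d)) := by
  funext p
  have e : lowPos (n := n) (Fin.snoc (α := fun i => Fin (n i)) p
      ⟨i % n (Fin.last d), Nat.mod_lt _ (last_pos n)⟩) = p := by
    funext i
    simp [lowPos]
  change L _ = L _
  congr 1
  rw [index_eq, e, prod_low, Fin.snoc_last]
  ring

theorem slices_vadd_block {t : ℕ} (ht : t < ∏ i, n i) (L : ℕ → Fin q) (b i : ℕ) :
    slices (posOf n t +ᵥ block n L b) i = posOf (low n) (t % ∏ i, low n i) +ᵥ
      block (low n) L (b * n (Fin.last d) + (i + t / ∏ i, low n i) % n (Fin.last d)) := by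
  rw [slices_vadd, slices_block, lowPos_posOf ht, posOf_last ht]

/-- The smallest shift to the smallest translate. -/
theorem shift_spec {d : ℕ} {n : Fin d → ℕ} [∀ i, NeZero (n i)] (x : Word q n) :
    ∃ h < ∏ i, n i, code n (posOf n h +ᵥ x) = cls n x ∧
      (∀ h' < h, code n (posOf n h' +ᵥ x) ≠ cls n x) ∧ kap n x = cls n x * (∏ i, n i) + h := by
  refine ⟨shiftOf index (code n) x, shiftOf_lt index_lt x, ?_, fun h' hh' he => ?_, rfl⟩
  · obtain ⟨h, h1, h2⟩ := shiftOf_spec (code := code n) (index (n := n)) x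
    rw [← h2, posOf_index, h1]
  · have h1 := shiftOf_le (ι := index (n := n)) he
    have h2 := shiftOf_lt (code := code n) (index_lt (n := n)) x
    rw [index_posOf (by omega)] at h1
    omega

/-- A translate with the smallest code. -/
theorem exists_min {d : ℕ} {n : Fin d → ℕ} [∀ i, NeZero (n i)] (x : Word q n) :
    ∃ t < ∏ i, n i, (∀ t' < ∏ i, n i, code n (posOf n t +ᵥ x) ≤ code n (posOf n t' +ᵥ x)) ∧
      (∀ s < t, ¬ ∀ t' < ∏ i, n i, code n (posOf n s +ᵥ x) ≤ code n (posOf n t' +ᵥ x)) ∧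
      code n (posOf n t +ᵥ x) = cls n x := by
  classical
  obtain ⟨g, hg⟩ := exists_clsOf (H := Pos n) (code := code n) x
  have hex : ∃ t, t < ∏ i, n i ∧
      ∀ t' < ∏ i, n i, code n (posOf n t +ᵥ x) ≤ code n (posOf n t' +ᵥ x) :=
    ⟨index g, index_lt g, fun t' _ => by rw [posOf_index, hg]; exact clsOf_le _ _⟩
  refine ⟨Nat.find hex, (Nat.find_spec hex).1, (Nat.find_spec hex).2, fun s hs h => ?_, ?_⟩
  · exact Nat.find_min hex hs ⟨hs.trans (Nat.find_spec hex).1, h⟩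
  · refine le_antisymm ?_ (clsOf_le _ _)
    have := (Nat.find_spec hex).2 _ (index_lt g)
    rwa [posOf_index, hg] at this

theorem minimal_of_eq_cls {d : ℕ} {n : Fin d → ℕ} [∀ i, NeZero (n i)] {x : Word q n} {g : Pos n}
    (h : code n (g +ᵥ x) = cls n x) (k : Pos n) : code n (g +ᵥ x) ≤ code n (k +ᵥ (g +ᵥ x)) := by
  rw [h, ← add_vadd]; exact clsOf_le _ _

/-- The data of the multiples of the last coordinate. -/
theorem exists_fixData (g : Pos n) : ∃ r a, 0 < r ∧ r ≤ n (Fin.last d) ∧ a < n (Fin.last d) ∧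
    Auto.FixData (n (Fin.last d)) (g (Fin.last d)) r (n (Fin.last d) / r) a ∧
    ((r • g) (Fin.last d) : ℕ) = 0 ∧ (∀ s, 0 < s → s < r → ((s • g) (Fin.last d) : ℕ) ≠ 0) ∧
    ((a • g) (Fin.last d) : ℕ) = n (Fin.last d) / r % n (Fin.last d) ∧
    ∀ s < a, ((s • g) (Fin.last d) : ℕ) ≠ n (Fin.last d) / r % n (Fin.last d) := by
  classical
  have hn := last_pos n
  have hex : ∃ r, 0 < r ∧ n (Fin.last d) ∣ r * g (Fin.last d) :=
    ⟨_, hn, dvd_mul_right _ _⟩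
  obtain ⟨h1, h2⟩ := Nat.find_spec hex
  have h3 : ∀ s, 0 < s → n (Fin.last d) ∣ s * g (Fin.last d) → Nat.find hex ≤ s :=
    fun s hs hd => Nat.find_min' hex ⟨hs, hd⟩
  obtain ⟨h4, h5⟩ := Auto.fixData_exists hn h1 h2 h3
  obtain ⟨h6, h7⟩ := Nat.find_spec h5
  refine ⟨Nat.find hex, Nat.find h5, h1, h3 _ hn (dvd_mul_right _ _), h6, ⟨h1, h4, h2, h3, h7⟩,
    ?_, fun s hs hlt h => ?_, ?_, fun s hs h => ?_⟩
  · rw [last_nsmul]; exact Nat.mod_eq_zero_of_dvd h2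
  · rw [last_nsmul] at h
    exact absurd (h3 s hs (Nat.dvd_of_mod_eq_zero h)) (by omega)
  · rw [last_nsmul, h7]
  · rw [last_nsmul] at h
    exact Nat.find_min h5 hs ⟨hs.trans h6, h⟩

end Numbering

/-! ### The program -/

namespace Expr

instance : Add Expr := ⟨.add⟩
instance : Sub Expr := ⟨.sub⟩
instance : Mul Expr := ⟨.mul⟩
instance : Div Expr := ⟨.div⟩
instance : Mod Expr := ⟨mod⟩

open Classical in
/-- The rules by which expressions are evaluated. -/
theorem rules :
    ((∀ c σ, (const c).eval σ = c) ∧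
      (∀ x σ, (var x).eval σ = σ.r x) ∧
      (∀ (e f : Expr) σ, (e + f).eval σ = e.eval σ + f.eval σ) ∧
      (∀ (e f : Expr) σ, (e - f).eval σ = e.eval σ - f.eval σ) ∧
      (∀ (e f : Expr) σ, (e * f).eval σ = e.eval σ * f.eval σ) ∧
      (∀ (e f : Expr) σ, (e / f).eval σ = e.eval σ / f.eval σ) ∧
      (∀ (e f : Expr) σ, (e % f).eval σ = e.eval σ % f.eval σ) ∧
      (∀ a e f σ, (get a e f).eval σ = σ.A a (e.eval σ) (f.eval σ)) ∧
      (∀ x v e σ, (sum x v e).eval σ = ∑ i ∈ Finset.range (σ.r v), e.eval (σ.setR x i)) ∧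
      (∀ e f σ, (cond e f).eval σ = if e.Holds σ then f.eval σ else 0)) ∧
    ((∀ a e f σ, (get a e f).Holds σ ↔ σ.A a (e.eval σ) (f.eval σ) ≠ 0) ∧
      (∀ e σ, (neg e).Holds σ ↔ ¬ e.Holds σ) ∧
      (∀ e f σ, (lt e f).Holds σ ↔ e.eval σ < f.eval σ) ∧
      (∀ e f σ, (le e f).Holds σ ↔ e.eval σ ≤ f.eval σ) ∧
      (∀ e f σ, (eq e f).Holds σ ↔ e.eval σ = f.eval σ) ∧
      (∀ e f σ, (or e f).Holds σ ↔ e.Holds σ ∨ f.Holds σ) ∧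
      (∀ e f σ, (and e f).Holds σ ↔ e.Holds σ ∧ f.Holds σ) ∧
      (∀ e f σ, (imp e f).Holds σ ↔ (e.Holds σ → f.Holds σ)) ∧
      (∀ x v e σ, (all x v e).Holds σ ↔ ∀ i < σ.r v, e.Holds (σ.setR x i))) ∧
    (∀ (σ : Store) x v, (σ.setR x v).A = σ.A) ∧ (∀ (σ : Store) a f, (σ.setA a f).r = σ.r) ∧
    (∀ (σ : Store) x v y, (σ.setR x v).r y = if y = x then v else σ.r y) ∧
    (∀ (σ : Store) a f b, (σ.setA a f).A b = if b = a then f else σ.A b) := by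
  refine ⟨⟨fun _ _ => rfl, fun _ _ => rfl, fun _ _ _ => rfl, fun _ _ _ => rfl,
    fun _ _ _ => rfl, fun _ _ _ => rfl, eval_mod, fun _ _ _ _ => rfl, fun _ _ _ _ => rfl, eval_cond⟩,
    ⟨fun _ _ _ _ => Iff.rfl, holds_neg, holds_lt, holds_le, holds_eq, holds_or, holds_and, holds_imp,
      fun x v e σ => holds_all e σ x v⟩,
    fun _ _ _ => rfl, fun _ _ _ => rfl, fun σ x v y => ?_, fun σ a f b => ?_⟩
  · by_cases h : y = x
    · rw [h, Store.setR_r_same, if_pos rfl]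
    · rw [Store.setR_r_ne _ _ h, if_neg h]
  · by_cases h : b = a
    · rw [h, Store.setA_A_same, if_pos rfl]
    · rw [Store.setA_A_ne _ _ h, if_neg h]

end Expr

-- Variables: 0 the dimension `d` (at the end, the rank), 1 `q`, 2 `N`, 3 the number of leading
-- sizes `1`, 4 the number of remaining dimensions, 5 the current one; 6 its size, 7 and 8 the
-- products of the sizes below it and up to it, 9 the number of blocks, 10 the current block, 11 the
-- current translation, 12 the base of the codes, 13 the square of 8, 14 the constant `1`; 20 to 24
-- are bound variables. Arrays: 0 weights `kap`, 1 `bigCount`, 2 `fixCount` and 3 subtraction, for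
-- the lower dimension; 8, 20, 14 and 4 the same for the current one; 5 powers of the base, 9
-- multiples of the translations, 21 orders of the last coordinates, 10 numbers of free slices, 12
-- the translations that fix slices, 11 twists, 13 powers of `fixCount`. For one block: 6 codes of
-- its translates, 7 the smallest of them, 15 letters, 16 suffixes, 17 first numbers of states, 18
-- transitions, 19 walks.
open MultiNecklace.Expr MultiNecklace.Stmt

/-- The table of subtraction, one dimension up. -/
def subStmt : Stmt := tab 4 20 8 21 8 (get 3 (var 20 % var 7) (var 21 % var 7) +
  var 7 * ((var 20 / var 7 + (var 6 - var 21 / var 7)) % var 6))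

/-- What the tables contain when the first dimensions have been treated. -/
structure Inv {q d : ℕ} (n : Fin d → ℕ) [∀ i, NeZero (n i)] (L : ℕ → Fin q) (R : ℕ) (σ : Store) :
    Prop where
  K : ∀ b < R, ∀ t < ∏ i, n i, σ.A 0 b t = kap n (posOf n t +ᵥ block n L b)
  A : ∀ b < R, ∀ t < ∏ i, n i, σ.A 1 b t = bigCount n (posOf n t) (block n L b)
  tot : ∀ t < ∏ i, n i, σ.A 2 0 t = fixCount q n (posOf n t)
  sub : Auto.SubTable index (posOf n) (∏ i, n i) (σ.A 3)
  base : σ.r 12 = bnd q n * ∏ i, n i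
  size : σ.r 7 = ∏ i, n i
  total : σ.r 2 = R * ∏ i, n i
  one : σ.r 14 = 1

/-! ### Tables of one dimension that serve all blocks: subtraction, powers, multiples, orders -/

section Level

variable {q d : ℕ} {n : Fin (d + 1) → ℕ} [∀ i, NeZero (n i)] {L : ℕ → Fin q} {R V : ℕ}
  {σ : Store} {Q : Store → Prop}

/-- The situation when the next dimension is treated. -/
structure Ctx {q d : ℕ} (n : Fin (d + 1) → ℕ) [∀ i, NeZero (n i)] (L : ℕ → Fin q) (R : ℕ)
    (σ : Store) : Prop where
  inv : Inv (low n) L (R * n (Fin.last d)) σ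
  last : σ.r 6 = n (Fin.last d)
  size : σ.r 8 = ∏ i, n i
  blocks : σ.r 9 = R
  square : σ.r 13 = (∏ i, n i) * ∏ i, n i

/-- The bounds for the numbers in the tables. -/
structure Big {d : ℕ} (q : ℕ) (n : Fin d → ℕ) (V : ℕ) : Prop where
  code : bnd q n * ∏ i, n i ≤ V
  count : q ^ ∏ i, n i ≤ V
  square : (∏ i, n i) * ∏ i, n i ≤ V

theorem Big.size {d q V : ℕ} {n : Fin d → ℕ} [∀ i, NeZero (n i)] (hV : Big q n V) :
    ∏ i, n i ≤ V :=
  (Nat.le_mul_of_pos_left _ (numbering n).pos).trans hV.square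

theorem Big.one {d q V : ℕ} {n : Fin d → ℕ} [∀ i, NeZero (n i)] (hV : Big q n V) : 1 ≤ V :=
  (numbering n).pos.trans_le hV.size

theorem sub_post (h : Ctx n L R σ) (hV : Big q n V)
    (hQ : ∀ f, Auto.SubTable index (posOf n) (∏ i, n i) f → Q (σ.setA 4 f)) :
    subStmt.Post V σ Q := by
  refine Post.tab (by decide) (by decide) (fun s t => index (posOf n s - posOf n t)) ?_ ?_ ?_
  · intro f i hi j hj
    rw [h.size] at hi hj
    simp only [rules, reduceIte, Nat.reduceEqDiff]
    have h0 : 0 < ∏ i, low n i := (numbering (low n)).pos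
    rw [h.inv.size, h.last, h.inv.sub _ (Nat.mod_lt _ h0) _ (Nat.mod_lt _ h0), index_sub,
      lowPos_posOf hi, lowPos_posOf hj, posOf_last hi, posOf_last hj]
  · intro i hi j hj
    exact (index_lt _).le.trans hV.size
  · intro f hf
    rw [h.size] at hf
    exact hQ f hf

/-- The powers of the base. -/
def powStmt : Stmt := .seq (.store 5 (const 0) (const 0) (const 1)) (recur 5 20 6 21 14 (get 5 (var 20) (const 0) * var 12))

theorem powers_le {B k m : ℕ} (hB : 0 < B) (hk : k ≤ m) : B ^ k ≤ B ^ m :=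
  Nat.pow_le_pow_right hB hk

theorem bnd_pos {d : ℕ} (q : ℕ) (n : Fin d → ℕ) [∀ i, NeZero (n i)] : 0 < bnd q n := by
  induction d with
  | zero => exact Nat.succ_pos q
  | succ d ih => exact Nat.pow_pos (Nat.mul_pos (ih (low n)) (numbering (low n)).pos)

/-- The variable 14 holds `1`, so the recursion fills rows with a single entry. -/
theorem pow_post (h : Ctx n L R σ) (hV : Big q n V)
    (hQ : ∀ f, (∀ i ≤ n (Fin.last d), f i 0 = (bnd q (low n) * ∏ i, low n i) ^ i) →
      Q (σ.setA 5 f)) : powStmt.Post V σ Q := by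
  have hB : 0 < bnd q (low n) * ∏ i, low n i := Nat.mul_pos (bnd_pos q (low n)) (numbering _).pos
  refine Post.seq ⟨hV.one, ?_⟩
  refine Post.recur (by decide) (by decide) (fun i _ => (bnd q (low n) * ∏ i, low n i) ^ i)
    ?_ ?_ ?_ ?_
  · intro j hj
    have h1 : σ.r 14 = 1 := h.inv.one
    have : j = 0 := by
      simp only [Stmt.exec, Store.setA_r] at hj; omega
    subst this
    simp [Stmt.exec, rules, upd]
  · intro f i hi hf j hj
    simp only [Stmt.exec, Store.setA_r, h.inv.one] at hf
    simp only [Stmt.exec, rules, reduceIte, Nat.reduceEqDiff]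
    rw [hf 0 one_pos, h.inv.base, pow_succ]
  · intro i hi j hj
    refine le_trans ?_ ((Nat.le_mul_of_pos_right _ (numbering n).pos).trans hV.code)
    simp only [Stmt.exec, Store.setA_r, h.last] at hi
    exact powers_le hB hi
  · intro f hf
    simp only [Stmt.exec, Store.setA_r, h.last, h.inv.one] at hf ⊢
    rw [Store.setA_setA]
    exact hQ f fun i hi => hf i hi 0 one_pos

/-- The multiples of the translations. -/
def mulStmt : Stmt := .seq (row 9 (const 0) 21 8 (const 0))
  (recur 9 20 6 21 8 (get 4 (get 9 (var 20) (var 21)) (get 4 (const 0) (var 21))))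

theorem mul_post (h : Ctx n L R σ) (hV : Big q n V)
    (hS : Auto.SubTable index (posOf n) (∏ i, n i) (σ.A 4))
    (hQ : ∀ f, (∀ i ≤ n (Fin.last d), ∀ t < ∏ i, n i, f i t = index (i • posOf n t)) →
      Q (σ.setA 9 f)) : mulStmt.Post V σ Q := by
  refine Post.seq (Post.row (r := 0) (fun _ => 0) (fun _ _ _ => rfl) (fun _ _ _ _ => rfl)
    (fun _ _ => Nat.zero_le _) fun f₀ hf₀ _ => ?_)
  refine Post.recur (by decide) (by decide) (fun i t => index (i • posOf n t)) ?_ ?_ ?_ ?_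
  · intro j hj
    rw [Store.setA_A_same, hf₀ j hj, zero_smul, index_zero]
  · intro f i hi hf j hj
    simp only [rules, reduceIte, Nat.reduceEqDiff] at hf hj ⊢
    rw [hf j hj]
    rw [h.size] at hj
    rw [Auto.SubTable.add (numbering n) hS (index_lt _) hj, posOf_index, succ_nsmul]
  · intro i hi j hj
    exact (index_lt _).le.trans hV.size
  · intro f hf
    rw [Store.setA_setA]
    simp only [Store.setA_r, h.last, h.size] at hf
    exact hQ f hf

/-- For every translation, the order of its last coordinate. -/
def ordStmt : Stmt := row 21 (const 0) 20 8 (least 22 23 6 (eq (get 9 (var 23 + const 1) (var 20) / var 7) (const 0)) + const 1)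

/-- The data that describe the multiples of the translation with index `t`. -/
structure FixAt {d : ℕ} (n : Fin (d + 1) → ℕ) [∀ i, NeZero (n i)] (t r a : ℕ) : Prop where
  pos : 0 < r
  le : r ≤ n (Fin.last d)
  lt : a < n (Fin.last d)
  data : Auto.FixData (n (Fin.last d)) (posOf n t (Fin.last d)) r (n (Fin.last d) / r) a
  zero : ((r • posOf n t) (Fin.last d) : ℕ) = 0
  least : ∀ s, 0 < s → s < r → ((s • posOf n t) (Fin.last d) : ℕ) ≠ 0
  eq : ((a • posOf n t) (Fin.last d) : ℕ) = n (Fin.last d) / r % n (Fin.last d)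
  first : ∀ s < a, ((s • posOf n t) (Fin.last d) : ℕ) ≠ n (Fin.last d) / r % n (Fin.last d)

theorem exists_fixAt (n : Fin (d + 1) → ℕ) [∀ i, NeZero (n i)] (t : ℕ) : ∃ r a, FixAt n t r a := by
  obtain ⟨r, a, h1, h2, h3, h4, h5, h6, h7, h8⟩ := exists_fixData (posOf n t)
  exact ⟨r, a, h1, h2, h3, h4, h5, h6, h7, h8⟩

noncomputable def ordOf {d : ℕ} (n : Fin (d + 1) → ℕ) [∀ i, NeZero (n i)] (t : ℕ) : ℕ :=
  (exists_fixAt n t).choose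

noncomputable def coefOf {d : ℕ} (n : Fin (d + 1) → ℕ) [∀ i, NeZero (n i)] (t : ℕ) : ℕ :=
  (exists_fixAt n t).choose_spec.choose

theorem fixAt (n : Fin (d + 1) → ℕ) [∀ i, NeZero (n i)] (t : ℕ) : FixAt n t (ordOf n t) (coefOf n t) :=
  (exists_fixAt n t).choose_spec.choose_spec

/-- The table of multiples. -/
def MulTable {d : ℕ} (n : Fin (d + 1) → ℕ) [∀ i, NeZero (n i)] (f : ℕ → ℕ → ℕ) : Prop :=
  ∀ i ≤ n (Fin.last d), ∀ t < ∏ i, n i, f i t = index (i • posOf n t)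

theorem ord_post (h : Ctx n L R σ) (hV : Big q n V) (hM : MulTable n (σ.A 9))
    (hQ : ∀ f, (∀ t < ∏ i, n i, f 0 t = ordOf n t) → Q (σ.setA 21 f)) :
    ordStmt.Post V σ Q := by
  refine Post.row (r := 0) (ordOf n) (fun _ _ _ => rfl) ?_ ?_ ?_
  · intro f _ t ht
    rw [h.size] at ht
    have h1 := fixAt n t
    have h2 := h1.pos
    have h3 := h1.le
    simp only [rules]
    -- The order is positive, so the search runs over its predecessor `j`; the final `+ 1` corrects
    -- this.
    rw [eval_least (P := fun j => index ((j + 1) • posOf n t) / (∏ i, low n i) = 0)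
      (k := ordOf n t - 1) (by decide) (by decide)]
    · omega
    · intro i j hj
      simp only [rules, reduceIte, Nat.reduceEqDiff, h.last] at hj ⊢
      rw [hM _ hj _ ht, h.inv.size]
    · simp only [rules, reduceIte, Nat.reduceEqDiff, h.last]
      omega
    · rw [Nat.sub_add_cancel h2, index_div, h1.zero]
    · intro j hj
      rw [index_div]
      exact h1.least _ (by omega) (by omega)
  · intro t ht
    have h1 := (fixAt n t).le
    refine h1.trans (le_trans ?_ hV.size)
    rw [prod_low]
    exact Nat.le_mul_of_pos_right _ (numbering (low n)).pos
  · intro f hf _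
    rw [h.size] at hf
    exact hQ f hf

end Level

/-! ### Free slices, stabilizers, twists and numbers of fixed words; codes of the translates of a
block -/

section Level

variable {q d : ℕ} {n : Fin (d + 1) → ℕ} [∀ i, NeZero (n i)] {L : ℕ → Fin q} {R V : ℕ}
  {σ : Store} {Q : Store → Prop}

/-- For every translation, the number of free slices of the words that it fixes. -/
def freeStmt : Stmt := row 10 (const 0) 20 8 (var 6 / get 21 (const 0) (var 20))

theorem last_le_prod (n : Fin (d + 1) → ℕ) [∀ i, NeZero (n i)] : n (Fin.last d) ≤ ∏ i, n i := by
  rw [prod_low]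
  exact Nat.le_mul_of_pos_right _ (numbering (low n)).pos

theorem free_post (h : Ctx n L R σ) (hV : Big q n V) (hr : ∀ t < ∏ i, n i, σ.A 21 0 t = ordOf n t)
    (hQ : ∀ f, (∀ t < ∏ i, n i, f 0 t = n (Fin.last d) / ordOf n t) → Q (σ.setA 10 f)) :
    freeStmt.Post V σ Q := by
  refine Post.row (r := 0) (fun t => n (Fin.last d) / ordOf n t) (fun _ _ _ => rfl) ?_ ?_ ?_
  · intro f _ t ht
    rw [h.size] at ht
    simp only [rules, reduceIte, Nat.reduceEqDiff]
    rw [h.last, hr t ht]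
  · intro t ht
    exact (Nat.div_le_self _ _).trans ((last_le_prod n).trans hV.size)
  · intro f hf _
    rw [h.size] at hf
    exact hQ f hf

/-- For every translation, the translation that fixes the slices of the words that it fixes. -/
def stabStmt : Stmt := row 12 (const 0) 20 8 (get 9 (get 21 (const 0) (var 20)) (var 20) % var 7)

theorem stab_post (h : Ctx n L R σ) (hV : Big q n V) (hr : ∀ t < ∏ i, n i, σ.A 21 0 t = ordOf n t)
    (hM : MulTable n (σ.A 9))
    (hQ : ∀ f, (∀ t < ∏ i, n i, f 0 t = index (ordOf n t • lowPos (posOf n t))) →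
      Q (σ.setA 12 f)) : stabStmt.Post V σ Q := by
  refine Post.row (r := 0) (fun t => index (ordOf n t • lowPos (posOf n t))) (fun _ _ _ => rfl)
    ?_ ?_ ?_
  · intro f _ t ht
    rw [h.size] at ht
    simp only [rules, reduceIte, Nat.reduceEqDiff]
    rw [h.inv.size, hr t ht, hM _ (fixAt n t).le t ht, index_mod]
    rfl
  · intro t ht
    refine (index_lt _).le.trans (le_trans ?_ hV.size)
    rw [prod_low]
    exact Nat.le_mul_of_pos_left _ (last_pos n)
  · intro f hf _
    rw [h.size] at hf
    exact hQ f hf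

/-- For every translation, the twist of the words that it fixes. -/
def twistStmt : Stmt := row 11 (const 0) 20 8 (get 9 (least 22 23 6
  (eq (get 9 (var 23) (var 20) / var 7) (get 10 (const 0) (var 20) % var 6))) (var 20) % var 7)

theorem twist_post (h : Ctx n L R σ) (hV : Big q n V) (hM : MulTable n (σ.A 9))
    (hm : ∀ t < ∏ i, n i, σ.A 10 0 t = n (Fin.last d) / ordOf n t)
    (hQ : ∀ f, (∀ t < ∏ i, n i, f 0 t = index (coefOf n t • lowPos (posOf n t))) →
      Q (σ.setA 11 f)) : twistStmt.Post V σ Q := by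
  refine Post.row (r := 0) (fun t => index (coefOf n t • lowPos (posOf n t))) (fun _ _ _ => rfl)
    ?_ ?_ ?_
  · intro f _ t ht
    rw [h.size] at ht
    have h1 := fixAt n t
    simp only [rules, reduceIte, Nat.reduceEqDiff]
    rw [eval_least (P := fun j => ((j • posOf n t) (Fin.last d) : ℕ) =
      n (Fin.last d) / ordOf n t % n (Fin.last d)) (k := coefOf n t) (by decide) (by decide)]
    · rw [h.inv.size, hM _ h1.lt.le t ht, index_mod]
      rfl
    · intro i j hj
      simp only [rules, reduceIte, Nat.reduceEqDiff, h.last] at hj ⊢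
      rw [hM _ hj.le _ ht, h.inv.size, hm t ht, index_div]
    · simp only [rules, reduceIte, Nat.reduceEqDiff, h.last]
      exact h1.lt
    · exact h1.eq
    · exact h1.first
  · intro t ht
    refine (index_lt _).le.trans (le_trans ?_ hV.size)
    rw [prod_low]
    exact Nat.le_mul_of_pos_left _ (last_pos n)
  · intro f hf _
    rw [h.size] at hf
    exact hQ f hf

/-- The powers of the numbers of fixed slices. -/
def fixPowStmt : Stmt := .seq (row 13 (const 0) 21 8 (const 1))
  (recur 13 20 6 21 8 (get 13 (var 20) (var 21) * get 2 (const 0) (get 12 (const 0) (var 21))))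

/-- The numbers of fixed words. -/
def fixStmt : Stmt := .seq fixPowStmt
  (row 14 (const 0) 20 8 (get 13 (get 10 (const 0) (var 20)) (var 20)))

/-- The exponent depends on the translation, so one recursion computes the powers with all exponents
up to the last size, and the right one is then selected. -/
theorem fix_post (h : Ctx n L R σ) (hV : Big q n V) (hq : 0 < q)
    (hm : ∀ t < ∏ i, n i, σ.A 10 0 t = n (Fin.last d) / ordOf n t)
    (hg : ∀ t < ∏ i, n i, σ.A 12 0 t = index (ordOf n t • lowPos (posOf n t)))
    (hQ : ∀ f f', (∀ t < ∏ i, n i, f' 0 t = fixCount q n (posOf n t)) →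
      Q ((σ.setA 13 f).setA 14 f')) : fixStmt.Post V σ Q := by
  have hpow : ∀ i ≤ n (Fin.last d), ∀ g : Pos (low n), fixCount q (low n) g ^ i ≤ V := by
    intro i hi g
    refine le_trans ?_ hV.count
    rw [prod_low, mul_comm, pow_mul]
    exact (Nat.pow_le_pow_left (fixCount_le (low n) g) i).trans
      (Nat.pow_le_pow_right (Nat.pow_pos hq) hi)
  refine Post.seq (Post.seq (Post.row (r := 0) (fun _ => 1) (fun _ _ _ => rfl)
    (fun _ _ _ _ => rfl) (fun _ _ => hV.one) fun f₀ hf₀ _ => ?_))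
  refine Post.recur (by decide) (by decide)
    (fun i t => fixCount q (low n) (ordOf n t • lowPos (posOf n t)) ^ i) ?_ ?_ ?_ ?_
  · intro j hj
    rw [Store.setA_A_same, hf₀ j hj, pow_zero]
  · intro f i hi hf j hj
    simp only [rules, reduceIte, Nat.reduceEqDiff] at hf hj ⊢
    rw [hf j hj]
    rw [h.size] at hj
    rw [hg j hj, h.inv.tot _ (index_lt _), posOf_index, pow_succ]
  · intro i hi j hj
    simp only [Store.setA_r, h.last] at hi
    exact hpow i hi _
  · intro f hf
    rw [Store.setA_setA]
    simp only [Store.setA_r, h.last, h.size] at hf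
    refine Post.row (r := 0) (fun t => fixCount q n (posOf n t)) (fun _ _ _ => rfl) ?_ ?_ ?_
    · intro f' _ t ht
      simp only [rules, reduceIte, Nat.reduceEqDiff] at ht ⊢
      rw [h.size] at ht
      rw [hm t ht, hf _ (Nat.div_le_self _ _) t ht, fixCount_succ (fixAt n t).data]
    · intro t ht
      exact (fixCount_le n _).trans hV.count
    · intro f' hf' _
      simp only [Store.setA_r, h.size] at hf'
      exact hQ f f' hf'

/-! ### The program for one block -/

/-- The codes of the translates of the block. -/
def codeStmt : Stmt := row 6 (const 0) 20 8 (sum 24 6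
  (get 0 (var 10 * var 6 + (var 24 + var 20 / var 7) % var 6) (var 20 % var 7) *
    get 5 (var 6 - const 1 - var 24) (const 0)))

variable {b : ℕ}

theorem block_lt {b R l m : ℕ} (hb : b < R) (hm : 0 < m) : b * m + l % m < R * m := by
  have := Nat.mod_lt l hm
  have h2 : (b + 1) * m ≤ R * m := Nat.mul_le_mul_right _ hb
  rw [add_mul, one_mul] at h2
  omega

theorem code_post (h : Ctx n L R σ) (hV : Big q n V) (hb : b < R) (hb' : σ.r 10 = b)
    (hp : ∀ i ≤ n (Fin.last d), σ.A 5 i 0 = (bnd q (low n) * ∏ i, low n i) ^ i)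
    (hQ : ∀ f, (∀ t < ∏ i, n i, f 0 t = code n (posOf n t +ᵥ block n L b)) → Q (σ.setA 6 f)) :
    codeStmt.Post V σ Q := by
  refine Post.row (r := 0) (fun t => code n (posOf n t +ᵥ block n L b)) (fun _ _ _ => rfl) ?_ ?_ ?_
  · intro f _ t ht
    rw [h.size] at ht
    simp only [rules, reduceIte, Nat.reduceEqDiff]
    rw [code_succ, lexCode, h.last, hb', h.inv.size]
    refine Finset.sum_congr rfl fun i hi => ?_
    rw [h.inv.K _ (block_lt hb (last_pos n)) _ (Nat.mod_lt _ (numbering (low n)).pos),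
      hp _ (by omega), slices_vadd_block ht]
  · intro t ht
    exact (code_lt n _).le.trans ((Nat.le_mul_of_pos_right _ (numbering n).pos).trans hV.code)
  · intro f hf _
    rw [h.size] at hf
    exact hQ f hf

/-- The index of the translation to the smallest translate of the block. -/
def minStmt : Stmt := .store 7 (const 0) (const 0)
  (least 22 23 8 (all 21 8 (le (get 6 (const 0) (var 23)) (get 6 (const 0) (var 21)))))

theorem min_post (h : Ctx n L R σ) (hV : Big q n V)
    (hw : ∀ t < ∏ i, n i, σ.A 6 0 t = code n (posOf n t +ᵥ block n L b))
    (hQ : ∀ f, f 0 0 < ∏ i, n i → code n (posOf n (f 0 0) +ᵥ block n L b) = cls n (block n L b) →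
      Q (σ.setA 7 f)) : minStmt.Post V σ Q := by
  obtain ⟨t, h1, h2, h3, h4⟩ := exists_min (block n L b)
  have e : (least 22 23 8 (all 21 8 (le (get 6 (const 0) (var 23))
      (get 6 (const 0) (var 21))))).eval σ = t := by
    refine eval_least (P := fun t => ∀ t' < ∏ i, n i, code n (posOf n t +ᵥ block n L b) ≤
      code n (posOf n t' +ᵥ block n L b)) (by decide) (by decide) ?_ (by rwa [h.size]) h2 h3
    intro i j hj
    rw [h.size] at hj
    simp only [rules, reduceIte, Nat.reduceEqDiff, h.size]
    refine forall_congr' fun t' => imp_congr_right fun ht' => ?_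
    rw [hw j hj, hw t' ht']
  refine ⟨?_, ?_⟩
  · change Expr.eval _ σ ≤ V
    rw [e]; exact h1.le.trans hV.size
  · have e1 : upd (σ.A 7) 0 0 t 0 0 = t := by simp [upd]
    refine hQ (upd (σ.A 7) 0 0 (Expr.eval _ σ)) ?_ ?_
    · rw [e, e1]; exact h1
    · rw [e, e1]; exact h4

/-- The codes of the translates of the block as a slice. -/
def kapStmt : Stmt := row 8 (var 10) 20 8 (get 6 (const 0) (get 7 (const 0) (const 0)) * var 8 +
  least 22 23 8 (eq (get 6 (const 0) (get 4 (var 20) (get 4 (const 0) (var 23))))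
    (get 6 (const 0) (get 7 (const 0) (const 0)))))

/-- All translates of the block have the same class, namely the smallest code, already located by
the array 7; only the shift has to be searched for each translate. -/
theorem kap_post (h : Ctx n L R σ) (hV : Big q n V) (hb' : σ.r 10 = b)
    (hw : ∀ t < ∏ i, n i, σ.A 6 0 t = code n (posOf n t +ᵥ block n L b))
    (hS : Auto.SubTable index (posOf n) (∏ i, n i) (σ.A 4))
    (h7 : σ.A 7 0 0 < ∏ i, n i)
    (h7' : code n (posOf n (σ.A 7 0 0) +ᵥ block n L b) = cls n (block n L b))
    (hQ : ∀ f, (∀ t < ∏ i, n i, f b t = kap n (posOf n t +ᵥ block n L b)) →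
      (∀ b' ≠ b, f b' = σ.A 8 b') → Q (σ.setA 8 f)) : kapStmt.Post V σ Q := by
  refine Post.row (r := b) (fun t => kap n (posOf n t +ᵥ block n L b)) (fun _ _ _ => ?_) ?_ ?_ ?_
  · simp only [rules, reduceIte, Nat.reduceEqDiff]
    exact hb'
  · intro f _ t ht
    rw [h.size] at ht
    obtain ⟨k, h1, h2, h3, h4⟩ := shift_spec (posOf n t +ᵥ block n L b)
    have hc : cls n (posOf n t +ᵥ block n L b) = cls n (block n L b) := clsOf_vadd _ _
    simp only [rules, reduceIte, Nat.reduceEqDiff]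
    rw [eval_least (P := fun j => code n (posOf n j +ᵥ (posOf n t +ᵥ block n L b)) =
      cls n (posOf n t +ᵥ block n L b)) (k := k) (by decide) (by decide)]
    · rw [h4, hw _ h7, h7', hc, h.size]
    · intro i j hj
      simp only [rules, reduceIte, Nat.reduceEqDiff, h.size] at hj ⊢
      rw [Auto.SubTable.add (numbering n) hS ht hj, hw _ (index_lt _), hw _ h7, h7', hc, posOf_index,
        add_comm (posOf n t), add_vadd]
    · simp only [rules, reduceIte, Nat.reduceEqDiff, h.size]
      exact h1
    · exact h2
    · exact h3
  · intro t ht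
    exact (kap_lt n _).le.trans hV.code
  · intro f hf hf'
    rw [h.size] at hf
    exact hQ f hf hf'

end Level

/-! ### The automaton of one block: letters, suffixes, transitions -/

section Level

variable {q d : ℕ} {n : Fin (d + 1) → ℕ} [∀ i, NeZero (n i)] {L : ℕ → Fin q} {R V : ℕ}
  {σ : Store} {Q : Store → Prop} {b : ℕ}

/-- The slice of the smallest translate with the number in `x` (times the number of elements). -/
def sliceExpr (x : ℕ) : Expr :=
  var 10 * var 6 + (var x / var 7 + get 7 (const 0) (const 0) / var 7) % var 6

/-- The letters of the automaton. -/
def letterStmt : Stmt := row 15 (const 0) 20 8 (get 0 (sliceExpr 20)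
  (get 3 (var 20 % var 7) (get 3 (const 0) (get 7 (const 0) (const 0) % var 7))))

theorem low_mul_last (n : Fin (d + 1) → ℕ) : (∏ i, low n i) * n (Fin.last d) = ∏ i, n i := by
  rw [prod_low, mul_comm]

/-- The automaton belongs to the smallest translate, so the table of weights is read at slices
rotated, and at translations shifted, by the two parts of its index `ts`. -/
theorem letter_post (h : Ctx n L R σ) (hV : Big q n V) (hb : b < R) (hb' : σ.r 10 = b) {ts : ℕ}
    (h7 : σ.A 7 0 0 = ts) (hts : ts < ∏ i, n i)
    (hQ : ∀ f, Auto.LetterTable (kap (low n)) (slices (posOf n ts +ᵥ block n L b)) (posOf (low n))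
      (∏ i, low n i) (n (Fin.last d)) (f 0) → Q (σ.setA 15 f)) : letterStmt.Post V σ Q := by
  have h0 := (numbering (low n)).pos
  refine Post.row (r := 0) (fun p => kap (low n) (posOf (low n) (p % ∏ i, low n i) +ᵥ
    slices (posOf n ts +ᵥ block n L b) (p / ∏ i, low n i))) (fun _ _ _ => rfl) ?_ ?_ ?_
  · intro f _ p hp
    simp only [sliceExpr, rules, reduceIte, Nat.reduceEqDiff]
    rw [hb', h7, h.last, h.inv.size,
      Auto.SubTable.add (numbering (low n)) h.inv.sub (Nat.mod_lt _ h0) (Nat.mod_lt _ h0),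
      h.inv.K _ (block_lt hb (last_pos n)) _ (index_lt _), posOf_index, slices_vadd_block hts,
      add_vadd]
  · intro p hp
    refine (kap_lt (low n) _).le.trans (le_trans ?_
      ((Nat.le_mul_of_pos_right _ (numbering n).pos).trans hV.code))
    exact Nat.le_self_pow (last_pos n).ne' _
  · intro f hf _
    rw [h.size, ← low_mul_last] at hf
    exact hQ f hf

/-- The suffixes among the states. -/
def suffixStmt : Stmt := tab 16 20 8 21 8 (cond (and (le (var 21 / var 7) (var 20 / var 7))
  (all 24 6 (imp (lt (var 24) (var 21 / var 7))
    (eq (get 15 (const 0) (var 24 * var 7 + var 21 % var 7)) (get 15 (const 0)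
      ((var 20 / var 7 - var 21 / var 7 + var 24) * var 7 + var 20 % var 7)))))) (const 1))

theorem suffix_post (h : Ctx n L R σ) (hV : Big q n V)
    (hQ : ∀ f, (∀ p < ∏ i, n i, ∀ y < ∏ i, n i,
      (f p y ≠ 0 ↔ Auto.SufP (σ.A 15 0) (∏ i, low n i) p y)) → Q (σ.setA 16 f)) :
    suffixStmt.Post V σ Q := by
  classical
  refine Post.tab (by decide) (by decide) (fun p y =>
    if Auto.SufP (σ.A 15 0) (∏ i, low n i) p y then 1 else 0) ?_ ?_ ?_
  · intro f p hp y hy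
    rw [h.size, ← low_mul_last] at hp hy
    simp only [rules, reduceIte, Nat.reduceEqDiff]
    refine if_congr ?_ rfl rfl
    rw [h.inv.size, h.last]
    refine and_congr_right fun hle => forall_congr' fun i => ?_
    have := Auto.div_lt_of_lt hy
    -- The search ranges over all indices below the last size; the guard in the expression cuts this
    -- down to the length of the shorter prefix.
    exact ⟨fun hi hi' => hi (by omega) hi', fun hi _ hi' => hi hi'⟩
  · intro p _ y _
    have := hV.one
    split_ifs <;> omega
  · intro f hf
    rw [h.size] at hf
    refine hQ f fun p hp y hy => ?_
    rw [hf p hp y hy]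
    simp

/-- The numbers that denote their state first. -/
def firstStmt : Stmt := row 17 (const 0) 20 8 (cond (all 21 8 (imp (lt (var 21) (var 20))
  (neg (and (eq (var 21 / var 7) (var 20 / var 7)) (get 16 (var 20) (var 21)))))) (const 1))

theorem first_post (h : Ctx n L R σ) (hV : Big q n V)
    (h16 : ∀ p < ∏ i, n i, ∀ y < ∏ i, n i,
      (σ.A 16 p y ≠ 0 ↔ Auto.SufP (σ.A 15 0) (∏ i, low n i) p y))
    (hQ : ∀ f, (∀ p < ∏ i, n i, (f 0 p ≠ 0 ↔ Auto.FirstP (σ.A 15 0) (∏ i, low n i) p)) →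
      Q (σ.setA 17 f)) : firstStmt.Post V σ Q := by
  classical
  refine Post.row (r := 0) (fun p => if Auto.FirstP (σ.A 15 0) (∏ i, low n i) p then 1 else 0)
    (fun _ _ _ => rfl) ?_ ?_ ?_
  · intro f _ p hp
    rw [h.size] at hp
    simp only [rules, reduceIte, Nat.reduceEqDiff]
    refine if_congr ?_ rfl rfl
    rw [h.inv.size, h.size]
    refine forall_congr' fun y => ⟨fun hy hyp => ?_, fun hy hyN hyp => ?_⟩
    · rw [← h16 p hp y (by omega)]
      exact hy (by omega) hyp
    · rw [h16 p hp y hyN]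
      exact hy hyp
  · intro p _
    have := hV.one
    split_ifs <;> omega
  · intro f hf _
    rw [h.size] at hf
    refine hQ f fun p hp => ?_
    rw [hf p hp]
    simp

/-- The tables that describe the automaton of the block `b`. -/
structure AutoTables {q d : ℕ} (n : Fin (d + 1) → ℕ) [∀ i, NeZero (n i)] (L : ℕ → Fin q) (b ts : ℕ)
    (σ : Store) : Prop where
  lt : ts < ∏ i, n i
  min : code n (posOf n ts +ᵥ block n L b) = cls n (block n L b)
  shift : σ.A 7 0 0 = ts
  letter : Auto.LetterTable (kap (low n)) (slices (posOf n ts +ᵥ block n L b)) (posOf (low n))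
      (∏ i, low n i) (n (Fin.last d)) (σ.A 15 0)
  suffix : ∀ p < ∏ i, n i, ∀ y < ∏ i, n i,
      (σ.A 16 p y ≠ 0 ↔ Auto.SufP (σ.A 15 0) (∏ i, low n i) p y)
  first : ∀ p < ∏ i, n i, (σ.A 17 0 p ≠ 0 ↔ Auto.FirstP (σ.A 15 0) (∏ i, low n i) p)

/-- The entry of the table of letters in the slice of the state in `20`. -/
def letterExpr (e : Expr) : Expr := get 15 (const 0) (var 20 / var 7 * var 7 + e)

/-- The state in `x` is a suffix of the state in `20` and the letter in `22`. -/
def snocExpr (x : ℕ) : Expr := or (lt (var x) (var 7)) (and (get 16 (var 20) (var x - var 7))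
  (eq (get 15 (const 0) (var x - var 7)) (letterExpr (var 22))))

/-- The letter in `22` may follow the state in `20`. -/
def goodExpr : Expr := all 23 8 (imp (get 16 (var 20) (var 23))
  (lt (get 15 (const 0) (var 23 / var 7 * var 7)) (letterExpr (get 3 (var 22) (var 23 % var 7)) +
    cond (lt (var 23 / var 7 + const 1) (var 6)) (const 1))))

/-- The translation in `x` fixes the letter in `22`, which is denoted by `22` first. -/
def fixedExpr : Expr := and (all 23 7 (imp (lt (var 23) (var 22))
    (neg (eq (letterExpr (var 23)) (letterExpr (var 22))))))
  (eq (letterExpr (get 3 (var 22) (get 3 (const 0) (get 12 (const 0) (var 11)))))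
    (letterExpr (var 22)))

/-- The transitions of the automaton. -/
def transStmt : Stmt := tab 18 20 8 21 8 (cond (get 17 (const 0) (var 21))
  (cond (lt (var 21) (var 7)) (get 1 (sliceExpr 20) (get 12 (const 0) (var 11))) +
    sum 22 7 (cond (and fixedExpr (and goodExpr (and (snocExpr 21)
      (all 23 8 (imp (snocExpr 23) (le (var 23 / var 7) (var 21 / var 7))))))) (const 1))))

/-- The letters of the smallest translate of the block `b`. -/
abbrev minLetters {q d : ℕ} (n : Fin (d + 1) → ℕ) [∀ i, NeZero (n i)] (L : ℕ → Fin q) (b ts : ℕ) :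
    ℕ → Word q (low n) := slices (posOf n ts +ᵥ block n L b)

/-- The translation that fixes the slices of the words fixed by the translation `t`. -/
noncomputable abbrev stabOf {d : ℕ} (n : Fin (d + 1) → ℕ) [∀ i, NeZero (n i)] (t : ℕ) :
    Pos (low n) := ordOf n t • lowPos (posOf n t)

/-- The state with the number `p`. -/
noncomputable abbrev stateOf {q d : ℕ} (n : Fin (d + 1) → ℕ) [∀ i, NeZero (n i)] (L : ℕ → Fin q)
    (b ts p : ℕ) : List (Word q (low n)) :=
  Auto.st (posOf (low n)) (∏ i, low n i) (minLetters n L b ts) p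

/-- The transitions of the automaton between numbered states. -/
noncomputable abbrev transOf {q d : ℕ} (n : Fin (d + 1) → ℕ) [∀ i, NeZero (n i)] (L : ℕ → Fin q)
    (b ts t p y : ℕ) : ℕ :=
  Auto.trans (Pos (low n)) (kap (low n)) (minLetters n L b ts) (n (Fin.last d))
    {x | stabOf n t +ᵥ x = x} (stateOf n L b ts p) (stateOf n L b ts y)

/-- The walks of the automaton between numbered states. -/
noncomputable abbrev walksOf {q d : ℕ} (n : Fin (d + 1) → ℕ) [∀ i, NeZero (n i)] (L : ℕ → Fin q)
    (b ts t i p y : ℕ) : ℕ :=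
  Auto.walks (Pos (low n)) (kap (low n)) (minLetters n L b ts) (n (Fin.last d))
    {x | stabOf n t +ᵥ x = x} i (stateOf n L b ts p) (stateOf n L b ts y)

/-- Targets that are not the first number of their state get the entry `0`, so that a plain sum over
numbers in the recursion for walks meets every state once. -/
theorem trans_post (h : Ctx n L R σ) (hV : Big q n V) (hq : 0 < q) (hb : b < R) (hb' : σ.r 10 = b)
    {ts t : ℕ} (hA : AutoTables n L b ts σ) (ht' : σ.r 11 = t)
    (hg : σ.A 12 0 t = index (stabOf n t))
    (hQ : ∀ f, (∀ p < ∏ i, n i, ∀ y < ∏ i, n i, f p y =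
      if σ.A 17 0 y ≠ 0 then transOf n L b ts t p y else 0) →
      Q (σ.setA 18 f)) : transStmt.Post V σ Q := by
  classical
  have h0 := (numbering (low n)).pos
  refine Post.tab (by decide) (by decide) (fun p y => if σ.A 17 0 y ≠ 0 then
    transOf n L b ts t p y else 0) ?_ ?_ ?_
  · intro f p hp y hy
    rw [h.size] at hp hy
    have hp' := hp
    have hy' := hy
    rw [← low_mul_last] at hp' hy'
    have hmin : Auto.Minimal (Pos (low n)) (kap (low n)) (minLetters n L b ts) (n (Fin.last d)) :=
      minimal_slices (minimal_of_eq_cls hA.min)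
    have htr : transOf n L b ts t p y = _ := Auto.trans_st (numbering (low n)) h.inv.sub hA.letter
      (orbitOrder_kap (low n)) hmin hp' hy'
    simp only [sliceExpr, fixedExpr, goodExpr, snocExpr, letterExpr, rules, reduceIte,
      Nat.reduceEqDiff, ne_eq]
    rw [h.inv.size, h.last, h.size, hb', ht', hg, hA.shift, htr]
    refine if_congr Iff.rfl (congrArg₂ (· + ·) ?_ ?_) rfl
    · refine if_congr Iff.rfl ?_ rfl
      -- The slice of the smallest translate is a translate of a block, and `bigCount` depends only
      -- on the orbit; so the table for untranslated blocks suffices.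
      rw [h.inv.A _ (block_lt hb (last_pos n)) _ (index_lt _), posOf_index, slices_vadd_block hA.lt,
        ← bigCount_vadd _ (posOf (low n) (ts % ∏ i, low n i))]
      unfold bigCount
      refine Finset.sum_congr rfl fun a _ => ?_
      congr!
    · unfold Auto.orbitTrans
      refine Finset.sum_congr rfl fun r hr => if_congr ?_ rfl rfl
      rw [Finset.mem_range] at hr
      rw [and_assoc]
      refine and_congr ?_ (and_congr Iff.rfl (and_congr ?_ ?_))
      · exact forall_congr' fun r' => ⟨fun H hr' => H (by omega) hr', fun H _ hr' => H hr'⟩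
      · unfold Auto.GoodP
        rw [low_mul_last]
        refine forall_congr' fun z => imp_congr_right fun hz => ?_
        rw [← hA.suffix p hp z hz]
      · have key : ∀ z < ∏ i, n i, (z < ∏ i, low n i ∨ ¬σ.A 16 p (z - ∏ i, low n i) = 0 ∧
            σ.A 15 0 (z - ∏ i, low n i) = σ.A 15 0 ((p / ∏ i, low n i) * (∏ i, low n i) + r)) ↔
            Auto.SnocP (σ.A 15 0) (∏ i, low n i) p ((p / ∏ i, low n i) * (∏ i, low n i) + r) z := by
          intro z hz
          unfold Auto.SnocP
          rw [← hA.suffix p hp _ (lt_of_le_of_lt (Nat.sub_le _ _) hz)]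
        unfold Auto.LongestP
        rw [low_mul_last]
        refine and_congr (key y hy) (forall_congr' fun z => imp_congr_right fun hz => ?_)
        rw [key z hz]
  · intro p _ y _
    split_ifs
    · refine le_trans ?_ hV.count
      have h1 : transOf n L b ts t p y ≤
          Fintype.card (Word q (low n)) := by
        rw [Fintype.card_eq_sum_ones]
        exact Finset.sum_le_sum fun u _ => by split_ifs <;> omega
      rw [card_word] at h1
      refine h1.trans (Nat.pow_le_pow_right hq ?_)
      rw [prod_low]
      exact Nat.le_mul_of_pos_left _ (last_pos n)
    · exact Nat.zero_le _
  · intro f hf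
    rw [h.size] at hf
    exact hQ f fun p hp y hy => by rw [hf p hp y hy]

end Level

/-- The states agree except for the variables in `X` and the arrays in `Y`. -/
structure Agree (X Y : List ℕ) (σ σ' : Store) : Prop where
  r : ∀ x ∉ X, σ'.r x = σ.r x
  A : ∀ a ∉ Y, σ'.A a = σ.A a

namespace Agree

variable {X Y : List ℕ} {σ σ' σ'' : Store}

theorem refl (X Y : List ℕ) (σ : Store) : Agree X Y σ σ := ⟨fun _ _ => rfl, fun _ _ => rfl⟩

theorem trans (h : Agree X Y σ σ') (h' : Agree X Y σ' σ'') : Agree X Y σ σ'' :=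
  ⟨fun x hx => (h'.r x hx).trans (h.r x hx), fun a ha => (h'.A a ha).trans (h.A a ha)⟩

theorem mono {X' Y' : List ℕ} (h : Agree X Y σ σ') (hX : X ⊆ X') (hY : Y ⊆ Y') :
    Agree X' Y' σ σ' :=
  ⟨fun x hx => h.r x fun h' => hx (hX h'), fun a ha => h.A a fun h' => ha (hY h')⟩

theorem setA {a : ℕ} (h : Agree X Y σ σ') (ha : a ∈ Y) (f : ℕ → ℕ → ℕ) :
    Agree X Y σ (σ'.setA a f) :=
  ⟨h.r, fun b hb => (Store.setA_A_ne _ _ (by rintro rfl; exact hb ha)).trans (h.A b hb)⟩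

theorem setR {x : ℕ} (h : Agree X Y σ σ') (hx : x ∈ X) (u : ℕ) : Agree X Y σ (σ'.setR x u) :=
  ⟨fun y hy => (Store.setR_r_ne _ _ (by rintro rfl; exact hy hx)).trans (h.r y hy), h.A⟩

/-- At the end of a loop, the loop variable has its old value. -/
theorem restore {x : ℕ} (h : Agree (x :: X) Y σ σ') : Agree X Y σ (σ'.setR x (σ.r x)) := by
  refine ⟨fun y hy => ?_, h.A⟩
  by_cases e : y = x
  · rw [e, Store.setR_r_same]
  · rw [Store.setR_r_ne _ _ e, h.r y (by simp [e, hy])]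

end Agree

/-! ### Walks, and the counts for all translations and blocks -/

section Level

variable {q d : ℕ} {n : Fin (d + 1) → ℕ} [∀ i, NeZero (n i)] {L : ℕ → Fin q} {R V : ℕ}
  {σ σ' : Store} {Q : Store → Prop} {b : ℕ}

theorem Ctx.agree {X Y : List ℕ} (h : Ctx n L R σ) (hσ : Agree X Y σ σ')
    (hX : ∀ x ∈ [2, 6, 7, 8, 9, 12, 13, 14], x ∉ X) (hY : ∀ a ∈ [0, 1, 2, 3], a ∉ Y) :
    Ctx n L R σ' := by
  have h0 := hσ.A 0 (hY 0 (by decide))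
  have h1 := hσ.A 1 (hY 1 (by decide))
  have h2 := hσ.A 2 (hY 2 (by decide))
  have h3 := hσ.A 3 (hY 3 (by decide))
  refine ⟨⟨?_, ?_, ?_, ?_, ?_, ?_, ?_, ?_⟩, ?_, ?_, ?_, ?_⟩
  · rw [h0]; exact h.inv.K
  · rw [h1]; exact h.inv.A
  · rw [h2]; exact h.inv.tot
  · rw [h3]; exact h.inv.sub
  · rw [hσ.r 12 (hX 12 (by decide))]; exact h.inv.base
  · rw [hσ.r 7 (hX 7 (by decide))]; exact h.inv.size
  · rw [hσ.r 2 (hX 2 (by decide))]; exact h.inv.total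
  · rw [hσ.r 14 (hX 14 (by decide))]; exact h.inv.one
  · rw [hσ.r 6 (hX 6 (by decide))]; exact h.last
  · rw [hσ.r 8 (hX 8 (by decide))]; exact h.size
  · rw [hσ.r 9 (hX 9 (by decide))]; exact h.blocks
  · rw [hσ.r 13 (hX 13 (by decide))]; exact h.square

theorem AutoTables.agree {X Y : List ℕ} {ts : ℕ} (h : AutoTables n L b ts σ)
    (hσ : Agree X Y σ σ') (hY : ∀ a ∈ [7, 15, 16, 17], a ∉ Y) : AutoTables n L b ts σ' := by
  have h0 := hσ.A 7 (hY 7 (by decide))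
  have h1 := hσ.A 15 (hY 15 (by decide))
  have h2 := hσ.A 16 (hY 16 (by decide))
  have h3 := hσ.A 17 (hY 17 (by decide))
  refine ⟨h.lt, h.min, ?_, ?_, ?_, ?_⟩
  · rw [h0]; exact h.shift
  · rw [h1]; exact h.letter
  · rw [h1, h2]; exact h.suffix
  · rw [h1, h3]; exact h.first

/-- The tables that do not depend on the block. -/
structure Tables {d : ℕ} (q : ℕ) (n : Fin (d + 1) → ℕ) [∀ i, NeZero (n i)] (σ : Store) : Prop where
  sub : Auto.SubTable index (posOf n) (∏ i, n i) (σ.A 4)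
  pow : ∀ i ≤ n (Fin.last d), σ.A 5 i 0 = (bnd q (low n) * ∏ i, low n i) ^ i
  free : ∀ t < ∏ i, n i, σ.A 10 0 t = n (Fin.last d) / ordOf n t
  stab : ∀ t < ∏ i, n i, σ.A 12 0 t = index (stabOf n t)
  twist : ∀ t < ∏ i, n i, σ.A 11 0 t = index (coefOf n t • lowPos (posOf n t))

theorem Tables.agree {X Y : List ℕ} (h : Tables q n σ) (hσ : Agree X Y σ σ')
    (hY : ∀ a ∈ [4, 5, 10, 11, 12], a ∉ Y) : Tables q n σ' := by
  refine ⟨?_, ?_, ?_, ?_, ?_⟩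
  · rw [hσ.A 4 (hY 4 (by decide))]; exact h.sub
  · rw [hσ.A 5 (hY 5 (by decide))]; exact h.pow
  · rw [hσ.A 10 (hY 10 (by decide))]; exact h.free
  · rw [hσ.A 12 (hY 12 (by decide))]; exact h.stab
  · rw [hσ.A 11 (hY 11 (by decide))]; exact h.twist

/-- The walks of the automaton, by recursion on the length. -/
def walkStmt : Stmt := .seq (row 19 (const 0) 20 13 (cond (and
    (eq (var 20 % var 8 / var 7) (var 20 / var 8 / var 7))
    (get 16 (var 20 / var 8) (var 20 % var 8))) (const 1)))
  (recur 19 24 6 20 13 (sum 22 8 (get 18 (var 20 / var 8) (var 22) *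
    get 19 (var 24) (var 22 * var 8 + var 20 % var 8))))

/-- An array has two indices and the first is used for the length, so the pair `(p, y)` of states is
stored in the column `p * N + y`, with `N` the product of the sizes treated. This is why the row is
as long as the variable 13. -/
theorem walk_post (h : Ctx n L R σ) (hV : Big q n V) (hq : 0 < q) {ts t : ℕ}
    (hA : AutoTables n L b ts σ)
    (hT : ∀ p < ∏ i, n i, ∀ y < ∏ i, n i, σ.A 18 p y =
      if σ.A 17 0 y ≠ 0 then transOf n L b ts t p y else 0)
    (hQ : ∀ f, (∀ i ≤ n (Fin.last d), ∀ p < ∏ i, n i, ∀ y < ∏ i, n i,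
      f i (p * (∏ i, n i) + y) = walksOf n L b ts t i p y) → Q (σ.setA 19 f)) :
    walkStmt.Post V σ Q := by
  classical
  have h0 := (numbering (low n)).pos
  have hpos := (numbering n).pos
  have hV' : ∀ i ≤ n (Fin.last d), ∀ p y, walksOf n L b ts t i p y ≤ V := fun i hi p y =>
    (walks_le hi hq _ _).trans hV.count
  refine Post.seq (Post.row (r := 0) (fun k => walksOf n L b ts t 0 (k / ∏ i, n i) (k % ∏ i, n i))
    (fun _ _ _ => rfl) ?_ (fun k _ => hV' 0 (Nat.zero_le _) _ _) fun f₀ hf₀ _ => ?_)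
  · intro f _ k hk
    rw [h.square] at hk
    have h1 : k / (∏ i, n i) < ∏ i, n i := Nat.div_lt_of_lt_mul hk
    have h2 := Nat.mod_lt k hpos
    rw [walksOf, stateOf, stateOf, Auto.walks_st_zero hA.letter (orbitOrder_kap (low n)).inj h0
      (by rw [low_mul_last]; exact h1)]
    simp only [rules, reduceIte, Nat.reduceEqDiff]
    rw [h.size, h.inv.size]
    refine if_congr (and_congr_right fun _ => ?_) rfl rfl
    exact hA.suffix _ h1 _ h2
  refine Post.recur (by decide) (by decide)
    (fun i k => walksOf n L b ts t i (k / ∏ i, n i) (k % ∏ i, n i)) ?_ ?_ ?_ ?_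
  · intro j hj
    rw [Store.setA_A_same, hf₀ j hj]
  · intro f i hi hf k hk
    simp only [rules, reduceIte, Nat.reduceEqDiff, h.square, h.size] at hf hk ⊢
    have h1 : k / (∏ i, n i) < ∏ i, n i := Nat.div_lt_of_lt_mul hk
    have h2 := Nat.mod_lt k hpos
    rw [walksOf, Auto.walks_succ (last_pos n), Auto.sum_states (numbering (low n)) hA.letter
      (orbitOrder_kap (low n)).inj, low_mul_last]
    refine Finset.sum_congr rfl fun y hy => ?_
    rw [Finset.mem_range] at hy
    have h3 := Auto.mul_add_lt hy h2
    rw [hT _ h1 y hy, hf _ h3, Auto.mul_add_div' h2, Nat.mul_add_mod', Nat.mod_eq_of_lt h2]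
    by_cases hfirst : σ.A 17 0 y ≠ 0
    · rw [if_pos hfirst, if_pos ((hA.first y hy).mp hfirst)]
    · rw [if_neg hfirst, if_neg (mt (hA.first y hy).mpr hfirst), zero_mul]
  · intro i hi k _
    simp only [Store.setA_r, h.last] at hi
    exact hV' i hi _ _
  · intro f hf
    rw [Store.setA_setA]
    simp only [Store.setA_r, h.last, h.square] at hf
    refine hQ f fun i hi p hp y hy => ?_
    rw [hf i hi _ (Auto.mul_add_lt hp hy), Auto.mul_add_div' hy, Nat.mul_add_mod',
      Nat.mod_eq_of_lt hy]

/-- The number of words with a larger orbit than the block that are fixed by a translation. -/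
def closedStmt : Stmt := .store 20 (var 10) (var 11) (sum 22 8 (cond (get 17 (const 0) (var 22))
  (get 19 (get 10 (const 0) (var 11)) (var 22 * var 8 + (var 22 / var 7 * var 7 +
    get 3 (var 22 % var 7) (get 11 (const 0) (var 11)))))))

/-- The walk must end in the start translated by `-(coefOf n t • lowPos (posOf n t))`; in terms of
numbers this keeps the length and subtracts in the translation part. -/
theorem closed_post (h : Ctx n L R σ) (hV : Big q n V) (hT : Tables q n σ) (hb' : σ.r 10 = b)
    {ts t : ℕ} (hA : AutoTables n L b ts σ) (ht : t < ∏ i, n i) (ht' : σ.r 11 = t)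
    (hM : ∀ i ≤ n (Fin.last d), ∀ p < ∏ i, n i, ∀ y < ∏ i, n i,
      σ.A 19 i (p * (∏ i, n i) + y) = walksOf n L b ts t i p y)
    (hQ : Q (σ.setA 20 (upd (σ.A 20) b t (bigCount n (posOf n t) (block n L b))))) :
    closedStmt.Post V σ Q := by
  classical
  have h0 := (numbering (low n)).pos
  have key : (sum 22 8 (cond (get 17 (const 0) (var 22))
      (get 19 (get 10 (const 0) (var 11)) (var 22 * var 8 + (var 22 / var 7 * var 7 +
      get 3 (var 22 % var 7) (get 11 (const 0) (var 11))))))).eval σ =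
      bigCount n (posOf n t) (block n L b) := by
    rw [← bigCount_vadd (posOf n t) (posOf n ts) (block n L b),
      bigCount_succ (fixAt n t).data (minimal_of_eq_cls hA.min),
      Auto.sum_states (numbering (low n)) hA.letter (orbitOrder_kap (low n)).inj]
    simp only [rules, reduceIte, Nat.reduceEqDiff]
    rw [h.size, low_mul_last, ht', h.inv.size, hT.free t ht, hT.twist t ht]
    refine Finset.sum_congr rfl fun p hp => ?_
    rw [Finset.mem_range] at hp
    have hp' := hp
    rw [← low_mul_last] at hp'
    have h1 : σ.A 3 (p % ∏ i, low n i) (index (coefOf n t • lowPos (posOf n t))) <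
        ∏ i, low n i := by
      rw [h.inv.sub _ (Nat.mod_lt _ h0) _ (index_lt _)]; exact index_lt _
    have h2 := Auto.mul_add_lt (Auto.div_lt_of_lt hp') h1
    rw [low_mul_last] at h2
    refine if_congr (hA.first p hp) ?_ rfl
    rw [hM _ (Nat.div_le_self _ _) p hp _ h2, Auto.st_map (numbering (low n)) h.inv.sub]
  constructor
  · change Expr.eval _ σ ≤ V
    rw [key]
    exact (bigCount_le n _ _).trans hV.count
  · change Q (σ.setA 20 (upd (σ.A 20) (σ.r 10) (σ.r 11) (Expr.eval _ σ)))
    rwa [key, hb', ht']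

/-- The treatment of one translation for one block. -/
def countStmt : Stmt := .seq transStmt (.seq walkStmt closedStmt)

theorem count_post (h : Ctx n L R σ) (hV : Big q n V) (hq : 0 < q) (hT : Tables q n σ)
    (hb : b < R) (hb' : σ.r 10 = b) {ts t : ℕ} (hA : AutoTables n L b ts σ) (ht : t < ∏ i, n i)
    (ht' : σ.r 11 = t) : countStmt.Post V σ fun σ' => Agree [] [18, 19, 20] σ σ' ∧
      σ'.A 20 = upd (σ.A 20) b t (bigCount n (posOf n t) (block n L b)) := by
  refine Post.seq (trans_post h hV hq hb hb' hA ht' (hT.stab t ht) fun f hf => Post.seq ?_)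
  have a1 : Agree [] [18, 19, 20] σ (σ.setA 18 f) := (Agree.refl _ _ σ).setA (by decide) f
  refine walk_post (h.agree a1 (by decide) (by decide)) hV hq (hA.agree a1 (by decide))
    (t := t) ?_ fun f' hf' => ?_
  · intro p hp y hy
    rw [Store.setA_A_same, a1.A 17 (by decide)]
    exact hf p hp y hy
  have a2 := a1.setA (a := 19) (by decide) f'
  refine closed_post (h.agree a2 (by decide) (by decide)) hV (hT.agree a2 (by decide)) hb'
    (hA.agree a2 (by decide)) ht ht' ?_ ?_
  · rw [Store.setA_A_same]; exact hf'
  · refine ⟨a2.setA (by decide) _, ?_⟩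
    rw [Store.setA_A_same]
    rfl

/-- The treatment of one block. -/
def blockStmt : Stmt := .seq codeStmt (.seq minStmt (.seq kapStmt (.seq letterStmt
  (.seq suffixStmt (.seq firstStmt (.loop 11 8 countStmt))))))

theorem counts_post (h : Ctx n L R σ) (hV : Big q n V) (hq : 0 < q) (hT : Tables q n σ)
    (hb : b < R) (hb' : σ.r 10 = b) {ts : ℕ} (hA : AutoTables n L b ts σ) :
    (Stmt.loop 11 8 countStmt).Post V σ fun σ' => Agree [] [18, 19, 20] σ σ' ∧
      (∀ t < ∏ i, n i, σ'.A 20 b t = bigCount n (posOf n t) (block n L b)) ∧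
      ∀ b' ≠ b, σ'.A 20 b' = σ.A 20 b' := by
  refine Post.loop (fun k σ' => Agree [11] [18, 19, 20] σ σ' ∧
    (∀ t < k, σ'.A 20 b t = bigCount n (posOf n t) (block n L b)) ∧
      ∀ b' ≠ b, σ'.A 20 b' = σ.A 20 b') ⟨Agree.refl _ _ _, by simp, fun _ _ => rfl⟩ ?_ ?_
  · rintro t ht σ' ⟨a1, h1, h2⟩
    rw [h.size] at ht
    have a2 := a1.setR (x := 11) (by decide) t
    refine (count_post (h.agree a2 (by decide) (by decide)) hV hq (hT.agree a2 (by decide)) hb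
      ((a2.r 10 (by decide)).trans hb') (hA.agree a2 (by decide)) ht
      (Store.setR_r_same _ _ _)).mono fun σ'' h3 => ⟨a2.trans (h3.1.mono (by simp) (by simp)),
        fun s hs => ?_, fun b' hne => ?_⟩
    · rw [h3.2]
      unfold upd
      split_ifs with e
      · rw [e.2]
      · exact h1 s (by omega)
    · rw [h3.2, ← h2 b' hne]
      funext s
      simp [upd, hne]
  · rintro σ' ⟨a1, h1, h2⟩
    rw [h.size] at h1
    exact ⟨a1.restore, h1, h2⟩

/-- The arrays changed in the treatment of one block. -/
abbrev blockArrays : List ℕ := [6, 7, 8, 15, 16, 17, 18, 19, 20]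

theorem block_post (h : Ctx n L R σ) (hV : Big q n V) (hq : 0 < q) (hT : Tables q n σ)
    (hb : b < R) (hb' : σ.r 10 = b) :
    blockStmt.Post V σ fun σ' => Agree [] blockArrays σ σ' ∧
      (∀ t < ∏ i, n i, σ'.A 8 b t = kap n (posOf n t +ᵥ block n L b)) ∧
      (∀ t < ∏ i, n i, σ'.A 20 b t = bigCount n (posOf n t) (block n L b)) ∧
      ∀ b' ≠ b, σ'.A 8 b' = σ.A 8 b' ∧ σ'.A 20 b' = σ.A 20 b' := by
  refine Post.seq (code_post h hV hb hb' hT.pow fun f6 h6 => Post.seq ?_)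
  have a1 : Agree [] blockArrays σ (σ.setA 6 f6) := (Agree.refl _ _ σ).setA (by decide) f6
  refine min_post (h.agree a1 (by decide) (by decide)) hV (b := b) (by rwa [Store.setA_A_same])
    fun f7 h7 h7' => Post.seq ?_
  have a2 := a1.setA (a := 7) (by decide) f7
  have h2 := h.agree a2 (by decide) (by decide)
  have T2 := hT.agree a2 (by decide)
  refine kap_post h2 hV (b := b) hb' h6 T2.sub h7 h7' fun f8 h8 h8' => Post.seq ?_
  have a3 := a2.setA (a := 8) (by decide) f8
  refine letter_post (h.agree a3 (by decide) (by decide)) hV hb hb' (ts := f7 0 0) rfl h7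
    fun f15 h15 => Post.seq ?_
  have a4 := a3.setA (a := 15) (by decide) f15
  refine suffix_post (h.agree a4 (by decide) (by decide)) hV fun f16 h16 => Post.seq ?_
  have a5 := a4.setA (a := 16) (by decide) f16
  refine first_post (h.agree a5 (by decide) (by decide)) hV h16 fun f17 h17 => ?_
  have a6 := a5.setA (a := 17) (by decide) f17
  refine (counts_post (h.agree a6 (by decide) (by decide)) hV hq (hT.agree a6 (by decide)) hb hb'
    (ts := f7 0 0) ⟨h7, h7', rfl, h15, h16, h17⟩).mono fun σ' h' =>
      ⟨a6.trans (h'.1.mono (by simp) (by decide)), ?_, h'.2.1, fun b' hne => ⟨?_, ?_⟩⟩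
  · rw [h'.1.A 8 (by decide)]
    exact h8
  · rw [h'.1.A 8 (by decide)]
    exact h8' b' hne
  · rw [h'.2.2 b' hne]
    rfl

theorem blocks_post (h : Ctx n L R σ) (hV : Big q n V) (hq : 0 < q) (hT : Tables q n σ) :
    (Stmt.loop 10 9 blockStmt).Post V σ fun σ' => Agree [] blockArrays σ σ' ∧
      (∀ b < R, ∀ t < ∏ i, n i, σ'.A 8 b t = kap n (posOf n t +ᵥ block n L b)) ∧
      ∀ b < R, ∀ t < ∏ i, n i, σ'.A 20 b t = bigCount n (posOf n t) (block n L b) := by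
  refine Post.loop (fun k σ' => Agree [10] blockArrays σ σ' ∧
      (∀ b < k, ∀ t < ∏ i, n i, σ'.A 8 b t = kap n (posOf n t +ᵥ block n L b)) ∧
      ∀ b < k, ∀ t < ∏ i, n i, σ'.A 20 b t = bigCount n (posOf n t) (block n L b))
    ⟨Agree.refl _ _ _, by simp, by simp⟩ ?_ ?_
  · rintro b hb σ' ⟨a1, h1, h2⟩
    rw [h.blocks] at hb
    have a2 := a1.setR (x := 10) (by decide) b
    refine (block_post (h.agree a2 (by decide) (by decide)) hV hq (hT.agree a2 (by decide)) hb
      (Store.setR_r_same _ _ _)).mono fun σ'' h3 => ⟨a2.trans (h3.1.mono (by simp) (by simp)),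
        fun b' hb' t ht => ?_, fun b' hb' t ht => ?_⟩
    · rcases Nat.lt_succ_iff_lt_or_eq.mp hb' with h' | rfl
      · rw [(h3.2.2.2 b' h'.ne).1]; exact h1 b' h' t ht
      · exact h3.2.1 t ht
    · rcases Nat.lt_succ_iff_lt_or_eq.mp hb' with h' | rfl
      · rw [(h3.2.2.2 b' h'.ne).2]; exact h2 b' h' t ht
      · exact h3.2.2.1 t ht
  · rintro σ' ⟨a1, h1, h2⟩
    rw [h.blocks] at h1 h2
    exact ⟨a1.restore, h1, h2⟩

end Level

/-! ### One dimension of the algorithm -/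

section Level

variable {q d : ℕ} {n : Fin (d + 1) → ℕ} [∀ i, NeZero (n i)] {L : ℕ → Fin q} {R V : ℕ}
  {σ σ' : Store} {Q : Store → Prop}

/-- The sizes for the next dimension, the number of which is in `5`. -/
def headStmt : Stmt := .seq (.assign 6 (.raw (var 3 + var 5))) (.seq (.assign 8 (var 7 * var 6))
  (.seq (.assign 9 (var 2 / var 8)) (.assign 13 (var 8 * var 8))))

/-- The tables that do not depend on the block. -/
def setupStmt : Stmt := .seq subStmt (.seq powStmt (.seq mulStmt (.seq ordStmt (.seq freeStmt
  (.seq stabStmt (.seq twistStmt fixStmt))))))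

/-- The new tables become the current ones. -/
def copyStmt : Stmt := .seq (tab 0 10 9 20 8 (get 8 (var 10) (var 20)))
  (.seq (tab 1 10 9 20 8 (get 20 (var 10) (var 20)))
    (.seq (tab 3 20 8 21 8 (get 4 (var 20) (var 21)))
      (row 2 (const 0) 20 8 (get 14 (const 0) (var 20)))))

def tailStmt : Stmt := .seq (.assign 12 (get 5 (var 6) (const 0) * var 8)) (.assign 7 (var 8))

/-- The treatment of one dimension. -/
def levelStmt : Stmt := .seq headStmt (.seq setupStmt (.seq (.loop 10 9 blockStmt)
  (.seq copyStmt tailStmt)))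

theorem head_post (h : Inv (low n) L (R * n (Fin.last d)) σ) (hV : Big q n V) (hσ : σ.Le V)
    (hraw : σ.raw (min (σ.r 3 + σ.r 5) σ.base) = n (Fin.last d)) :
    headStmt.Post V σ (Ctx n L R) := by
  have hpos := (numbering n).pos
  have e : R * n (Fin.last d) * ∏ i, low n i = R * ∏ i, n i := by rw [prod_low, mul_assoc]
  refine Post.seq (Post.assign hraw ((last_le_prod n).trans hV.size) ?_)
  refine Post.seq (Post.assign (k := ∏ i, n i) ?_ hV.size ?_)
  · simp only [rules, reduceIte, Nat.reduceEqDiff]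
    rw [h.size, low_mul_last]
  refine Post.seq (Post.assign (k := R) ?_ ?_ ?_)
  · simp only [rules, reduceIte, Nat.reduceEqDiff]
    rw [h.total, e, Nat.mul_div_cancel _ hpos]
  -- `Big` does not bound the number of blocks. It is at most the total number of letters, which the
  -- variable 2 holds.
  · have h1 := hσ.r 2
    rw [h.total, e] at h1
    exact (Nat.le_mul_of_pos_right _ hpos).trans h1
  refine Post.assign (k := (∏ i, n i) * ∏ i, n i) ?_ hV.square ?_
  · simp only [rules, reduceIte, Nat.reduceEqDiff]
  refine ⟨⟨h.K, h.A, h.tot, h.sub, h.base, h.size, h.total, h.one⟩, ?_, ?_, ?_, ?_⟩ <;>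
    simp only [rules, reduceIte, Nat.reduceEqDiff]

theorem setup_post (h : Ctx n L R σ) (hV : Big q n V) (hq : 0 < q) :
    setupStmt.Post V σ fun σ' => Agree [] [4, 5, 9, 10, 11, 12, 13, 14, 21] σ σ' ∧ Tables q n σ' ∧
      ∀ t < ∏ i, n i, σ'.A 14 0 t = fixCount q n (posOf n t) := by
  refine Post.seq (sub_post h hV fun f4 h4 => Post.seq ?_)
  have a1 : Agree [] [4, 5, 9, 10, 11, 12, 13, 14, 21] σ (σ.setA 4 f4) :=
    (Agree.refl _ _ σ).setA (by decide) f4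
  refine pow_post (h.agree a1 (by decide) (by decide)) hV fun f5 h5 => Post.seq ?_
  have a2 := a1.setA (a := 5) (by decide) f5
  refine mul_post (h.agree a2 (by decide) (by decide)) hV h4 fun f9 h9 => Post.seq ?_
  have a3 := a2.setA (a := 9) (by decide) f9
  refine ord_post (h.agree a3 (by decide) (by decide)) hV h9 fun f21 h21 => Post.seq ?_
  have a4 := a3.setA (a := 21) (by decide) f21
  refine free_post (h.agree a4 (by decide) (by decide)) hV h21 fun f10 h10 => Post.seq ?_
  have a5 := a4.setA (a := 10) (by decide) f10
  refine stab_post (h.agree a5 (by decide) (by decide)) hV h21 h9 fun f12 h12 => Post.seq ?_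
  have a6 := a5.setA (a := 12) (by decide) f12
  refine twist_post (h.agree a6 (by decide) (by decide)) hV h9 h10 fun f11 h11 => ?_
  have a7 := a6.setA (a := 11) (by decide) f11
  refine fix_post (h.agree a7 (by decide) (by decide)) hV hq h10 h12 fun f13 f14 h14 => ?_
  exact ⟨(a7.setA (a := 13) (by decide) f13).setA (a := 14) (by decide) f14,
    ⟨h4, h5, h10, h12, h11⟩, h14⟩

/-- Every block reads the tables of the lower dimension, so the new tables replace them only after
the last block. -/
theorem copy_post (h : Ctx n L R σ) (hV : Big q n V) (hT : Tables q n σ)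
    (h8 : ∀ b < R, ∀ t < ∏ i, n i, σ.A 8 b t = kap n (posOf n t +ᵥ block n L b))
    (h20 : ∀ b < R, ∀ t < ∏ i, n i, σ.A 20 b t = bigCount n (posOf n t) (block n L b))
    (h14 : ∀ t < ∏ i, n i, σ.A 14 0 t = fixCount q n (posOf n t)) :
    (Stmt.seq copyStmt tailStmt).Post V σ (Inv n L R) := by
  refine Post.seq (Post.seq (Post.tab (by decide) (by decide)
    (fun b t => kap n (posOf n t +ᵥ block n L b)) ?_ ?_ fun f0 h0 => Post.seq (Post.tab (by decide)
    (by decide) (fun b t => bigCount n (posOf n t) (block n L b)) ?_ ?_ fun f1 h1 =>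
    Post.seq (Post.tab (by decide) (by decide) (fun s t => index (posOf n s - posOf n t)) ?_ ?_
    fun f3 h3 => Post.row (r := 0) (fun t => fixCount q n (posOf n t)) (fun _ _ _ => rfl) ?_ ?_
    fun f2 h2 _ => Post.seq (Post.assign (k := bnd q n * ∏ i, n i) ?_ hV.code
      (Post.assign (k := ∏ i, n i) ?_ hV.size ?_))))))
  · intro f b hb t ht
    rw [h.blocks] at hb
    rw [h.size] at ht
    simp only [rules, reduceIte, Nat.reduceEqDiff]
    exact h8 b hb t ht
  · intro b _ t _
    exact (kap_lt n _).le.trans hV.code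
  · intro f b hb t ht
    rw [Store.setA_r, h.blocks] at hb
    rw [Store.setA_r, h.size] at ht
    simp only [rules, reduceIte, Nat.reduceEqDiff]
    exact h20 b hb t ht
  · intro b _ t _
    exact (bigCount_le n _ _).trans hV.count
  · intro f s hs t ht
    simp only [Store.setA_r, h.size] at hs ht
    simp only [rules, reduceIte, Nat.reduceEqDiff]
    exact hT.sub s hs t ht
  · intro s _ t _
    exact (index_lt _).le.trans hV.size
  · intro f _ t ht
    simp only [Store.setA_r, h.size] at ht
    simp only [rules, reduceIte, Nat.reduceEqDiff]
    exact h14 t ht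
  · intro t _
    exact (fixCount_le n _).trans hV.count
  · simp only [rules, reduceIte, Nat.reduceEqDiff]
    rw [h.last, hT.pow _ le_rfl, h.size]
    rfl
  · simp only [rules, reduceIte, Nat.reduceEqDiff]
    exact h.size
  · simp only [Store.setA_r, h.blocks, h.size] at h0 h1 h2 h3
    refine ⟨h0, h1, h2, h3, ?_, ?_, ?_, ?_⟩ <;> simp only [rules, reduceIte, Nat.reduceEqDiff]
    · rw [h.inv.total, prod_low, mul_assoc]
    · exact h.inv.one

theorem level_post (h : Inv (low n) L (R * n (Fin.last d)) σ) (hV : Big q n V) (hq : 0 < q)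
    (hσ : σ.Le V) (hraw : σ.raw (min (σ.r 3 + σ.r 5) σ.base) = n (Fin.last d)) :
    levelStmt.Post V σ (Inv n L R) := by
  refine Post.seq ((head_post h hV hσ hraw).mono fun σ₁ h1 => Post.seq
    ((setup_post h1 hV hq).mono fun σ₂ ⟨a2, T2, h14⟩ => Post.seq ?_))
  have h2 := h1.agree a2 (by decide) (by decide)
  refine (blocks_post h2 hV hq T2).mono fun σ₃ ⟨a3, h8, h20⟩ => ?_
  refine copy_post (h2.agree a3 (by decide) (by decide)) hV (T2.agree a3 (by decide)) h8 h20 ?_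
  rw [a3.A 14 (by decide)]
  exact h14

/-! ### The running time of the program for one dimension -/

/-- The exponents of the ranges of the loops. -/
def weight (v : ℕ) : ℕ := if v = 13 then 2 else if v = 14 then 0 else 1

/-- The variables that give the ranges of the loops. -/
abbrev ranges : List ℕ := [6, 7, 8, 13, 14]

/-- The number of blocks is not bounded by a power of the sizes treated so far; loops over blocks
are therefore charged linearly instead of through an exponent. -/
theorem loop_cost_le {S : List ℕ} {wt : ℕ → ℕ} {M D x v : ℕ} {s : Stmt} (hM : 1 ≤ M)
    (hs : s.Fixed S = true) (hx : x ∉ S) (hD : s.depth wt ≤ D) (σ : Store)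
    (hσ : ∀ v ∈ S, σ.r v ≤ M ^ wt v) :
    (Stmt.loop x v s).cost σ ≤ σ.r v * ((s.size + 7) * M ^ D) + 8 := by
  have h1 : ∀ i ∈ Finset.range (σ.r v), s.cost ((iter s.exec x σ i).setR x i) + 7 ≤
      (s.size + 7) * M ^ D := by
    intro i _
    have h2 := Stmt.cost_le hM s hs ((iter s.exec x σ i).setR x i) fun u hu => by
      rw [Store.setR_r_ne _ _ (by rintro rfl; exact hx hu), iter_r_of_fixed hs hx hu]
      exact hσ u hu
    have h3 := Nat.mul_le_mul_left s.size (Nat.pow_le_pow_right hM hD)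
    have h4 : 1 ≤ M ^ D := Nat.one_le_pow _ _ hM
    nlinarith
  have := Finset.sum_le_card_nsmul _ _ _ h1
  rw [Finset.card_range, smul_eq_mul] at this
  exact Nat.add_le_add_right this 8

/-- The constant factor of the running time for one dimension. -/
def levelConst : ℕ := headStmt.size + (setupStmt.size + ((blockStmt.size + 15) +
  (((row 0 (var 10) 20 8 (get 8 (var 10) (var 20))).size + 15) +
  (((row 1 (var 10) 20 8 (get 20 (var 10) (var 20))).size + 15) +
  ((tab 3 20 8 21 8 (get 4 (var 20) (var 21))).size +
  (row 2 (const 0) 20 8 (get 14 (const 0) (var 20))).size)) + tailStmt.size)))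

/-- With `M` the product of the sizes so far, the dominant part is run for each of `R` blocks and
`M` translations: transitions test at most `M` states for each triple of two states and a letter,
and walks of at most `M` lengths are summed over `M` states for each of `M ^ 2` pairs. Both have
exponent 4, hence 5 with the loop over translations. -/
theorem level_cost (h : Inv (low n) L (R * n (Fin.last d)) σ) (hR : 0 < R) (hV : Big q n V)
    (hσ : σ.Le V) (hraw : σ.raw (min (σ.r 3 + σ.r 5) σ.base) = n (Fin.last d)) :
    levelStmt.cost σ ≤ levelConst * (R * (∏ i, n i) ^ 5) := by
  have hpos := (numbering n).pos
  have hpos' : 1 ≤ (∏ i, n i) ^ 5 := Nat.one_le_pow _ _ hpos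
  have hX : (∏ i, n i) ^ 5 ≤ R * (∏ i, n i) ^ 5 := Nat.le_mul_of_pos_left _ hR
  have mono : ∀ {a}, a ≤ 5 → (∏ i, n i) ^ a ≤ R * (∏ i, n i) ^ 5 := fun h =>
    (Nat.pow_le_pow_right hpos h).trans hX
  obtain ⟨-, h1⟩ := head_post h hV hσ hraw
  obtain ⟨W, hW⟩ : ∃ W : Store → Prop, ∀ σ, W σ ↔
    (∀ v ∈ ranges, σ.r v ≤ (∏ i, n i) ^ weight v) ∧ σ.r 9 = R := ⟨_, fun _ => Iff.rfl⟩
  have hw : W (headStmt.exec σ) := by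
    have h7 : ∏ i, low n i ≤ ∏ i, n i := by
      rw [prod_low]; exact Nat.le_mul_of_pos_left _ (last_pos n)
    rw [hW]
    refine ⟨?_, h1.blocks⟩
    simp only [ranges, List.mem_cons, List.not_mem_nil, or_false, forall_eq_or_imp, forall_eq,
      h1.last, h1.inv.size, h1.size, h1.square, h1.inv.one]
    refine ⟨?_, ?_, ?_, ?_, ?_⟩
    · simpa [weight] using last_le_prod n
    · simpa [weight] using h7
    · simp [weight]
    · simp [weight, sq]
    · simp [weight]
  have hframe : ∀ {σ : Store} (s : Stmt), W σ → s.vars = [] → W (s.exec σ) := by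
    intro σ s h hs
    rw [hW] at h ⊢
    have : (s.exec σ).r = σ.r := funext fun x => Stmt.exec_r (by rw [hs]; exact List.not_mem_nil) σ
    rwa [this]
  have hloop : ∀ {σ : Store} {s : Stmt} {x : ℕ}, W σ → s.Fixed ranges = true → x ∉ ranges →
      s.depth weight ≤ 5 → (Stmt.loop x 9 s).cost σ ≤ (s.size + 15) * (R * (∏ i, n i) ^ 5) := by
    intro σ s x h hs hx hD
    rw [hW] at h
    have := loop_cost_le (v := 9) hpos hs hx hD σ h.1
    rw [h.2] at this
    nlinarith
  have hstmt : ∀ {σ : Store} {s : Stmt}, W σ → s.Fixed ranges = true →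
      s.depth weight ≤ 5 → s.cost σ ≤ s.size * (R * (∏ i, n i) ^ 5) := by
    intro σ s h hs hD
    rw [hW] at h
    exact (Stmt.cost_le hpos s hs σ h.1).trans (Nat.mul_le_mul_left _ (mono hD))
  -- Code without loops takes constant time: with no range variables, all exponents are irrelevant
  -- and `M = 1` is admissible.
  have hconst : ∀ (σ : Store) (s : Stmt), s.Fixed [] = true →
      s.cost σ ≤ s.size * (R * (∏ i, n i) ^ 5) := by
    intro σ s hs
    refine (Stmt.cost_le (S := []) (wt := fun _ => 0) (M := 1) le_rfl s hs σ (by simp)).trans ?_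
    rw [one_pow]
    exact Nat.mul_le_mul_left _ (hpos'.trans hX)
  have w1 := hframe setupStmt hw (by decide)
  have w2 := hframe (Stmt.loop 10 9 blockStmt) w1 (by decide)
  have w3 := hframe (tab 0 10 9 20 8 (get 8 (var 10) (var 20))) w2 (by decide)
  have w4 := hframe (tab 1 10 9 20 8 (get 20 (var 10) (var 20))) w3 (by decide)
  have w5 := hframe (tab 3 20 8 21 8 (get 4 (var 20) (var 21))) w4 (by decide)
  simp only [levelConst, add_mul _ _ (R * (∏ i, n i) ^ 5)]
  refine Nat.add_le_add (hconst _ headStmt (by decide)) (Nat.add_le_add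
    (hstmt hw (by decide) (by decide)) (Nat.add_le_add ?_ (Nat.add_le_add (Nat.add_le_add ?_
    (Nat.add_le_add ?_ (Nat.add_le_add (hstmt w4 (by decide) (by decide))
      (hstmt w5 (by decide) (by decide))))) (hconst _ tailStmt (by decide)))))
  · rw [← add_mul]; exact hloop w1 (by decide) (by decide) (by decide)
  · rw [← add_mul]; exact hloop w2 (by decide) (by decide) (by decide)
  · rw [← add_mul]; exact hloop w3 (by decide) (by decide) (by decide)

end Level

/-! ### Words whose sizes are all one -/

section Ones

variable {q d : ℕ} {n : Fin d → ℕ}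

theorem prod_ones (h : ∀ i, n i = 1) : ∏ i, n i = 1 := Finset.prod_eq_one fun i _ => h i

theorem subsingleton_pos (h : ∀ i, n i = 1) : Subsingleton (Pos n) :=
  ⟨fun a b => funext fun i => by
    have : Subsingleton (Fin (n i)) := by rw [h i]; infer_instance
    exact Subsingleton.elim _ _⟩

variable [∀ i, NeZero (n i)]

theorem cls_ones (h : ∀ i, n i = 1) (u : Word q n) : cls n u = code n u := by
  have := subsingleton_pos h
  obtain ⟨k, hk⟩ := exists_clsOf (H := Pos n) (code := code n) u
  rw [Subsingleton.elim k 0, zero_vadd] at hk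
  exact hk.symm

theorem kap_ones (h : ∀ i, n i = 1) (u : Word q n) : kap n u = code n u := by
  have h1 := shiftOf_lt (code := code n) (index_lt (n := n)) u
  rw [prod_ones h] at h1
  rw [kap, kapOf, prod_ones h, mul_one, Nat.lt_one_iff.mp h1, add_zero]
  exact cls_ones h u

theorem bnd_ones {d : ℕ} {n : Fin d → ℕ} (h : ∀ i, n i = 1) : bnd q n = q + 1 := by
  induction d with
  | zero => rfl
  | succ d ih =>
    rw [bnd, ih fun i => h _, h, pow_one, Finset.prod_eq_one fun i _ => h _, mul_one]

theorem code_ones {d : ℕ} {n : Fin d → ℕ} [∀ i, NeZero (n i)] (h : ∀ i, n i = 1) (u : Word q n) :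
    code n u = u 0 + 1 := by
  induction d with
  | zero =>
    change (u _ : ℕ) + 1 = _
    congr 3
    exact Subsingleton.elim _ _
  | succ d ih =>
    have := subsingleton_pos h
    rw [code_succ, lexCode, h (Fin.last d), Finset.sum_range_one, Nat.sub_self, pow_zero,
      mul_one, kap_ones fun i => h _, ih fun i => h _]
    change (u _ : ℕ) + 1 = _
    congr 3
    exact Subsingleton.elim _ _

theorem sum_word_ones (h : ∀ i, n i = 1) (f : Fin q → ℕ) : ∑ u : Word q n, f (u 0) = ∑ a, f a := by
  have := subsingleton_pos h
  have : Unique (Pos n) := ⟨⟨0⟩, fun a => Subsingleton.elim _ _⟩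
  exact Fintype.sum_equiv (Equiv.funUnique (Pos n) (Fin q)) _ _ fun u => congrArg (fun p => f (u p))
    (Subsingleton.elim _ _)

theorem fixCount_ones (h : ∀ i, n i = 1) (g : Pos n) : fixCount q n g = q := by
  have := subsingleton_pos h
  have h1 : ∀ u : Word q n, g +ᵥ u = u := fun u => by rw [Subsingleton.elim g 0, zero_vadd]
  unfold fixCount
  simp only [h1, if_true]
  rw [sum_word_ones h fun _ => 1]
  simp

theorem bigCount_ones (h : ∀ i, n i = 1) (g : Pos n) (w : Word q n) :
    bigCount n g w = q - (w 0 + 1) := by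
  have := subsingleton_pos h
  have h1 : ∀ u : Word q n, g +ᵥ u = u := fun u => by rw [Subsingleton.elim g 0, zero_vadd]
  have h2 : ∀ u : Word q n, cls n w < cls n u ↔ w 0 < u 0 := fun u => by
    rw [cls_ones h, cls_ones h, code_ones h, code_ones h, Fin.lt_def]; omega
  unfold bigCount
  simp only [h1, h2, true_and]
  rw [sum_word_ones h fun a => if w 0 < a then 1 else 0, ← Finset.card_filter]
  have : (Finset.univ.filter fun i => w 0 < i) = Finset.Ioi (w 0) := by ext; simp
  rw [this, Fin.card_Ioi]
  omega

end Ones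

/-! ### The whole program -/

/-- The situation before the dimensions with at least two slices are treated. -/
def initStmt : Stmt := .seq (.seq (.assign 4 (var 0 - var 3)) (.seq (.assign 7 (const 1))
    (.seq (.assign 14 (const 1)) (.assign 12 (var 1 + const 1)))))
  (.seq (tab 0 10 2 20 14 (raw (var 0 + var 10))) (.seq
    (tab 1 10 2 20 14 (var 1 - raw (var 0 + var 10)))
    (.seq (.store 2 (const 0) (const 0) (var 1)) (.store 3 (const 0) (const 0) (const 0)))))

/-- If all sizes are `1`, a block is a single letter and the only translation is trivial: the weight
is the letter in `{1, …, q}`, and the larger words are the `q - (L b + 1)` larger letters. This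
holds for any number of such dimensions, so they are all treated at once. -/
theorem init_post {q d₀ d N V : ℕ} {n : Fin d₀ → ℕ} [∀ i, NeZero (n i)] (h : ∀ i, n i = 1)
    {L : ℕ → Fin q} {σ : Store} (hσ : σ.Le V) (h0 : σ.r 0 = d) (h1 : σ.r 1 = q) (h2 : σ.r 2 = N)
    (h3 : σ.r 3 = d₀) (hbase : σ.base = d + N) (hraw : ∀ b < N, σ.raw (d + b) = L b + 1)
    (hV : q + 1 ≤ V) : initStmt.Post V σ fun σ' => Inv n L N σ' ∧ σ'.r 4 = d - d₀ := by
  have hb : ∀ b, block n L b (0 : Pos n) = L b := fun b => by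
    change L _ = L _
    rw [prod_ones h, index_zero, mul_one, add_zero]
  have hread : ∀ b < N, σ.raw (min (d + b) (d + N)) = L b + 1 := fun b hb => by
    rw [min_eq_left (by omega), hraw b hb]
  have hsub := subsingleton_pos h
  refine Post.seq (Post.seq (Post.assign (k := d - d₀) ?_ ?_ (Post.seq (Post.assign (k := 1) rfl ?_
    (Post.seq (Post.assign (k := 1) rfl ?_ (Post.assign (k := q + 1) ?_ hV (Post.seq
    (Post.tab (by decide) (by decide) (fun b _ => L b + 1) ?_ ?_ fun f0 hf0 => Post.seq
    (Post.tab (by decide) (by decide) (fun b _ => q - (L b + 1)) ?_ ?_ fun f1 hf1 => Post.seq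
    ⟨?_, ?_, ?_⟩))))))))))
  · simp only [rules]; rw [h0, h3]
  · have := hσ.r 0; omega
  · omega
  · omega
  · simp only [rules, reduceIte, Nat.reduceEqDiff]; rw [h1]
  · intro f b hb t ht
    simp only [rules, reduceIte, Nat.reduceEqDiff] at hb ht
    simp only [Expr.eval, rules, reduceIte, Nat.reduceEqDiff, Store.setR_raw, Store.setA_raw,
      Store.setR_base, Store.setA_base]
    rw [h0, hbase, hread b (by omega)]
  · intro b _ _ _
    have := (L b).2
    omega
  · intro f b hb t ht
    simp only [rules, reduceIte, Nat.reduceEqDiff] at hb ht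
    simp only [Expr.eval, rules, reduceIte, Nat.reduceEqDiff, Store.setR_raw, Store.setA_raw,
      Store.setR_base, Store.setA_base]
    rw [h0, h1, hbase, hread b (by omega)]
  · intro b _ _ _
    omega
  · change Expr.eval (var 1) _ ≤ V
    simp only [rules, reduceIte, Nat.reduceEqDiff]
    omega
  · exact Nat.zero_le _
  · simp only [rules, reduceIte, Nat.reduceEqDiff, h2] at hf0 hf1
    simp only [Stmt.exec, rules, reduceIte, Nat.reduceEqDiff]
    refine ⟨⟨?_, ?_, ?_, ?_, ?_, ?_, ?_, ?_⟩, ?_⟩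
    · intro b hbN t ht
      rw [prod_ones h] at ht
      rw [Subsingleton.elim (posOf n t) 0, zero_vadd, kap_ones h, code_ones h, hb]
      exact hf0 b hbN t ht
    · intro b hbN t ht
      rw [prod_ones h] at ht
      rw [bigCount_ones h, hb]
      exact hf1 b hbN t ht
    · intro t ht
      rw [prod_ones h] at ht
      rw [fixCount_ones h]
      obtain rfl : t = 0 := by omega
      simp only [rules, reduceIte, Nat.reduceEqDiff, upd, and_self, h1]
    · intro s hs t ht
      rw [prod_ones h] at hs ht
      obtain rfl : s = 0 := by omega
      obtain rfl : t = 0 := by omega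
      simp only [rules, reduceIte, upd, and_self]
      rw [sub_self, index_zero]
    · simp only [rules, reduceIte, Nat.reduceEqDiff]
      rw [bnd_ones h, prod_ones h, mul_one]
    · simp only [rules, reduceIte, Nat.reduceEqDiff]
      rw [prod_ones h]
    · simp only [rules, reduceIte, Nat.reduceEqDiff]
      rw [prod_ones h, h2, mul_one]
    · simp only [rules, reduceIte, Nat.reduceEqDiff]
    · trivial

theorem init_cost {σ : Store} {N : ℕ} (h2 : σ.r 2 = N) (hN : 0 < N) :
    initStmt.cost σ ≤ initStmt.size * N := by
  have h := Stmt.cost_le (M := 1) (S := []) (wt := fun _ => 0) le_rfl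
    (.seq (.assign 4 (var 0 - var 3)) (.seq (.assign 7 (const 1))
    (.seq (.assign 14 (const 1)) (.assign 12 (var 1 + const 1))))) (by decide) σ (by simp)
  rw [one_pow, mul_one] at h
  refine (Nat.add_le_add (h.trans (Nat.le_mul_of_pos_right _ hN)) (Stmt.cost_le (M := N) (S := [2, 14])
    (wt := fun v => if v = 2 then 1 else 0) hN _ (by decide) _ ?_)).trans ?_
  · simp only [List.mem_cons, List.not_mem_nil, or_false, forall_eq_or_imp, forall_eq]
    simp only [Stmt.exec, rules, reduceIte, Nat.reduceEqDiff, h2]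
    simp
  · have e : Stmt.depth (fun v => if v = 2 then 1 else 0)
      (.seq (tab 0 10 2 20 14 (raw (var 0 + var 10))) (.seq
      (tab 1 10 2 20 14 (var 1 - raw (var 0 + var 10)))
      (.seq (.store 2 (const 0) (const 0) (var 1)) (.store 3 (const 0) (const 0) (const 0))))) = 1 := by
      decide
    rw [e, pow_one, ← add_mul]
    exact le_rfl

/-- The rank, from the tables for all dimensions. -/
def finalStmt : Stmt := .assign 0 ((sum 20 7 (get 2 (const 0) (var 20)) -
  sum 20 7 (get 1 (const 0) (var 20))) / var 2 - const 1)

theorem sum_posOf {d : ℕ} {n : Fin d → ℕ} [∀ i, NeZero (n i)] (f : Pos n → ℕ) :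
    ∑ t ∈ Finset.range (∏ i, n i), f (posOf n t) = ∑ g, f g :=
  Finset.sum_nbij' (posOf n) index (by simp) (fun g _ => Finset.mem_range.mpr (index_lt g))
    (fun t ht => index_posOf (Finset.mem_range.mp ht)) (fun g _ => posOf_index g) fun _ _ => rfl

theorem rank_le {q d : ℕ} {n : Fin d → ℕ} [∀ i, NeZero (n i)] (w : Word q n) :
    (Necklace.mk w).rank ≤ q ^ ∏ i, n i := by
  classical
  rw [rank_eq_card, ← card_word]
  exact Finset.card_le_univ _

theorem final_post {q d V : ℕ} {n : Fin d → ℕ} [∀ i, NeZero (n i)] {L : ℕ → Fin q} {σ : Store}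
    (h : Inv n L 1 σ) (hV : q ^ ∏ i, n i ≤ V) : finalStmt.Post V σ fun σ' =>
      σ'.r 0 = (Necklace.mk (block n L 0)).rank := by
  refine Post.assign (k := (Necklace.mk (block n L 0)).rank) ?_ ((rank_le _).trans hV)
    (Store.setR_r_same _ _ _)
  simp only [rules, reduceIte]
  rw [rank_eq, h.size, h.total, one_mul, ← sum_posOf, ← sum_posOf]
  congr 3
  · exact Finset.sum_congr rfl fun t ht => h.tot t (Finset.mem_range.mp ht)
  · exact Finset.sum_congr rfl fun t ht => h.A 0 one_pos t (Finset.mem_range.mp ht)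

theorem final_cost {σ : Store} {N : ℕ} (h : σ.r 7 = N) (hN : 0 < N) :
    finalStmt.cost σ ≤ finalStmt.size * N := by
  refine (Stmt.cost_le (M := N) (S := [7]) (wt := fun _ => 1) hN _ (by decide) _ (by simp [h])).trans
    ?_
  have e : Stmt.depth (fun _ => 1) finalStmt = 1 := by decide
  rw [e, pow_one]

/-- A loop together with its running time. -/
theorem loop_spec {V x v : ℕ} {s : Stmt} {σ : Store} (I : ℕ → Store → Prop) (T : ℕ → ℕ) (h0 : I 0 σ)
    (hs : ∀ i < σ.r v, ∀ σ', I i σ' → s.Post V (σ'.setR x i) (I (i + 1)) ∧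
      s.cost (σ'.setR x i) ≤ T i) :
    (Stmt.loop x v s).Post V σ (fun σ' => ∃ σ'', I (σ.r v) σ'' ∧ σ' = σ''.setR x (σ.r x)) ∧
      (Stmt.loop x v s).cost σ ≤ ∑ i ∈ Finset.range (σ.r v), (T i + 7) + 8 := by
  have h : ∀ i ≤ σ.r v, I i (iter s.exec x σ i) := by
    intro i hi
    induction i with
    | zero => exact h0
    | succ i ih => exact (hs i (by omega) _ (ih (by omega))).1.2
  refine ⟨⟨fun i hi => (hs i hi _ (h i hi.le)).1.1, _, h _ le_rfl, rfl⟩, ?_⟩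
  refine Nat.add_le_add_right (Finset.sum_le_sum fun i hi => Nat.add_le_add_right ?_ 7) 8
  have hi := Finset.mem_range.mp hi
  exact (hs i hi _ (h i hi.le)).2

/-! ### All dimensions together: numbers and total time -/

section Main

variable {m : ℕ → ℕ} {q d d₀ V N Z : ℕ}

/-- The first `k` sizes. -/
abbrev pre (m : ℕ → ℕ) (k : ℕ) : Fin k → ℕ := fun i => m i

theorem prod_pre_succ (m : ℕ → ℕ) (k : ℕ) : ∏ i, pre m (k + 1) i = m k * ∏ i, pre m k i := by
  rw [Fin.prod_univ_castSucc, mul_comm]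
  rfl

theorem bnd_pre_succ (m : ℕ → ℕ) (k : ℕ) :
    bnd q (pre m (k + 1)) = (bnd q (pre m k) * ∏ i, pre m k i) ^ m k := rfl

/-- The number of blocks when the first `k` dimensions have been treated. -/
def blocks (m : ℕ → ℕ) (d k : ℕ) : ℕ := ∏ i ∈ Finset.Ico k d, m i

theorem blocks_self (m : ℕ → ℕ) (d : ℕ) : blocks m d d = 1 := by simp [blocks]

theorem blocks_succ (m : ℕ → ℕ) {d k : ℕ} (hk : k < d) :
    blocks m d k = blocks m d (k + 1) * m k := by
  rw [blocks, Finset.prod_eq_prod_Ico_succ_bot hk, mul_comm]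
  rfl

theorem blocks_mul (m : ℕ → ℕ) {d k : ℕ} (hk : k ≤ d) :
    blocks m d k * ∏ i, pre m k i = ∏ i, pre m d i := by
  rw [Fin.prod_univ_eq_prod_range m, Fin.prod_univ_eq_prod_range m, blocks, mul_comm]
  exact Finset.prod_range_mul_prod_Ico m hk

theorem pre_ones (h : ∀ i < d₀, m i = 1) : ∀ i, pre m d₀ i = 1 := fun i => h i i.2

/-- Every dimension from `d₀` on at least doubles the product, so the number of these dimensions is
smaller than the product. This bounds the number of rounds of the prologue. -/
theorem le_pre (hm : ∀ i, d₀ ≤ i → i < d → 2 ≤ m i) [∀ i, NeZero (m i)] {k : ℕ} (h : d₀ ≤ k)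
    (hk : k ≤ d) : k - d₀ < ∏ i, pre m k i := by
  induction k, h using Nat.le_induction with
  | base => rw [Nat.sub_self]; exact (numbering (pre m d₀)).pos
  | succ k h ih =>
    have h1 := hm k h (by omega)
    have h2 := ih (by omega)
    have h3 := Nat.mul_le_mul_right (∏ i, pre m k i) h1
    rw [prod_pre_succ]
    omega

/-- For a size `s ≥ 2` and a product `M`, the exponent grows from `2 * M - 1` to at most `(2 * M -
1) * s + 1 ≤ 2 * M * s - 1`. The slack of one absorbs the extra factor at every level, so the bound
does not depend on the number of dimensions. -/
theorem bnd_pre_le (h1 : ∀ i < d₀, m i = 1) (hm : ∀ i, d₀ ≤ i → i < d → 2 ≤ m i)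
    [∀ i, NeZero (m i)] (hq : q + 1 ≤ Z) (hZ : ∏ i, pre m d i ≤ Z) {k : ℕ} (h : d₀ ≤ k)
    (hk : k ≤ d) : bnd q (pre m k) * ∏ i, pre m k i ≤ Z ^ (2 * (∏ i, pre m k i) - 1) := by
  induction k, h using Nat.le_induction with
  | base => rw [bnd_ones (pre_ones h1), prod_ones (pre_ones h1)]; simpa using hq
  | succ k h ih =>
    have h2 := hm k h (by omega)
    have h3 := (numbering (pre m k)).pos
    have h4 : ∏ i, pre m (k + 1) i ≤ Z := by
      refine le_trans ?_ hZ
      rw [← blocks_mul m hk]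
      refine Nat.le_mul_of_pos_left _ (Finset.prod_pos fun i _ => NeZero.pos _)
    rw [bnd_pre_succ]
    calc _ ≤ (Z ^ (2 * (∏ i, pre m k i) - 1)) ^ m k * Z :=
          Nat.mul_le_mul (Nat.pow_le_pow_left (ih (by omega)) _) h4
      _ = Z ^ ((2 * (∏ i, pre m k i) - 1) * m k + 1) := by rw [pow_succ, pow_mul]
      _ ≤ _ := by
        refine Nat.pow_le_pow_right (by omega) ?_
        rw [prod_pre_succ, Nat.sub_mul, one_mul]
        have : m k ≤ 2 * (∏ i, pre m k i) * m k := Nat.le_mul_of_pos_left _ (by omega)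
        have e : 2 * (m k * ∏ i, pre m k i) = 2 * (∏ i, pre m k i) * m k := by ring
        rw [e]
        omega

theorem big_pre (h1 : ∀ i < d₀, m i = 1) (hm : ∀ i, d₀ ≤ i → i < d → 2 ≤ m i)
    [∀ i, NeZero (m i)] (hq : q + 1 ≤ Z) (hZ : ∏ i, pre m d i ≤ Z) {k : ℕ} (h : d₀ ≤ k)
    (hk : k ≤ d) : Big q (pre m k) (Z ^ (2 * ∏ i, pre m d i)) := by
  have h4 : ∏ i, pre m k i ≤ ∏ i, pre m d i := by
    rw [← blocks_mul m hk]
    exact Nat.le_mul_of_pos_left _ (Finset.prod_pos fun i _ => NeZero.pos _)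
  have h3 := (numbering (pre m d)).pos
  refine ⟨(bnd_pre_le h1 hm hq hZ h hk).trans (Nat.pow_le_pow_right (by omega) (by omega)),
    (Nat.pow_le_pow_left (by omega) _).trans (Nat.pow_le_pow_right (by omega) (by omega)), ?_⟩
  calc _ ≤ Z * Z := Nat.mul_le_mul (h4.trans hZ) (h4.trans hZ)
    _ = Z ^ 2 := (sq Z).symm
    _ ≤ _ := Nat.pow_le_pow_right (by omega) (by omega)

/-- The program after the product of the sizes has been computed. -/
def mainStmt : Stmt := .seq initStmt (.seq (.loop 5 4 levelStmt) finalStmt)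

/-- Each size is at least `2`, so the summands grow at least by the factor `2 ^ 4`; the factor `2`
used here already bounds the geometric sum by twice its last term. -/
theorem sum_levels_le (hm : ∀ i, d₀ ≤ i → i < d → 2 ≤ m i) (C X : ℕ) [∀ i, NeZero (m i)] {l : ℕ}
    (hX : 0 < X) (hl : d₀ + l ≤ d) :
    ∑ i ∈ Finset.range l, (C * (X * (∏ j, pre m (d₀ + (i + 1)) j) ^ 4) + 7) ≤
      (C + 7) * (2 * (X * (∏ j, pre m (d₀ + l) j) ^ 4)) := by
  induction l with
  | zero => simp
  | succ l ih =>
    rw [Finset.sum_range_succ]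
    have h1 := ih (by omega)
    have h2 := hm (d₀ + l) (by omega) (by omega)
    have h3 := (numbering (pre m (d₀ + l))).pos
    have h4 : 2 * (X * (∏ j, pre m (d₀ + l) j) ^ 4) ≤ X * (∏ j, pre m (d₀ + (l + 1)) j) ^ 4 := by
      rw [← add_assoc, prod_pre_succ, mul_pow]
      have : 2 ^ 4 ≤ m (d₀ + l) ^ 4 := Nat.pow_le_pow_left h2 4
      calc 2 * (X * (∏ j, pre m (d₀ + l) j) ^ 4) ≤ 2 ^ 4 * (X * (∏ j, pre m (d₀ + l) j) ^ 4) := by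
            omega
        _ ≤ m (d₀ + l) ^ 4 * (X * (∏ j, pre m (d₀ + l) j) ^ 4) := Nat.mul_le_mul_right _ this
        _ = _ := by ring
    have h5 : 1 ≤ X * (∏ j, pre m (d₀ + (l + 1)) j) ^ 4 :=
      Nat.mul_pos hX (Nat.pow_pos (numbering (pre m (d₀ + (l + 1)))).pos)
    have h6 := Nat.mul_le_mul_left (C + 7) h4
    nlinarith

/-- The constant factor of the running time. -/
def mainConst : ℕ := initStmt.size + ((levelConst + 7) * 2 + 8 + finalStmt.size)

theorem main_spec (h1 : ∀ i < d₀, m i = 1) (hm : ∀ i, d₀ ≤ i → i < d → 2 ≤ m i) (hd : d₀ ≤ d)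
    [∀ i, NeZero (m i)] {L : ℕ → Fin q} {σ : Store} (hσ : σ.Le V) (e0 : σ.r 0 = d) (e1 : σ.r 1 = q)
    (e2 : σ.r 2 = ∏ i, pre m d i) (e3 : σ.r 3 = d₀) (hbase : σ.base = d + ∏ i, pre m d i)
    (hsize : ∀ i < d, σ.raw i = m i) (hraw : ∀ b < ∏ i, pre m d i, σ.raw (d + b) = L b + 1)
    (hV : ∀ k, d₀ ≤ k → k ≤ d → Big q (pre m k) V) (hqV : q + 1 ≤ V) :
    mainStmt.Post V σ (fun σ' => σ'.r 0 = (Necklace.mk (block (pre m d) L 0)).rank) ∧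
      mainStmt.cost σ ≤ mainConst * (∏ i, pre m d i) ^ 5 := by
  have hN := (numbering (pre m d)).pos
  have hq : 0 < q := (Nat.zero_le _).trans_lt (L 0).2
  have hpos : ∀ k, 0 < blocks m d k := fun k => Finset.prod_pos fun i _ => NeZero.pos _
  obtain ⟨p1, p2, p3⟩ := init_post (pre_ones h1) hσ e0 e1 e2 e3 hbase hraw hqV
  obtain ⟨σ₁, hσ₁⟩ : ∃ σ₁, σ₁ = initStmt.exec σ := ⟨_, rfl⟩
  rw [← hσ₁] at p2 p3
  have f3 : σ₁.r 3 = d₀ := by rw [hσ₁, Stmt.exec_r (by decide), e3]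
  have fb : σ₁.base = d + ∏ i, pre m d i := by rw [hσ₁, Stmt.exec_base, hbase]
  have fr : σ₁.raw = σ.raw := by rw [hσ₁, Stmt.exec_raw]
  have hle₁ : σ₁.Le V := by rw [hσ₁]; exact p1.exec_le hσ
  have c1 := init_cost e2 hN
  have hloop := loop_spec (V := V) (x := 5) (v := 4) (s := levelStmt) (σ := σ₁)
    (fun l σ' => Inv (pre m (d₀ + l)) L (blocks m d (d₀ + l)) σ' ∧ σ'.r 3 = d₀ ∧
      σ'.base = σ₁.base ∧ σ'.raw = σ.raw ∧ σ'.Le V)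
    (fun l => levelConst * ((∏ i, pre m d i) * (∏ i, pre m (d₀ + (l + 1)) i) ^ 4))
    ⟨by
      have : blocks m d d₀ = ∏ i, pre m d i := by
        rw [← blocks_mul m hd, prod_ones (pre_ones h1), mul_one]
      rw [add_zero, this]
      exact p2, f3, rfl, fr, hle₁⟩ ?_
  · obtain ⟨q1, q2⟩ := hloop
    rw [p3] at q1 q2
    have hl : d₀ + (d - d₀) = d := by omega
    have hfin : (Stmt.loop 5 4 levelStmt).Post V σ₁ fun σ' => Inv (pre m d) L 1 σ' := by
      refine ⟨q1.1, ?_⟩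
      obtain ⟨σ'', ⟨i1, -⟩, e⟩ := q1.2
      rw [hl, blocks_self] at i1
      rw [e]
      exact ⟨i1.K, i1.A, i1.tot, i1.sub, i1.base, i1.size, i1.total, i1.one⟩
    have hlast := final_post hfin.2 (hV d hd le_rfl).count
    refine ⟨⟨⟨p1, by rw [← hσ₁]; exact ⟨hfin.1, hlast.1⟩⟩, ?_⟩, ?_⟩
    · show (finalStmt.exec ((Stmt.loop 5 4 levelStmt).exec (initStmt.exec σ))).r 0 = _
      rw [← hσ₁]
      exact hlast.2
    · have c3 := final_cost hfin.2.size hN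
      have c2 := q2.trans (Nat.add_le_add_right (sum_levels_le hm levelConst _ hN
        (l := d - d₀) (by omega)) 8)
      rw [hl, ← pow_succ', show 4 + 1 = 5 from rfl] at c2
      show initStmt.cost σ + ((Stmt.loop 5 4 levelStmt).cost (initStmt.exec σ) +
        finalStmt.cost ((Stmt.loop 5 4 levelStmt).exec (initStmt.exec σ))) ≤ _
      rw [← hσ₁]
      have hN5 : ∏ i, pre m d i ≤ (∏ i, pre m d i) ^ 5 := Nat.le_self_pow (by decide) _
      have g1 := Nat.mul_le_mul_left initStmt.size hN5
      have g2 := Nat.mul_le_mul_left finalStmt.size hN5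
      rw [mainConst, add_mul, add_mul, add_mul, mul_assoc (levelConst + 7)]
      omega
  · intro l hl σ' ⟨i1, i2, i3, i4, i5⟩
    rw [p3] at hl
    have hlV : l ≤ V := by have := hσ.r 0; omega
    have j1 : Inv (low (pre m (d₀ + (l + 1)))) L
        (blocks m d (d₀ + (l + 1)) * pre m (d₀ + (l + 1)) (Fin.last (d₀ + l))) (σ'.setR 5 l) := by
      have e := blocks_succ m (d := d) (k := d₀ + l) (by omega)
      have : Inv (pre m (d₀ + l)) L (blocks m d (d₀ + l + 1) * m (d₀ + l)) σ' := by
        rw [← e]; exact i1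
      exact ⟨this.K, this.A, this.tot, this.sub, this.base, this.size, this.total, this.one⟩
    have j2 : (σ'.setR 5 l).raw (min ((σ'.setR 5 l).r 3 + (σ'.setR 5 l).r 5) (σ'.setR 5 l).base) =
        pre m (d₀ + (l + 1)) (Fin.last (d₀ + l)) := by
      rw [Store.setR_r_ne _ _ (by decide), Store.setR_r_same, Store.setR_base, Store.setR_raw, i2, i3,
        i4, fb, min_eq_left (by omega)]
      exact hsize _ (by omega)
    have j3 : (σ'.setR 5 l).Le V := i5.setR hlV
    have hbig := hV (d₀ + (l + 1)) (by omega) (by omega)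
    have P := level_post j1 hbig hq j3 j2
    refine ⟨⟨P.1, P.2, ?_, ?_, ?_, P.1.exec_le j3⟩, ?_⟩
    · rw [Stmt.exec_r (by decide), Store.setR_r_ne _ _ (by decide), i2]
    · rw [Stmt.exec_base, Store.setR_base, i3]
    · rw [Stmt.exec_raw, Store.setR_raw, i4]
    -- The number of blocks times the size of a block is `N`, so `R * M ^ 5` becomes `N * M ^ 4`.
    · refine (level_cost j1 (hpos _) hbig j3 j2).trans (le_of_eq ?_)
      have e := blocks_mul m (show d₀ + (l + 1) ≤ d by omega)
      rw [← e, mul_assoc (blocks m d (d₀ + (l + 1))), ← pow_succ']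
      rfl

end Main

/-! ### The beginning of the program -/

theorem Program.Reach.monoBound {P : Program} {B B' T : ℕ} {c c' : Config} (h : P.Reach B T c c')
    (hB : B ≤ B') : P.Reach B' T c c' := by
  obtain ⟨t, ht, e, h⟩ := h
  exact ⟨t, ht, e, fun s hs => ⟨fun i => ((h s hs).1 i).trans hB, fun a => ((h s hs).2 a).trans hB⟩⟩

/-- Computes the number of letters and the number of leading dimensions of size `1`, and the first
address after the input. -/
def prologue : List Instr :=
  [.add 2 1 8, .const 4 1, .const 8 1, .add 6 0 10, .jumpZero 6 12, .sub 10 6 8, .load 12 10,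
   .sub 14 12 8, .jumpZero 14 12, .mul 4 4 12, .add 6 10 16, .jump 4, .add 1 0 4]

section Prologue

variable {m M r : ℕ → ℕ} {q d d₀ Z i : ℕ} {P : Program}

/-- The registers when the sizes from `i` on have been multiplied. -/
structure ProInv (m : ℕ → ℕ) (q d i : ℕ) (r : ℕ → ℕ) : Prop where
  dim : r 0 = d
  letters : r 2 = q
  prod : r 4 = blocks m d i
  pos : r 6 = i
  one : r 8 = 1
  zero : r 16 = 0

theorem blocks_le_prod [∀ i, NeZero (m i)] (k : ℕ) (hk : k ≤ d) :
    blocks m d k ≤ ∏ i, pre m d i := by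
  rw [← blocks_mul m hk]
  exact Nat.le_mul_of_pos_right _ (numbering (pre m k)).pos

theorem prologue_round [∀ i, NeZero (m i)] (hP : CodeAt P 0 prologue) (hi : i < d)
    (h2 : 2 ≤ m i) (hM : M i = m i) (hZ : ∏ i, pre m d i ≤ Z) (h : ProInv m q d (i + 1) r)
    (hb : Config.Bounded Z ⟨4, r, M⟩) :
    ∃ r', P.Reach Z 8 ⟨4, r, M⟩ ⟨4, r', M⟩ ∧ ProInv m q d i r' := by
  simp only [prologue, CodeAt] at hP
  obtain ⟨-, -, -, -, P4, P5, P6, P7, P8, P9, P10, P11, -⟩ := hP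
  have hm : m i ≤ Z := hM ▸ hb.2 i
  have hiZ : i ≤ Z := by have := hb.1 6; simp only [h.pos] at this; omega
  have hblk := blocks_succ m hi
  have hle := (blocks_le_prod (m := m) i hi.le).trans hZ
  have s0 : P.Reach Z 0 ⟨4, r, M⟩ ⟨4, r, M⟩ := .refl hb
  have s1 : P.Reach Z 1 ⟨4, r, M⟩ ⟨5, r, M⟩ := by
    have := s0.snoc P4 (by exact hb)
    simpa [Instr.exec, h.pos] using this
  have s2 : P.Reach Z 2 ⟨4, r, M⟩ ⟨6, Function.update r 10 i, M⟩ := by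
    have := s1.snoc P5 (s1.bounded.update _ _ _ (by simp only [h.pos, h.one]; omega))
    simpa [Instr.exec, h.pos, h.one] using this
  have s3 := s2.snoc P6 (s2.bounded.update _ _ _ (by simpa [hM] using hm))
  have s4 := s3.snoc P7 (s3.bounded.update _ _ _ (by simp [Instr.exec, hM, h.one]; omega))
  have s5 := s4.snoc P8 (by exact s4.bounded)
  have e5 : m i - 1 ≠ 0 := by omega
  simp only [Instr.exec, Function.update_self, Function.update_of_ne, hM, h.one, ne_eq, e5, reduceIte,
    Nat.reduceEqDiff, not_false_eq_true, Nat.reduceAdd] at s5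
  have s6 := s5.snoc P9 (s5.bounded.update _ _ _ (by simpa [h.prod, ← hblk] using hle))
  have s7 := s6.snoc P10 (s6.bounded.update _ _ _ (by simpa [Instr.exec, h.zero] using hiZ))
  have s8 := s7.snoc P11 (by exact s7.bounded)
  refine ⟨_, s8, ⟨?_, ?_, ?_, ?_, ?_, ?_⟩⟩ <;>
    simp [Instr.exec, h.dim, h.letters, h.prod, h.one, h.zero, hblk]

/-- The scan from the end stops at address `0` or at a size `1`. In both cases all remaining sizes
are `1`, so the product of the sizes already read is `N` and the position reached is the number of
leading ones. -/
theorem prologue_end (hP : CodeAt P 0 prologue) (h1 : ∀ j < i, m j = 1) (hM : ∀ j < i, M j = m j)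
    (hZ : d + blocks m d i ≤ Z) (h : ProInv m q d i r) (hb : Config.Bounded Z ⟨4, r, M⟩) :
    ∃ r', P.Reach Z 6 ⟨4, r, M⟩ ⟨13, r', M⟩ ∧ ProInv m q d i r' ∧ r' 1 = d + blocks m d i := by
  simp only [prologue, CodeAt] at hP
  obtain ⟨-, -, -, -, P4, P5, P6, P7, P8, -, -, -, P12, -⟩ := hP
  have main : ∃ r', P.Reach Z 5 ⟨4, r, M⟩ ⟨12, r', M⟩ ∧ ProInv m q d i r' := by
    have s0 : P.Reach Z 0 ⟨4, r, M⟩ ⟨4, r, M⟩ := .refl hb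
    have s1 := s0.snoc P4 (by exact hb)
    rcases Nat.eq_zero_or_pos i with hi | hi
    · refine ⟨r, Program.Reach.mono ?_ (by decide : 1 ≤ 5), h⟩
      simpa [Instr.exec, h.pos, hi] using s1
    have e0 : i ≠ 0 := hi.ne'
    simp only [Instr.exec, h.pos, e0, reduceIte, Nat.reduceAdd] at s1
    have hiZ : i ≤ Z := h.pos ▸ hb.1 6
    have hMi : M (i - 1) = 1 := by rw [hM _ (by omega), h1 _ (by omega)]
    have hZ1 : 1 ≤ Z := by rw [← hMi]; exact hb.2 _
    have s2 := s1.snoc P5 (s1.bounded.update _ _ _ (by simp only [h.pos, h.one]; omega))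
    simp only [Instr.exec, h.pos, h.one, Nat.reduceAdd] at s2
    have s3 := s2.snoc P6 (s2.bounded.update _ _ _ (by simpa [hMi] using hZ1))
    have s4 := s3.snoc P7 (s3.bounded.update _ _ _ (by simp [Instr.exec, hMi, h.one]))
    have s5 := s4.snoc P8 (by exact s4.bounded)
    simp only [Instr.exec, Function.update_self, Function.update_of_ne, hMi, h.one, ne_eq, reduceIte,
      Nat.reduceEqDiff, not_false_eq_true, Nat.reduceAdd, Nat.sub_self] at s5
    refine ⟨_, s5, ⟨?_, ?_, ?_, ?_, ?_, ?_⟩⟩ <;>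
      simp [h.dim, h.letters, h.prod, h.pos, h.one, h.zero]
  obtain ⟨r', s, h'⟩ := main
  have s' := s.snoc P12 (s.bounded.update _ _ _ (by simpa only [h'.dim, h'.prod] using hZ))
  refine ⟨_, s', ⟨?_, ?_, ?_, ?_, ?_, ?_⟩, ?_⟩ <;>
    simp [h'.dim, h'.letters, h'.prod, h'.pos, h'.one, h'.zero]

/-- The leading ones are never read, apart from at most one of them; by `le_pre` there are fewer
than `N` rounds, however large `d` is. -/
theorem prologue_spec [∀ i, NeZero (m i)] (hP : CodeAt P 0 prologue) (h1 : ∀ j < d₀, m j = 1)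
    (hm : ∀ j, d₀ ≤ j → j < d → 2 ≤ m j) (hd : d₀ ≤ d) (hM : ∀ j < d, M j = m j)
    (hZ : d + q + ∏ i, pre m d i ≤ Z) (hMZ : ∀ a, M a ≤ Z)
    (hr : ∀ i, r i = if i = 0 then d else if i = 1 then q else 0) :
    ∃ r', P.Reach Z (10 + 8 * (∏ i, pre m d i)) ⟨0, r, M⟩ ⟨13, r', M⟩ ∧ r' 0 = d ∧ r' 2 = q ∧
      r' 4 = ∏ i, pre m d i ∧ r' 6 = d₀ ∧ r' 1 = d + ∏ i, pre m d i := by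
  have hN := (numbering (pre m d)).pos
  have hb : Config.Bounded Z ⟨0, r, M⟩ :=
    ⟨fun i => by simp only [hr]; split_ifs <;> omega, hMZ⟩
  have start : ∃ r', P.Reach Z 4 ⟨0, r, M⟩ ⟨4, r', M⟩ ∧ ProInv m q d d r' := by
    have hP' := hP
    simp only [prologue, CodeAt] at hP'
    obtain ⟨P0, P1, P2, P3, -⟩ := hP'
    have s0 : P.Reach Z 0 ⟨0, r, M⟩ ⟨0, r, M⟩ := .refl hb
    have s1 := s0.snoc P0 (s0.bounded.update _ _ _ (by simp [hr]; omega))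
    have s2 := s1.snoc P1 (s1.bounded.update _ _ _ (by omega))
    have s3 := s2.snoc P2 (s2.bounded.update _ _ _ (by omega))
    have s4 := s3.snoc P3 (s3.bounded.update _ _ _ (by simp [Instr.exec, hr]; omega))
    refine ⟨_, s4, ⟨?_, ?_, ?_, ?_, ?_, ?_⟩⟩ <;> simp [Instr.exec, hr, blocks_self]
  have rounds : ∀ j, d₀ + j ≤ d → ∃ r', P.Reach Z (4 + 8 * j) ⟨0, r, M⟩ ⟨4, r', M⟩ ∧
      ProInv m q d (d - j) r' := by
    intro j
    induction j with
    | zero => intro _; exact start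
    | succ j ih =>
      intro hj
      obtain ⟨r', s, h⟩ := ih (by omega)
      rw [show d - j = d - (j + 1) + 1 by omega] at h
      obtain ⟨r'', s', h'⟩ := prologue_round hP (by omega) (hm _ (by omega) (by omega))
        (hM _ (by omega)) (by omega) h s.bounded
      exact ⟨r'', s.trans s', h'⟩
  obtain ⟨r', s, h⟩ := rounds (d - d₀) (by omega)
  rw [show d - (d - d₀) = d₀ by omega] at h
  have e : blocks m d d₀ = ∏ i, pre m d i := by
    rw [← blocks_mul m hd, prod_ones (pre_ones h1), mul_one]
  obtain ⟨r'', s', h', hbase⟩ := prologue_end hP h1 (fun j hj => hM j (by omega)) (by omega) h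
    s.bounded
  have := le_pre hm hd le_rfl
  exact ⟨r'', (s.trans s').mono (by omega), h'.dim, h'.letters, h'.prod.trans e, h'.pos,
    e ▸ hbase⟩

end Prologue

/-! ### The theorem -/

/-- Monotonicity of the sizes enters the proof here: it puts all sizes `1` in front. -/
theorem exists_ones {m : ℕ → ℕ} {d : ℕ} (hpos : ∀ i, 1 ≤ m i)
    (h : ∀ i j, i ≤ j → j < d → m i ≤ m j) :
    ∃ d₀ ≤ d, (∀ j < d₀, m j = 1) ∧ ∀ j, d₀ ≤ j → j < d → 2 ≤ m j := by
  classical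
  have hex : ∃ k, d ≤ k ∨ 2 ≤ m k := ⟨d, .inl le_rfl⟩
  refine ⟨Nat.find hex, Nat.find_min' hex (.inl le_rfl), fun j hj => ?_, fun j hj hjd => ?_⟩
  · have := Nat.find_min hex hj
    have := hpos j
    omega
  · rcases Nat.find_spec hex with h' | h'
    · omega
    · exact h'.trans (h _ _ hj hjd)

/-- The program. -/
def rankProgram : Program := prologue ++ mainStmt.code 0 13

/-- The constant. -/
def rankConst : ℕ := mainConst + 18 + 2 * mainStmt.deg

theorem rankProgram_computes {m : ℕ → ℕ} {q d : ℕ} [∀ i, NeZero (m i)]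
    (h : ∀ i j, i ≤ j → j < d → m i ≤ m j) (w : Word q (pre m d)) :
    rankProgram.Computes (input w) (Necklace.mk w).rank (rankConst * (∏ i, pre m d i) ^ 5)
      ((d + q + ∏ i, pre m d i) ^ (rankConst * ∏ i, pre m d i)) := by
  obtain ⟨d₀, hd, h1, hm⟩ := exists_ones (fun i => NeZero.one_le) h
  have hN := (numbering (pre m d)).pos
  have hq : 0 < q := (Nat.zero_le _).trans_lt (w 0).2
  obtain ⟨Z, hZ⟩ : ∃ Z, Z = d + q + ∏ i, pre m d i := ⟨_, rfl⟩
  obtain ⟨V, hV⟩ : ∃ V, V = Z ^ (2 * ∏ i, pre m d i) := ⟨_, rfl⟩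
  have hZV : Z ≤ V := hV ▸ Nat.le_self_pow (by omega) Z
  have hsize : ∀ j < d, (input w).mem j = m j := fun j hj => by simp [input, hj]
  have hletters : ∀ b < ∏ i, pre m d i, (input w).mem (d + b) = w (posOf (pre m d) b) + 1 := by
    intro b hb
    rw [← input_mem_index, index_posOf hb]
  have hMZ : ∀ a, (input w).mem a ≤ Z := by
    intro a
    by_cases ha : a < d
    · rw [hsize a ha]
      have := Finset.single_le_prod' (f := pre m d) (fun i _ => NeZero.one_le)
        (Finset.mem_univ ⟨a, ha⟩)
      change m a ≤ _ at this
      omega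
    · by_cases ha' : a - d < ∏ i, pre m d i
      · have e := hletters _ ha'
        rw [show d + (a - d) = a by omega] at e
        have := (w (posOf (pre m d) (a - d))).2
        omega
      · simp only [input, ha, ha', dite_false]
        omega
  obtain ⟨r, s, r0, r2, r4, r6, r1⟩ := prologue_spec (P := rankProgram) (r := (input w).reg)
    (codeAt_append.mp (codeAt_self [] rankProgram)).1 h1 hm hd hsize hZ.ge hMZ fun _ => rfl
  -- The arrays start with whatever the memory holds; beyond the bound on its size, nothing about
  -- this content is used.
  let σ : Store := ⟨fun x => r (2 * x), fun a i j => (input w).mem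
    (addr (d + ∏ i, pre m d i) a i j), d + ∏ i, pre m d i, (input w).mem⟩
  have hσ : σ.Le V := ⟨fun x => (s.bounded.1 _).trans hZV, fun a i j => (hMZ _).trans hZV,
    by change d + ∏ i, pre m d i ≤ V; omega, fun i => (hMZ _).trans hZV⟩
  obtain ⟨⟨hsafe, hrank⟩, hcost⟩ := main_spec (L := fun b => w (posOf (pre m d) b)) h1 hm hd hσ r0 r2
    r4 r6 rfl hsize hletters (fun k hk hk' => hV ▸ big_pre h1 hm (by omega) (by omega) hk hk')
    (by omega)
  have hblock : block (pre m d) (fun b => w (posOf (pre m d) b)) 0 = w := by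
    funext p
    simp only [block, zero_mul, zero_add, posOf_index]
  rw [hblock] at hrank
  -- `V` has exponent `2 * N`, so numbers up to `V ^ deg` have exponent `2 * deg * N`; this is the
  -- last summand of `rankConst`. The summand `18` covers the `10 + 8 * N` steps of the prologue.
  have hB : V ^ mainStmt.deg ≤ Z ^ (rankConst * ∏ i, pre m d i) := by
    rw [hV, ← pow_mul]
    refine Nat.pow_le_pow_right (by omega) ?_
    calc _ = 2 * mainStmt.deg * ∏ i, pre m d i := by ring
      _ ≤ _ := Nat.mul_le_mul_right _ (Nat.le_add_left _ _)
  have hZB : Z ≤ Z ^ (rankConst * ∏ i, pre m d i) :=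
    Nat.le_self_pow (Nat.mul_pos (by unfold rankConst; omega) hN).ne' Z
  have s' := s.monoBound hZB
  obtain ⟨c, t, hpc, hrel, -⟩ := Stmt.correct (P := rankProgram) (V := V) (by omega) hB mainStmt le_rfl
    0 13 ⟨13, r, (input w).mem⟩ σ (codeAt_append.mp (codeAt_self [] rankProgram)).2 rfl
    ⟨fun _ _ => rfl, r1, fun _ _ => rfl, fun _ _ _ => rfl⟩ s'.bounded hσ hsafe
  obtain ⟨T, hT, e, hbound⟩ := s'.trans t
  rw [← hZ]
  refine ⟨T, hT.trans ?_, ?_, ?_, hbound⟩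
  · have hN5 : ∏ i, pre m d i ≤ (∏ i, pre m d i) ^ 5 := Nat.le_self_pow (by decide) _
    rw [rankConst, add_mul, add_mul]
    omega
  · refine .inl ?_
    rw [show (⟨0, (input w).reg, (input w).mem⟩ : Config) = input w from rfl] at e
    rw [e, hpc, List.getElem?_eq_none_iff, rankProgram, List.length_append,
      show prologue.length = 13 from rfl]
  · rw [show (⟨0, (input w).reg, (input w).mem⟩ : Config) = input w from rfl] at e
    rw [e, ← hrank]
    exact hrel.r 0 (Set.notMem_empty 0)

theorem mainTheorem :
    ∃ (P : Program) (C : ℕ), ∀ (d q : ℕ) (n : Fin d → ℕ) [∀ i, NeZero (n i)], Monotone n →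
      ∀ w : Word q n, P.Computes (input w) (Necklace.mk w).rank (C * (∏ i, n i) ^ 5)
        ((d + q + ∏ i, n i) ^ (C * ∏ i, n i)) := by
  refine ⟨rankProgram, rankConst, fun d q n inst hn => ?_⟩
  -- The sizes are extended by `1` to all indices, so that the sizes of the first `k` dimensions are
  -- restrictions of one function.
  obtain ⟨m, hm, rfl⟩ : ∃ m : ℕ → ℕ, (∀ i, NeZero (m i)) ∧ n = pre m d := by
    refine ⟨fun i => if h : i < d then n ⟨i, h⟩ else 1, fun i => ?_, by ext i; simp⟩
    by_cases h : i < d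
    · simpa [h] using inst ⟨i, h⟩
    · simpa [h] using ⟨one_ne_zero⟩
  exact rankProgram_computes fun i j hij hj =>
    hn (show (⟨i, hij.trans_lt hj⟩ : Fin d) ≤ ⟨j, hj⟩ from hij)

end MultiNecklace

theorem mainTheorem3 :
    ∃ (P : MultiNecklace.Program) (C : ℕ),
      ∀ (d q : ℕ) (n : Fin d → ℕ) [∀ i, NeZero (n i)], Monotone n →
        ∀ w : MultiNecklace.Word q n,
          P.Computes (MultiNecklace.input w) (MultiNecklace.Necklace.mk w).rank
            (C * (∏ i, n i) ^ 5) ((d + q + ∏ i, n i) ^ (C * ∏ i, n i)) := by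
  exact MultiNecklace.mainTheorem
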